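/- Let $(P,\Pi)$ be a (finite-dimensional, Hausdorff, second countable, smooth) Poisson manifold, let $\sharp\colon T^*P\to TP$ be contraction with $\Pi$, $\langle\beta,\sharp\alpha\rangle=\Pi(\alpha,\beta)$, and let $C\subset P$ be an embedded submanifold with conormal bundle $N^*C=(TC)^\circ\subset T^*P|_C$. Regard $T^*P$ as a Lie algebroid with anchor $\sharp$ and bracket $[\alpha,\beta]=\mathcal L_{\sharp\alpha}\beta-\mathcal L_{\sharp\beta}\alpha-d(\Pi(\alpha,\beta))$. Call $C$ *pre-Poisson* if the rank of $TC+\sharp N^*C$ is constant along $C$. A *Lie subalgebroid* of $T^*P$ over $C$ is a smooth vector subbundle $B\subset T^*P|_C$ (of constant rank) with a Lie algebroid structure over $C$ whose anchor is the restriction of $\sharp$ and whose bracket of two sections is the restriction to $C$ of the bracket of any (local) one-forms on $P$ that extend them. 1. $N^*C\cap\sharp^{-1}TC$ is a Lie subalgebroid of $T^*P$ if and only if $C$ is pre-Poisson. 2. Suppose that $C$ is pre-Poisson. Let $\tilde P\subset P$ be an embedded submanifold containing $C$ that is cosymplectic, i.e. $T\tilde P\oplus\sharp N^*\tilde P=TP|_{\tilde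 P}$, with the induced Poisson structure, whose contraction map is $\tilde\sharp\,\eta=\sharp\xi$, where $\xi\in T^*P|_{\tilde P}$ is the extension of $\eta\in T^*\tilde P$ that annihilates $\sharp N^*\tilde P$. Suppose that $C$ is coisotropic in $\tilde P$, i.e. $\tilde\sharp\,N^*_{\tilde P}C\subset TC$, where $N^*_{\tilde P}C\subset T^*\tilde P|_C$ is the annihilator of $TC$. Then $N^*C\cap\sharp^{-1}TC$, with the Lie algebroid structure induced from $T^*P$, is isomorphic as a Lie algebroid over $C$ (over the identity of $C$) to $N^*_{\tilde P}C$, with the Lie algebroid structure induced from $T^*\tilde P$. -/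

import Mathlib

open Manifold
open scoped Manifold ContDiff Topology Bundle

noncomputable section

/-- The tangent space of a manifold `M` modelled on the vector space `E`. -/
abbrev Tan (E : Type*) [NormedAddCommGroup E] [NormedSpace ℝ E] {M : Type*}
    [TopologicalSpace M] [ChartedSpace E M] (x : M) : Type _ :=
  TangentSpace 𝓘(ℝ, E) x

/-- The cotangent space of a manifold `M` modelled on the vector space `E`. -/
abbrev Cot (E : Type*) [NormedAddCommGroup E] [NormedSpace ℝ E] {M : Type*}
    [TopologicalSpace M] [ChartedSpace E M] (x : M) : Type _ :=
  TangentSpace 𝓘(ℝ, E) x →L[ℝ] Bundle.Trivial M ℝ x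

section Calculus

variable {E : Type*} [NormedAddCommGroup E] [NormedSpace ℝ E]
  {M : Type*} [TopologicalSpace M] [ChartedSpace E M] [IsManifold 𝓘(ℝ, E) ∞ M]

/-- The differential `dh` of a real function. -/
def dfun (h : M → ℝ) (x : M) : Cot E x := mfderiv 𝓘(ℝ, E) 𝓘(ℝ, ℝ) h x

/-- Smoothness on `U` of a real function. -/
def SmoothFunOn (E : Type*) [NormedAddCommGroup E] [NormedSpace ℝ E] {M : Type*}
    [TopologicalSpace M] [ChartedSpace E M] (h : M → ℝ) (U : Set M) : Prop :=
  ContMDiffOn 𝓘(ℝ, E) 𝓘(ℝ, ℝ) ∞ h U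

/-- Smoothness on `U` of a vector field. -/
def SmoothFieldOn (X : ∀ x : M, Tan E x) (U : Set M) : Prop :=
  ContMDiffOn 𝓘(ℝ, E) (𝓘(ℝ, E).prod 𝓘(ℝ, E)) ∞
    (fun x => (⟨x, X x⟩ : TangentBundle 𝓘(ℝ, E) M)) U

/-- Smoothness on `U` of a differential one-form. -/
def SmoothFormOn (α : ∀ x : M, Cot E x) (U : Set M) : Prop :=
  ContMDiffOn 𝓘(ℝ, E) (𝓘(ℝ, E).prod 𝓘(ℝ, E →L[ℝ] ℝ)) ∞
    (fun x => Bundle.TotalSpace.mk' (E →L[ℝ] ℝ) (E := fun x : M => Cot E x) x (α x)) U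

/-- `(L_X β)(Z) = X (β Z) - β [X, Z]`: the Lie derivative of the one-form `β` along `X`, evaluated
on the vector field `Z`. -/
def lieDerivForm (X : ∀ x : M, Tan E x) (β : ∀ x : M, Cot E x) (Z : ∀ x : M, Tan E x)
    (x : M) : ℝ :=
  dfun (E := E) (fun y => β y (Z y)) x (X x) - β x (VectorField.mlieBracket 𝓘(ℝ, E) X Z x)

end Calculus

section Poisson

variable {E : Type*} [NormedAddCommGroup E] [NormedSpace ℝ E]
  {M : Type*} [TopologicalSpace M] [ChartedSpace E M] [IsManifold 𝓘(ℝ, E) ∞ M]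

/-- The bracket `{g, h} = Π(dg, dh)` of functions, for the bivector field `Π` with contraction map
`sharp : T*M → TM`, that is `Π(α, β) = β (sharp α)`. -/
def poissonBracket (sharp : ∀ x : M, Cot E x →L[ℝ] Tan E x) (g h : M → ℝ) (x : M) : ℝ :=
  dfun (E := E) h x (sharp x (dfun (E := E) g x))

/-- `sharp` is the contraction map of a Poisson bivector field `Π(α, β) = β (sharp α)`. The
condition `[Π, Π] = 0` is the Jacobi identity for the bracket of (locally defined) functions. -/
structure IsPoisson (sharp : ∀ x : M, Cot E x →L[ℝ] Tan E x) : Prop where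
  skew : ∀ (x : M) (α β : Cot E x), β (sharp x α) = -α (sharp x β)
  smooth : ContMDiff 𝓘(ℝ, E) (𝓘(ℝ, E).prod 𝓘(ℝ, (E →L[ℝ] ℝ) →L[ℝ] E)) ∞
    (fun x => Bundle.TotalSpace.mk' ((E →L[ℝ] ℝ) →L[ℝ] E)
      (E := fun x : M => Cot E x →L[ℝ] Tan E x) x (sharp x))
  jacobi : ∀ (U : Set M) (g₁ g₂ g₃ : M → ℝ), IsOpen U →
    SmoothFunOn E g₁ U → SmoothFunOn E g₂ U → SmoothFunOn E g₃ U → ∀ x ∈ U,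
    poissonBracket sharp g₁ (poissonBracket sharp g₂ g₃) x
      + poissonBracket sharp g₂ (poissonBracket sharp g₃ g₁) x
      + poissonBracket sharp g₃ (poissonBracket sharp g₁ g₂) x = 0

/-- The Lie bracket of the cotangent Lie algebroid of a Poisson manifold,
`[α, β] = L_{♯α} β - L_{♯β} α - d(Π(α, β))`, evaluated on the vector field `Z` at `x`. The anchor
of this Lie algebroid is `♯`. -/
def koszul (sharp : ∀ x : M, Cot E x →L[ℝ] Tan E x) (α β : ∀ x : M, Cot E x)
    (Z : ∀ x : M, Tan E x) (x : M) : ℝ :=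
  lieDerivForm (fun y => sharp y (α y)) β Z x - lieDerivForm (fun y => sharp y (β y)) α Z x
    - dfun (E := E) (fun y => β y (sharp y (α y))) x (Z x)

end Poisson

section Submanifold

variable {E : Type*} [NormedAddCommGroup E] [NormedSpace ℝ E]
  {P : Type*} [TopologicalSpace P] [ChartedSpace E P]
  {F : Type*} [NormedAddCommGroup F] [NormedSpace ℝ F]
  {C : Type*} [TopologicalSpace C] [ChartedSpace F C]

variable (F) in
/-- The tangent space `T_cC`, as a subspace of `T_{f c}P`, for a submanifold `f : C → P`. -/
abbrev tangentAlong (f : C → P) (c : C) : Submodule ℝ (Tan E (f c)) :=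
  LinearMap.range (mfderiv 𝓘(ℝ, F) 𝓘(ℝ, E) f c).toLinearMap

/-- The annihilator `W° ⊆ T*_xP` of a subspace `W ⊆ T_xP`. -/
def ann {x : P} (W : Submodule ℝ (Tan E x)) : Submodule ℝ (Cot E x) where
  carrier := {ξ | ∀ v ∈ W, ξ v = 0}
  add_mem' := fun ha hb v hv => by simp [ha v hv, hb v hv]
  zero_mem' := fun v _ => by simp
  smul_mem' := fun r a ha v hv => by simp [ha v hv]

variable (F) in
/-- The conormal bundle `N*C` of a submanifold `f : C → P`. -/
def conormal (f : C → P) (c : C) : Submodule ℝ (Cot E (f c)) := ann (tangentAlong F f c)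

variable (F) in
/-- The subspace `♯N*C` of `T_{f c}P`. -/
def sharpConormal (sharp : ∀ x : P, Cot E x →L[ℝ] Tan E x) (f : C → P) (c : C) :
    Submodule ℝ (Tan E (f c)) :=
  (conormal F f c).map (sharp (f c)).toLinearMap

variable (F) in
/-- The family of subspaces `N*C ∩ ♯⁻¹TC` of `T*P|_C`. -/
def charConormal (sharp : ∀ x : P, Cot E x →L[ℝ] Tan E x) (f : C → P) (c : C) :
    Submodule ℝ (Cot E (f c)) :=
  conormal F f c ⊓ (tangentAlong F f c).comap (sharp (f c)).toLinearMap

variable (F) in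
/-- `C` is pre-Poisson: the rank of `TC + ♯N*C` is constant along `C`. -/
def IsPrePoisson (sharp : ∀ x : P, Cot E x →L[ℝ] Tan E x) (f : C → P) : Prop :=
  ∃ k : ℕ, ∀ c, Module.finrank ℝ ↥(tangentAlong F f c ⊔ sharpConormal F sharp f c) = k

variable (F) in
/-- `C` is coisotropic: `♯N*C ⊆ TC`. -/
def IsCoisotropic (sharp : ∀ x : P, Cot E x →L[ℝ] Tan E x) (f : C → P) : Prop :=
  ∀ c, sharpConormal F sharp f c ≤ tangentAlong F f c

variable (F) in
/-- `C` is cosymplectic: `TC ⊕ ♯N*C = TP|_C`. -/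
def IsCosymplectic (sharp : ∀ x : P, Cot E x →L[ℝ] Tan E x) (f : C → P) : Prop :=
  ∀ c, IsCompl (tangentAlong F f c) (sharpConormal F sharp f c)

open scoped Classical in
/-- For a submanifold `f : C → P`, the linear map `T_{f c}P → T_cC` which is the identity on `T_cC`
and vanishes on `♯N*C`. (Junk value `0` where `f` is not immersive or `C` not cosymplectic.) -/
def cosymplecticProj [FiniteDimensional ℝ E] (sharp : ∀ x : P, Cot E x →L[ℝ] Tan E x)
    (f : C → P) (c : C) : Tan E (f c) →L[ℝ] Tan F c :=
  if h : Function.Injective (mfderiv 𝓘(ℝ, F) 𝓘(ℝ, E) f c).toLinearMap ∧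
      IsCompl (tangentAlong F f c) (sharpConormal F sharp f c) then
    haveI : FiniteDimensional ℝ (Tan E (f c)) := inferInstanceAs (FiniteDimensional ℝ E)
    haveI : T2Space (Tan E (f c)) := inferInstanceAs (T2Space E)
    LinearMap.toContinuousLinearMap
      ((LinearEquiv.ofInjective _ h.1).symm.toLinearMap ∘ₗ
        (tangentAlong F f c).projectionOnto (sharpConormal F sharp f c) h.2)
  else 0

/-- The contraction map `T*C → TC` of the bivector field induced on a cosymplectic submanifold `C`:
extend `η ∈ T*_cC` to the covector on `T_{f c}P` that annihilates `♯N*C`, and apply `♯`. The result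
is tangent to `C`, hence unchanged by the projection. -/
def inducedSharp [FiniteDimensional ℝ E] (sharp : ∀ x : P, Cot E x →L[ℝ] Tan E x)
    (f : C → P) (c : C) : Cot F c →L[ℝ] Tan F c :=
  cosymplecticProj sharp f c ∘L sharp (f c) ∘L
    ContinuousLinearMap.precomp ℝ (cosymplecticProj sharp f c)

end Submanifold

section Algebroid

variable {E : Type*} [NormedAddCommGroup E] [NormedSpace ℝ E]
  {P : Type*} [TopologicalSpace P] [ChartedSpace E P] [IsManifold 𝓘(ℝ, E) ∞ P]
  {F : Type*} [NormedAddCommGroup F] [NormedSpace ℝ F]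
  {C : Type*} [TopologicalSpace C] [ChartedSpace F C] [IsManifold 𝓘(ℝ, F) ∞ C]

variable (F) in
/-- Smoothness on `U` of a section of `T*P|_C`, for `f : C → P`. -/
def SmoothAlongOn (f : C → P) (σ : ∀ c, Cot E (f c)) (U : Set C) : Prop :=
  ContMDiffOn 𝓘(ℝ, F) (𝓘(ℝ, E).prod 𝓘(ℝ, E →L[ℝ] ℝ)) ∞
    (fun c => Bundle.TotalSpace.mk' (E →L[ℝ] ℝ) (E := fun x : P => Cot E x) (f c) (σ c)) U

variable (F) in
/-- The family `B` of subspaces is a smooth vector subbundle of `T*P|_C`: it has constant rank `k`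
and, around every point, a smooth frame. -/
def IsSmoothSubbundle (f : C → P) (B : ∀ c, Submodule ℝ (Cot E (f c))) : Prop :=
  ∃ k : ℕ, ∀ c₀ : C, ∃ U : Set C, IsOpen U ∧ c₀ ∈ U ∧ ∃ s : Fin k → ∀ c, Cot E (f c),
    (∀ i, SmoothAlongOn F f (s i) U) ∧
    ∀ c ∈ U, LinearIndependent ℝ (fun i => s i c) ∧ Submodule.span ℝ (Set.range fun i => s i c) = B c

variable (F) in
/-- `σ` is a smooth section of the subbundle `B` of `T*P|_C`. -/
structure IsSection (f : C → P) (B : ∀ c, Submodule ℝ (Cot E (f c)))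
    (σ : ∀ c, Cot E (f c)) : Prop where
  mem : ∀ c, σ c ∈ B c
  smooth : SmoothAlongOn F f σ Set.univ

variable (F) in
/-- A Lie algebroid structure over `C` on a subbundle `B` of `T*P|_C`: a bundle map (the anchor)
`B → TC` and a Lie bracket on the smooth sections of `B` satisfying the Leibniz rule. Only values
of `bracket` on smooth sections matter. Bilinearity over `ℝ` follows from `add`, `leibniz` (with
constant `h`) and `skew`. -/
structure LieAlgebroid (f : C → P) (B : ∀ c, Submodule ℝ (Cot E (f c))) where
  anchor : ∀ c, B c →ₗ[ℝ] Tan F c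
  bracket : (∀ c, Cot E (f c)) → (∀ c, Cot E (f c)) → ∀ c, Cot E (f c)
  anchor_smooth : ∀ σ (hσ : IsSection F f B σ),
    SmoothFieldOn (fun c => anchor c ⟨σ c, hσ.mem c⟩) Set.univ
  bracket_isSection : ∀ σ τ, IsSection F f B σ → IsSection F f B τ →
    IsSection F f B (bracket σ τ)
  add : ∀ σ τ₁ τ₂, IsSection F f B σ → IsSection F f B τ₁ → IsSection F f B τ₂ →
    bracket σ (τ₁ + τ₂) = bracket σ τ₁ + bracket σ τ₂
  skew : ∀ σ τ, IsSection F f B σ → IsSection F f B τ → bracket σ τ = -bracket τ σ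
  jacobi : ∀ σ τ υ, IsSection F f B σ → IsSection F f B τ → IsSection F f B υ →
    bracket σ (bracket τ υ) + bracket τ (bracket υ σ) + bracket υ (bracket σ τ) = 0
  leibniz : ∀ σ τ (hσ : IsSection F f B σ), IsSection F f B τ →
    ∀ h : C → ℝ, SmoothFunOn F h Set.univ → ∀ c,
    bracket σ (fun c => h c • τ c) c =
      h c • bracket σ τ c + (dfun (E := F) h c (anchor c ⟨σ c, hσ.mem c⟩) : ℝ) • τ c

/-- The Lie algebroid structure `L` on `B` is the one induced by the cotangent Lie algebroid of
`(P, ♯)`: its anchor is the restriction of `♯`, and the bracket of two sections of `B` is the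
restriction to `C` of the bracket of any one-forms (on open sets of `P`) extending them. -/
structure LieAlgebroid.IsInduced (sharp : ∀ x : P, Cot E x →L[ℝ] Tan E x) {f : C → P}
    {B : ∀ c, Submodule ℝ (Cot E (f c))} (L : LieAlgebroid F f B) : Prop where
  anchor : ∀ c (ξ : B c), mfderiv 𝓘(ℝ, F) 𝓘(ℝ, E) f c (L.anchor c ξ) = sharp (f c) (ξ : Cot E (f c))
  bracket : ∀ σ τ, IsSection F f B σ → IsSection F f B τ →
    ∀ (U : Set P) (α β : ∀ x : P, Cot E x) (Z : ∀ x : P, Tan E x), IsOpen U →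
    SmoothFormOn α U → SmoothFormOn β U → SmoothFieldOn Z U →
    (∀ c, f c ∈ U → α (f c) = σ c) → (∀ c, f c ∈ U → β (f c) = τ c) →
    ∀ c, f c ∈ U → L.bracket σ τ c (Z (f c)) = koszul sharp α β Z (f c)

variable (F) in
/-- `B` is a Lie subalgebroid, over the submanifold `f : C → P`, of the cotangent Lie algebroid of
`(P, ♯)`: a vector subbundle with a Lie algebroid structure compatible with the inclusion. -/
def IsLieSubalgebroid (sharp : ∀ x : P, Cot E x →L[ℝ] Tan E x) (f : C → P)
    (B : ∀ c, Submodule ℝ (Cot E (f c))) : Prop :=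
  IsSmoothSubbundle F f B ∧ ∃ L : LieAlgebroid F f B, L.IsInduced sharp

variable {G : Type*} [NormedAddCommGroup G] [NormedSpace ℝ G]
  {Q : Type*} [TopologicalSpace Q] [ChartedSpace G Q] [IsManifold 𝓘(ℝ, G) ∞ Q]

/-- An isomorphism, over the identity of `C`, of Lie algebroids over `C`: a smooth vector bundle
isomorphism that intertwines the anchors and the brackets. -/
structure LieAlgebroid.Iso {f : C → P} {B : ∀ c, Submodule ℝ (Cot E (f c))}
    {g : C → Q} {B' : ∀ c, Submodule ℝ (Cot G (g c))}
    (L : LieAlgebroid F f B) (L' : LieAlgebroid F g B') where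
  toFun : ∀ c, B c ≃ₗ[ℝ] B' c
  smooth : ∀ σ (hσ : IsSection F f B σ),
    IsSection F g B' (fun c => (toFun c ⟨σ c, hσ.mem c⟩ : Cot G (g c)))
  symm_smooth : ∀ τ (hτ : IsSection F g B' τ),
    IsSection F f B (fun c => ((toFun c).symm ⟨τ c, hτ.mem c⟩ : Cot E (f c)))
  anchor : ∀ c (ξ : B c), L'.anchor c (toFun c ξ) = L.anchor c ξ
  bracket : ∀ σ τ (hσ : IsSection F f B σ) (hτ : IsSection F f B τ) (c : C),
    (toFun c ⟨L.bracket σ τ c, (L.bracket_isSection σ τ hσ hτ).mem c⟩ : Cot G (g c)) =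
      L'.bracket (fun c => (toFun c ⟨σ c, hσ.mem c⟩ : Cot G (g c)))
        (fun c => (toFun c ⟨τ c, hτ.mem c⟩ : Cot G (g c))) c

end Algebroid

end

/-! Write B for N*C ∩ ♯⁻¹TC. Skewness, ξ(♯η) = -η(♯ξ), makes B the annihilator of TC + ♯N*C
(`charConormal_eq_ann`). The two ranks therefore add up to dim P, and one is constant along C
exactly when the other is. A subbundle has constant rank by definition. Conversely, B is locally the
kernel of a smooth family of linear maps, and kernels of constant rank have smooth local frames
(`exists_smooth_frame_ker`). So smoothness of B as a subbundle is equivalent to C being pre-Poisson.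

The bracket on smooth sections of B needs no condition on the rank. In a chart the bracket of
one-forms is the first-order expression `lieForm`, in which each form is differentiated only along ♯
of the other. For forms that extend sections of B these directions are tangent to C, so the bracket
along C depends only on the sections (`lieForm_congr_of_tangent`). It is again a section of B
(`IsCharCovector.lieForm`): conormality follows by differentiating β(♯α) = 0 along C, and tangency
from ♯[α, β] = [♯α, ♯β], which is a form of the Jacobi identity for Π. The axioms of a Lie algebroid
are then inherited from identities for `lieForm` on a vector space. Charts adapted to the immersion,
in which C is a linear subspace, reduce everything to calculus there, and comparison with the
chart-free `koszul` shows that the local brackets agree.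

For the second part, a covector ξ in B kills ♯N*P̃: if η is conormal to P̃, then ξ(♯η) = -η(♯ξ) = 0,
as ♯ξ lies in TC ⊆ TP̃. Hence ξ is the extension, annihilating ♯N*P̃, of its own restriction to TP̃.
Coisotropy says that, conversely, such extensions of conormal covectors of C in P̃ lie in B. This
gives the bundle isomorphism `restrictConormal`. The structure of B is transported along it, so that
the algebroid axioms come for free, and it remains to see that the result is induced from T*P̃
(`isInduced_transport`). This holds because the bracket in P of extensions annihilating ♯N*P̃
restricts to the bracket in P̃ (`koszul_inducedSharp`, computed in `lieForm_inducedContraction`). -/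

set_option linter.unusedSectionVars false

noncomputable section

/-! ### The bracket of one-forms on a vector space. -/

section VectorSpace

variable {V : Type*} [NormedAddCommGroup V] [NormedSpace ℝ V]

instance instNormedAddCommGroupContraction : NormedAddCommGroup ((V →L[ℝ] ℝ) →L[ℝ] V) :=
  ContinuousLinearMap.toNormedAddCommGroup

instance instNormedSpaceContraction : NormedSpace ℝ ((V →L[ℝ] ℝ) →L[ℝ] V) :=
  ContinuousLinearMap.toNormedSpace

instance instNormedAddCommGroupContractionDeriv :
    NormedAddCommGroup (V →L[ℝ] (V →L[ℝ] ℝ) →L[ℝ] V) :=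
  ContinuousLinearMap.toNormedAddCommGroup

instance instNormedSpaceContractionDeriv : NormedSpace ℝ (V →L[ℝ] (V →L[ℝ] ℝ) →L[ℝ] V) :=
  ContinuousLinearMap.toNormedSpace

instance instNormedAddCommGroupContractionFlip :
    NormedAddCommGroup ((V →L[ℝ] ℝ) →L[ℝ] V →L[ℝ] V) :=
  ContinuousLinearMap.toNormedAddCommGroup

instance instNormedSpaceContractionFlip : NormedSpace ℝ ((V →L[ℝ] ℝ) →L[ℝ] V →L[ℝ] V) :=
  ContinuousLinearMap.toNormedSpace

/-- The bracket of one-forms on a vector space defined by a skew contraction map `S`: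
`D_{Sα} β - D_{Sβ} α + β ((D S) α)`. -/
def lieForm (S : V → (V →L[ℝ] ℝ) →L[ℝ] V) (α β : V → V →L[ℝ] ℝ) (y : V) : V →L[ℝ] ℝ :=
  fderiv ℝ β y (S y (α y)) - fderiv ℝ α y (S y (β y)) + (β y).comp ((fderiv ℝ S y).flip (α y))

/-- The contraction map `T` of a bilinear form on the dual is skew. -/
def IsSkew (T : (V →L[ℝ] ℝ) →L[ℝ] V) : Prop := ∀ a b : V →L[ℝ] ℝ, b (T a) = -a (T b)

variable {S : V → (V →L[ℝ] ℝ) →L[ℝ] V} {α β γ : V → V →L[ℝ] ℝ} {y : V}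

lemma lieForm_apply (z : V) : lieForm S α β y z =
    fderiv ℝ β y (S y (α y)) z - fderiv ℝ α y (S y (β y)) z + β y (fderiv ℝ S y z (α y)) := by
  simp [lieForm]

lemma fderiv_clm_apply_apply {W₁ W₂ : Type*} [NormedAddCommGroup W₁] [NormedSpace ℝ W₁]
    [NormedAddCommGroup W₂] [NormedSpace ℝ W₂] {A : V → W₁ →L[ℝ] W₂} {b : V → W₁}
    (hA : DifferentiableAt ℝ A y) (hb : DifferentiableAt ℝ b y) (v : V) :
    fderiv ℝ (fun x => A x (b x)) y v = fderiv ℝ A y v (b y) + A y (fderiv ℝ b y v) := by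
  rw [(hA.hasFDerivAt.clm_apply hb.hasFDerivAt).fderiv]
  simp [add_comm]

lemma skew_fderiv (hS : DifferentiableAt ℝ S y) (hskew : ∀ᶠ x in 𝓝 y, IsSkew (S x))
    (a b : V →L[ℝ] ℝ) (v : V) : b (fderiv ℝ S y v a) = -a (fderiv ℝ S y v b) := by
  have key : ∀ a b : V →L[ℝ] ℝ, fderiv ℝ (fun x => b (S x a)) y v = b (fderiv ℝ S y v a) := by
    intro a b
    have h1 : DifferentiableAt ℝ (fun x => S x a) y := hS.clm_apply (differentiableAt_const a)
    have := fderiv_clm_apply_apply (differentiableAt_const b) h1 v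
    rw [this, fderiv_clm_apply_apply hS (differentiableAt_const a)]
    simp
  rw [← key, ← key]
  have : (fun x => b (S x a)) =ᶠ[𝓝 y] fun x => -a (S x b) := by
    filter_upwards [hskew] with x hx using hx a b
  rw [this.fderiv_eq]
  simp [fderiv_fun_neg]

lemma mlieBracket_vectorSpace (X Z : V → V) (x : V) :
    VectorField.mlieBracket 𝓘(ℝ, V) (M := V) X Z x = VectorField.lieBracket ℝ X Z x := by
  have h := congrFun (VectorField.mlieBracketWithin_eq_lieBracketWithin (𝕜 := ℝ) (V := X) (W := Z)
    (s := Set.univ)) x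
  rw [VectorField.lieBracketWithin_univ] at h
  exact (congrFun VectorField.mlieBracketWithin_univ x).symm.trans h

lemma lieDerivForm_vectorSpace (X : V → V) (β : V → V →L[ℝ] ℝ) (Z : V → V) (x : V) :
    lieDerivForm (E := V) (M := V) X β Z x =
      fderiv ℝ (fun y => β y (Z y)) x (X x) - β x (VectorField.lieBracket ℝ X Z x) := by
  rw [← mlieBracket_vectorSpace, ← mfderiv_eq_fderiv]
  rfl

/-- After expansion by the product rule the derivatives of `Z` cancel, so the expression is
tensorial in `Z`. Skewness of `S` removes the term with the derivative of `β` along `Z`, and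
skewness of the derivative of `S` turns the remaining term into the last one of `lieForm`. -/
lemma koszul_eq_lieForm {Z : V → V} (hS : DifferentiableAt ℝ S y)
    (hskew : ∀ᶠ x in 𝓝 y, IsSkew (S x))
    (hα : DifferentiableAt ℝ α y) (hβ : DifferentiableAt ℝ β y) (hZ : DifferentiableAt ℝ Z y) :
    koszul (E := V) (M := V) S α β Z y = lieForm S α β y (Z y) := by
  have hSα : DifferentiableAt ℝ (fun x => S x (α x)) y := hS.clm_apply hα
  have hSβ : DifferentiableAt ℝ (fun x => S x (β x)) y := hS.clm_apply hβ
  have e3 : dfun (E := V) (M := V) (fun x => β x (S x (α x))) y (Z y) =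
      fderiv ℝ (fun x => β x (S x (α x))) y (Z y) := by
    simp only [dfun, mfderiv_eq_fderiv]
    rfl
  have e0 : koszul (E := V) (M := V) S α β Z y =
      lieDerivForm (E := V) (M := V) (fun x => S x (α x)) β Z y
      - lieDerivForm (E := V) (M := V) (fun x => S x (β x)) α Z y
      - dfun (E := V) (M := V) (fun x => β x (S x (α x))) y (Z y) := rfl
  rw [e0, lieDerivForm_vectorSpace, lieDerivForm_vectorSpace, e3, lieForm_apply, VectorField.lieBracket, VectorField.lieBracket,
    fderiv_clm_apply_apply hβ hZ, fderiv_clm_apply_apply hα hZ, fderiv_clm_apply_apply hβ hSα,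
    fderiv_clm_apply_apply hS hα, fderiv_clm_apply_apply hS hβ]
  have s1 := skew_fderiv hS hskew (α y) (β y) (Z y)
  have s2 := hskew.self_of_nhds (α y) (fderiv ℝ β y (Z y))
  have s3 := hskew.self_of_nhds (β y) (fderiv ℝ α y (Z y))
  simp only [map_add, map_sub]
  linarith

lemma lieForm_swap (hS : DifferentiableAt ℝ S y)
    (hskew : ∀ᶠ x in 𝓝 y, IsSkew (S x)) :
    lieForm S β α y = -lieForm S α β y := by
  ext z
  have := skew_fderiv hS hskew (α y) (β y) z
  simp only [lieForm_apply, neg_apply]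
  linarith

lemma lieForm_add (hβ : DifferentiableAt ℝ β y) (hγ : DifferentiableAt ℝ γ y) :
    lieForm S α (β + γ) y = lieForm S α β y + lieForm S α γ y := by
  ext z
  simp only [lieForm_apply, add_apply, fderiv_add hβ hγ, Pi.add_apply, map_add]
  ring

lemma lieForm_smul {h : V → ℝ} (hh : DifferentiableAt ℝ h y) (hβ : DifferentiableAt ℝ β y) :
    lieForm S α (fun x => h x • β x) y =
      h y • lieForm S α β y + fderiv ℝ h y (S y (α y)) • β y := by
  ext z
  simp only [lieForm_apply, add_apply, fderiv_fun_smul hh hβ,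
    smul_apply, ContinuousLinearMap.smulRight_apply, map_smul, smul_eq_mul]
  ring

lemma lieForm_congr {S' : V → (V →L[ℝ] ℝ) →L[ℝ] V} {α' β' : V → V →L[ℝ] ℝ} (hS : S =ᶠ[𝓝 y] S')
    (hα : α =ᶠ[𝓝 y] α') (hβ : β =ᶠ[𝓝 y] β') : lieForm S α β y = lieForm S' α' β' y := by
  simp only [lieForm, hS.fderiv_eq, hα.fderiv_eq, hβ.fderiv_eq, hS.self_of_nhds, hα.self_of_nhds,
    hβ.self_of_nhds]

lemma ContDiffOn.lieForm [FiniteDimensional ℝ V] {W : Set V} (hW : IsOpen W) (hS : ContDiffOn ℝ ∞ S W)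
    (hα : ContDiffOn ℝ ∞ α W) (hβ : ContDiffOn ℝ ∞ β W) : ContDiffOn ℝ ∞ (lieForm S α β) W := by
  have dS := hS.fderiv_of_isOpen hW (m := ∞) le_rfl
  have dα := hα.fderiv_of_isOpen hW (m := ∞) le_rfl
  have dβ := hβ.fderiv_of_isOpen hW (m := ∞) le_rfl
  refine contDiffOn_clm_apply.2 fun z => ?_
  simp only [lieForm_apply]
  exact (((dβ.clm_apply (hS.clm_apply hα)).clm_apply contDiffOn_const).sub
    ((dα.clm_apply (hS.clm_apply hβ)).clm_apply contDiffOn_const)).add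
    (hβ.clm_apply ((dS.clm_apply contDiffOn_const).clm_apply hα))

/-- The Jacobi identity `[Π, Π] = 0` for a contraction map on a vector space. -/
def JacobiAt (S : V → (V →L[ℝ] ℝ) →L[ℝ] V) (y : V) : Prop :=
  ∀ a b c : V →L[ℝ] ℝ, c (fderiv ℝ S y (S y a) b) + a (fderiv ℝ S y (S y b) c)
    + b (fderiv ℝ S y (S y c) a) = 0

lemma eq_of_forall_dual {v w : V} [FiniteDimensional ℝ V] (h : ∀ c : V →L[ℝ] ℝ, c v = c w) :
    v = w := by
  by_contra hne
  obtain ⟨c, hc⟩ := SeparatingDual.exists_ne_zero (R := ℝ) (sub_ne_zero.2 hne)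
  exact hc (by simp [h c])

/-- The anchor is a homomorphism, S[α, β] = [Sα, Sβ]. Paired with a constant covector `c`, the terms
with derivatives of the forms match by skewness of `S`, and what is left is the Jacobi identity for
the values of `α`, `β` and `c`. -/
lemma sharp_lieForm [FiniteDimensional ℝ V] (hS : DifferentiableAt ℝ S y)
    (hskew : ∀ᶠ x in 𝓝 y, IsSkew (S x)) (hJ : JacobiAt S y)
    (hα : DifferentiableAt ℝ α y) (hβ : DifferentiableAt ℝ β y) :
    S y (lieForm S α β y) = fderiv ℝ (fun x => S x (β x)) y (S y (α y))
      - fderiv ℝ (fun x => S x (α x)) y (S y (β y)) := by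
  refine eq_of_forall_dual fun c => ?_
  rw [fderiv_clm_apply_apply hS hα, fderiv_clm_apply_apply hS hβ,
    hskew.self_of_nhds (lieForm S α β y) c, lieForm_apply]
  simp only [map_add, map_sub]
  have j := hJ (α y) (β y) c
  have s1 := hskew.self_of_nhds (fderiv ℝ β y (S y (α y))) c
  have s2 := hskew.self_of_nhds (fderiv ℝ α y (S y (β y))) c
  have s3 := skew_fderiv hS hskew c (α y) (S y (β y))
  linarith

lemma ContDiffAt.differentiableAt_fderiv {W₁ : Type*} [NormedAddCommGroup W₁] [NormedSpace ℝ W₁]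
    {A : V → W₁} (hA : ContDiffAt ℝ 2 A y) : DifferentiableAt ℝ (fderiv ℝ A) y :=
  (hA.fderiv_right (m := 1) (by norm_num [one_add_one_eq_two])).differentiableAt one_ne_zero

/-- The product rule applied to three triple products gives nine terms; they feed the expansion of
the nested brackets in `lieForm_jacobi`. -/
lemma fderiv_lieForm_apply (hS : ContDiffAt ℝ 2 S y) (hα : ContDiffAt ℝ 2 α y)
    (hβ : ContDiffAt ℝ 2 β y) (v z : V) : fderiv ℝ (lieForm S α β) y v z =
      fderiv ℝ (fderiv ℝ β) y v (S y (α y)) z + fderiv ℝ β y (fderiv ℝ S y v (α y)) z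
      + fderiv ℝ β y (S y (fderiv ℝ α y v)) z
      - (fderiv ℝ (fderiv ℝ α) y v (S y (β y)) z + fderiv ℝ α y (fderiv ℝ S y v (β y)) z
      + fderiv ℝ α y (S y (fderiv ℝ β y v)) z)
      + (fderiv ℝ β y v (fderiv ℝ S y z (α y)) + β y (fderiv ℝ (fderiv ℝ S) y v z (α y))
      + β y (fderiv ℝ S y z (fderiv ℝ α y v))) := by
  have dS := hS.differentiableAt two_ne_zero
  have dα := hα.differentiableAt two_ne_zero
  have dβ := hβ.differentiableAt two_ne_zero
  have d2S := hS.differentiableAt_fderiv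
  have d2α := hα.differentiableAt_fderiv
  have d2β := hβ.differentiableAt_fderiv
  have dSα : DifferentiableAt ℝ (fun x => S x (α x)) y := dS.clm_apply dα
  have dSβ : DifferentiableAt ℝ (fun x => S x (β x)) y := dS.clm_apply dβ
  have d1 : DifferentiableAt ℝ (fun x => fderiv ℝ β x (S x (α x))) y := d2β.clm_apply dSα
  have d2 : DifferentiableAt ℝ (fun x => fderiv ℝ α x (S x (β x))) y := d2α.clm_apply dSβ
  have d3 : DifferentiableAt ℝ (fun x => fderiv ℝ S x z) y :=
    d2S.clm_apply (differentiableAt_const z)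
  have d4 : DifferentiableAt ℝ (fun x => fderiv ℝ S x z (α x)) y := d3.clm_apply dα
  have hd : DifferentiableAt ℝ (lieForm S α β) y :=
    (d1.sub d2).add (dβ.clm_comp
      (((ContinuousLinearMap.flipₗᵢ ℝ V (V →L[ℝ] ℝ) V).toContinuousLinearEquiv.differentiableAt.comp
        y d2S).clm_apply dα))
  have h0 := fderiv_clm_apply_apply hd (differentiableAt_const z) v
  simp only [fderiv_fun_const, Pi.zero_apply, zero_apply, map_zero, add_zero] at h0
  rw [← h0]
  simp only [lieForm_apply]
  have e1 := fderiv_clm_apply_apply d1 (differentiableAt_const z) v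
  have e2 := fderiv_clm_apply_apply d2 (differentiableAt_const z) v
  have e3 := fderiv_clm_apply_apply dβ d4 v
  rw [fderiv_clm_apply_apply d2β dSα, fderiv_clm_apply_apply dS dα] at e1
  rw [fderiv_clm_apply_apply d2α dSβ, fderiv_clm_apply_apply dS dβ] at e2
  rw [fderiv_clm_apply_apply d3 dα, fderiv_clm_apply_apply d2S (differentiableAt_const z)] at e3
  simp only [fderiv_fun_const, Pi.zero_apply, zero_apply, map_zero, add_zero, map_add,
    add_apply] at e1 e2 e3
  rw [fderiv_fun_add ((d1.clm_apply (differentiableAt_const z)).fun_sub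
      (d2.clm_apply (differentiableAt_const z))) (dβ.clm_apply d4),
    fderiv_fun_sub (d1.clm_apply (differentiableAt_const z))
      (d2.clm_apply (differentiableAt_const z))]
  simp only [add_apply, sub_apply, e1, e2, e3]
  ring

/-- The Jacobi identity holds near `y`, so it may be differentiated there. The result controls the
terms of the nested brackets in which `S` is differentiated twice. -/
lemma fderiv_jacobiAt (hS : ContDiffAt ℝ 2 S y) (hJ : ∀ᶠ x in 𝓝 y, JacobiAt S x)
    (a b c : V →L[ℝ] ℝ) (z : V) :
    c (fderiv ℝ (fderiv ℝ S) y z (S y a) b) + c (fderiv ℝ S y (fderiv ℝ S y z a) b)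
    + (a (fderiv ℝ (fderiv ℝ S) y z (S y b) c) + a (fderiv ℝ S y (fderiv ℝ S y z b) c))
    + (b (fderiv ℝ (fderiv ℝ S) y z (S y c) a) + b (fderiv ℝ S y (fderiv ℝ S y z c) a)) = 0 := by
  have dS := hS.differentiableAt two_ne_zero
  have d2S := hS.differentiableAt_fderiv
  have key : ∀ a b c : V →L[ℝ] ℝ,
      DifferentiableAt ℝ (fun x => c (fderiv ℝ S x (S x a) b)) y ∧
      fderiv ℝ (fun x => c (fderiv ℝ S x (S x a) b)) y z =
        c (fderiv ℝ (fderiv ℝ S) y z (S y a) b) + c (fderiv ℝ S y (fderiv ℝ S y z a) b) := by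
    intro a b c
    have d1 : DifferentiableAt ℝ (fun x => S x a) y := dS.clm_apply (differentiableAt_const a)
    have d2 : DifferentiableAt ℝ (fun x => fderiv ℝ S x (S x a)) y := d2S.clm_apply d1
    have d3 : DifferentiableAt ℝ (fun x => fderiv ℝ S x (S x a) b) y :=
      d2.clm_apply (differentiableAt_const b)
    refine ⟨(differentiableAt_const c).clm_apply d3, ?_⟩
    rw [fderiv_clm_apply_apply (differentiableAt_const c) d3,
      fderiv_clm_apply_apply d2 (differentiableAt_const b), fderiv_clm_apply_apply d2S d1,
      fderiv_clm_apply_apply dS (differentiableAt_const a)]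
    simp
  have h0 : (fun x => c (fderiv ℝ S x (S x a) b) + a (fderiv ℝ S x (S x b) c)
      + b (fderiv ℝ S x (S x c) a)) =ᶠ[𝓝 y] fun _ => 0 := by
    filter_upwards [hJ] with x hx using hx a b c
  have h1 := congrArg (fun T : V →L[ℝ] ℝ => T z) h0.fderiv_eq
  rw [fderiv_fun_add ((key a b c).1.fun_add (key b c a).1) (key c a b).1,
    fderiv_fun_add (key a b c).1 (key b c a).1] at h1
  simpa [(key a b c).2, (key b c a).2, (key c a b).2] using h1

/-- Inner brackets under `S` are removed by `sharp_lieForm`. In the cyclic sum the second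
derivatives of the forms cancel by symmetry, the terms without derivatives of the forms form the
differentiated Jacobi identity of `S`, and the remaining ones cancel in pairs, some of them by
skewness of the derivative of `S`. -/
lemma lieForm_jacobi [FiniteDimensional ℝ V] (hS : ContDiffAt ℝ 2 S y)
    (hskew : ∀ᶠ x in 𝓝 y, IsSkew (S x)) (hJ : ∀ᶠ x in 𝓝 y, JacobiAt S x)
    (hα : ContDiffAt ℝ 2 α y) (hβ : ContDiffAt ℝ 2 β y) (hγ : ContDiffAt ℝ 2 γ y) :
    lieForm S α (lieForm S β γ) y + lieForm S β (lieForm S γ α) y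
      + lieForm S γ (lieForm S α β) y = 0 := by
  have dS := hS.differentiableAt two_ne_zero
  have dα := hα.differentiableAt two_ne_zero
  have dβ := hβ.differentiableAt two_ne_zero
  have dγ := hγ.differentiableAt two_ne_zero
  have h2 : minSmoothness ℝ 2 ≤ 2 := by simp
  have hj := hJ.self_of_nhds
  ext z
  have jz := fderiv_jacobiAt hS hJ (α y) (β y) (γ y) z
  have sS := hS.isSymmSndFDerivAt h2
  have sα := congrArg (fun T : V →L[ℝ] ℝ => T z)
    (hα.isSymmSndFDerivAt h2 (S y (β y)) (S y (γ y)))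
  have sβ := congrArg (fun T : V →L[ℝ] ℝ => T z)
    (hβ.isSymmSndFDerivAt h2 (S y (γ y)) (S y (α y)))
  have sγ := congrArg (fun T : V →L[ℝ] ℝ => T z)
    (hγ.isSymmSndFDerivAt h2 (S y (α y)) (S y (β y)))
  have k1 := skew_fderiv dS hskew (γ y) (fderiv ℝ β y (S y (α y))) z
  have k2 := skew_fderiv dS hskew (α y) (fderiv ℝ γ y (S y (β y))) z
  have k3 := skew_fderiv dS hskew (β y) (fderiv ℝ α y (S y (γ y))) z
  rw [sS z (S y (α y)), sS z (S y (β y)), sS z (S y (γ y))] at jz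
  simp only [add_apply, zero_apply, lieForm_apply (β := lieForm S _ _), fderiv_lieForm_apply hS hα hβ,
    fderiv_lieForm_apply hS hβ hγ, fderiv_lieForm_apply hS hγ hα,
    sharp_lieForm dS hskew hj dα dβ, sharp_lieForm dS hskew hj dβ dγ,
    sharp_lieForm dS hskew hj dγ dα, fderiv_clm_apply_apply dS dα, fderiv_clm_apply_apply dS dβ,
    fderiv_clm_apply_apply dS dγ, map_add, map_sub, sub_apply]
  simp only [lieForm_apply]
  linarith

end VectorSpace

/-! ### Brackets along a linear subspace, induced contraction maps, and kernels of constant rank. -/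

section AlongSubspace

variable {V : Type*} [NormedAddCommGroup V] [NormedSpace ℝ V]
  {U : Type*} [NormedAddCommGroup U] [NormedSpace ℝ U]
  {S : V → (V →L[ℝ] ℝ) →L[ℝ] V} {ι : U →L[ℝ] V} {ρ : V →L[ℝ] U} {u : U}

/-- By the chain rule, a derivative in a direction tangent to the subspace sees only the restriction
of the map to it. -/
lemma fderiv_apply_inclusion {W : Type*} [NormedAddCommGroup W] [NormedSpace ℝ W] {A : V → W}
    (hA : DifferentiableAt ℝ A (ι u)) (w : U) :
    fderiv ℝ A (ι u) (ι w) = fderiv ℝ (fun x => A (ι x)) u w := by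
  have h : HasFDerivAt (fun x => A (ι x)) ((fderiv ℝ A (ι u)).comp ι) u :=
    hA.hasFDerivAt.comp u ι.hasFDerivAt
  rw [h.fderiv]
  rfl

/-- The restriction to a subspace of the bracket of two forms whose images under `S` are tangent to
the subspace depends only on the restrictions of the forms. -/
lemma lieForm_congr_of_tangent {α β α' β' : V → V →L[ℝ] ℝ}
    (hα : DifferentiableAt ℝ α (ι u)) (hβ : DifferentiableAt ℝ β (ι u))
    (hα' : DifferentiableAt ℝ α' (ι u)) (hβ' : DifferentiableAt ℝ β' (ι u))
    (eα : ∀ᶠ x in 𝓝 u, α (ι x) = α' (ι x)) (eβ : ∀ᶠ x in 𝓝 u, β (ι x) = β' (ι x))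
    (tα : S (ι u) (α (ι u)) ∈ Set.range ι) (tβ : S (ι u) (β (ι u)) ∈ Set.range ι) :
    lieForm S α β (ι u) = lieForm S α' β' (ι u) := by
  obtain ⟨w, hw⟩ := tα
  obtain ⟨w', hw'⟩ := tβ
  have a0 := eα.self_of_nhds
  have b0 := eβ.self_of_nhds
  have e1 : fderiv ℝ β (ι u) (ι w) = fderiv ℝ β' (ι u) (ι w) := by
    rw [fderiv_apply_inclusion hβ, fderiv_apply_inclusion hβ', Filter.EventuallyEq.fderiv_eq eβ]
  have e2 : fderiv ℝ α (ι u) (ι w') = fderiv ℝ α' (ι u) (ι w') := by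
    rw [fderiv_apply_inclusion hα, fderiv_apply_inclusion hα', Filter.EventuallyEq.fderiv_eq eα]
  simp only [lieForm, ← a0, ← b0, ← hw, ← hw', e1, e2]

/-- The covector `ξ` at `ι u` vanishes on the subspace and `S ξ` is tangent to it. -/
def IsCharCovector (S : V → (V →L[ℝ] ℝ) →L[ℝ] V) (ι : U →L[ℝ] V) (ρ : V →L[ℝ] U) (u : U)
    (ξ : V →L[ℝ] ℝ) : Prop :=
  (∀ z, ξ (ι z) = 0) ∧ S (ι u) ξ = ι (ρ (S (ι u) ξ))

/-- Both conditions are identities along the subspace, so they can be differentiated in tangent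
directions, and the bracket involves the forms only through such directions. The second one also
uses `sharp_lieForm`: the bracket of two fields tangent to the subspace is tangent to it. -/
lemma IsCharCovector.lieForm [FiniteDimensional ℝ V] {α β : V → V →L[ℝ] ℝ}
    (hS : DifferentiableAt ℝ S (ι u)) (hskew : ∀ᶠ x in 𝓝 (ι u), IsSkew (S x))
    (hJ : JacobiAt S (ι u))
    (hα : DifferentiableAt ℝ α (ι u)) (hβ : DifferentiableAt ℝ β (ι u))
    (cα : ∀ᶠ x in 𝓝 u, IsCharCovector S ι ρ x (α (ι x)))
    (cβ : ∀ᶠ x in 𝓝 u, IsCharCovector S ι ρ x (β (ι x))) :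
    IsCharCovector S ι ρ u (lieForm S α β (ι u)) := by
  have a0 := cα.self_of_nhds
  have b0 := cβ.self_of_nhds
  -- A form vanishing on tangent vectors along the subspace keeps this property when differentiated
  -- in a tangent direction, because the tangent space is constant.
  have hzero : ∀ {γ : V → V →L[ℝ] ℝ}, DifferentiableAt ℝ γ (ι u) →
      (∀ᶠ x in 𝓝 u, IsCharCovector S ι ρ x (γ (ι x))) → ∀ w z,
      fderiv ℝ γ (ι u) (ι w) (ι z) = 0 := by
    intro γ hγ cγ w z
    have h1 := fderiv_clm_apply_apply hγ (differentiableAt_const (ι z)) (ι w)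
    simp only [fderiv_fun_const, Pi.zero_apply, zero_apply, map_zero, add_zero] at h1
    rw [← h1, fderiv_apply_inclusion (hγ.clm_apply (differentiableAt_const _))]
    have : (fun x => γ (ι x) (ι z)) =ᶠ[𝓝 u] fun _ => 0 := by
      filter_upwards [cγ] with x hx using hx.1 z
    rw [this.fderiv_eq]
    simp
  have htan : ∀ {γ : V → V →L[ℝ] ℝ}, DifferentiableAt ℝ γ (ι u) →
      (∀ᶠ x in 𝓝 u, IsCharCovector S ι ρ x (γ (ι x))) → ∀ w,
      fderiv ℝ (fun x => S x (γ x)) (ι u) (ι w) =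
        ι (ρ (fderiv ℝ (fun x => S x (γ x)) (ι u) (ι w))) := by
    intro γ hγ cγ w
    have hd : DifferentiableAt ℝ (fun x => S x (γ x)) (ι u) := hS.clm_apply hγ
    have hd' : DifferentiableAt ℝ (fun x => S (ι x) (γ (ι x))) u :=
      hd.comp u ι.differentiableAt
    have h2 : (fun x => S (ι x) (γ (ι x))) =ᶠ[𝓝 u] fun x => (ι.comp ρ) (S (ι x) (γ (ι x))) := by
      filter_upwards [cγ] with x hx using hx.2
    have h3 := ((ι.comp ρ).hasFDerivAt.comp u hd'.hasFDerivAt).fderiv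
    rw [fderiv_apply_inclusion hd]
    conv_lhs => rw [h2.fderiv_eq]
    exact congrArg (fun T : U →L[ℝ] V => T w) h3
  refine ⟨fun z => ?_, ?_⟩
  · have hβSα : (fun x => β (ι x) (S (ι x) (α (ι x)))) =ᶠ[𝓝 u] fun _ => 0 := by
      filter_upwards [cα, cβ] with x hx hx'
      rw [hx.2, hx'.1]
    have hd : DifferentiableAt ℝ (fun x => S x (α x)) (ι u) := hS.clm_apply hα
    have h1 := fderiv_clm_apply_apply hβ hd (ι z)
    rw [fderiv_apply_inclusion (hβ.clm_apply hd), hβSα.fderiv_eq,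
      fderiv_clm_apply_apply hS hα] at h1
    -- The derivative of β(Sα) = 0 along `ι z` has three terms. The one with the derivative of `β`
    -- vanishes because Sα is tangent. By skewness, the one with the derivative of `α` is that
    -- derivative evaluated on the tangent vector Sβ, up to sign, and vanishes too. The third is the
    -- last term of `lieForm`.
    have h2 := hskew.self_of_nhds (fderiv ℝ α (ι u) (ι z)) (β (ι u))
    rw [b0.2, hzero hα cα] at h2
    rw [map_add, h2, a0.2, hzero hβ cβ] at h1
    rw [lieForm_apply, a0.2, b0.2, hzero hβ cβ, hzero hα cα]
    simpa using h1.symm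
  · rw [sharp_lieForm hS hskew hJ hα hβ, map_sub, map_sub]
    have h1 := htan hα cα (ρ (S (ι u) (β (ι u))))
    have h2 := htan hβ cβ (ρ (S (ι u) (α (ι u))))
    rw [← b0.2] at h1
    rw [← a0.2] at h2
    rw [← h1, ← h2]

/-- The contraction map induced on a subspace by a family `p` of projections onto it. -/
def inducedContraction (S : V → (V →L[ℝ] ℝ) →L[ℝ] V) (ι : U →L[ℝ] V) (p : U → V →L[ℝ] U) (u : U) :
    (U →L[ℝ] ℝ) →L[ℝ] U :=
  (p u).comp ((S (ι u)).comp (ContinuousLinearMap.precomp ℝ (p u)))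

/-- It suffices to pair with the covectors `c - c.comp (ι.comp q)`, which annihilate the subspace.
Skewness moves `T` onto such a covector, and `q` then kills its image. -/
lemma sharp_comp_proj [FiniteDimensional ℝ V] {T : (V →L[ℝ] ℝ) →L[ℝ] V} {q : V →L[ℝ] U}
    (hT : IsSkew T) (hq : ∀ z, q (ι z) = z) (hqT : ∀ k : V →L[ℝ] ℝ, (∀ z, k (ι z) = 0) → q (T k) = 0)
    (η : U →L[ℝ] ℝ) : T (η.comp q) = ι (q (T (η.comp q))) := by
  refine eq_of_forall_dual fun c => ?_
  have h := hT (η.comp q) (c - c.comp (ι.comp q))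
  have h0 := hqT (c - c.comp (ι.comp q)) (fun z => by simp [hq])
  rw [ContinuousLinearMap.comp_apply η, h0, map_zero, neg_zero] at h
  simpa [sub_eq_zero] using h

instance instNormedAddCommGroupPrecomp : NormedAddCommGroup ((U →L[ℝ] ℝ) →L[ℝ] V →L[ℝ] ℝ) :=
  ContinuousLinearMap.toNormedAddCommGroup

instance instNormedSpacePrecomp : NormedSpace ℝ ((U →L[ℝ] ℝ) →L[ℝ] V →L[ℝ] ℝ) :=
  ContinuousLinearMap.toNormedSpace

/-- The images of the extended forms are tangent (`sharp_comp_proj`), so the two terms with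
derivatives of the forms agree by restriction. For the last term, the derivative of p ∘ S ∘ p* has
three summands, and the two in which `p` is differentiated disappear, leaving the derivative of `S`.
-/
lemma lieForm_inducedContraction [FiniteDimensional ℝ V] {p : U → V →L[ℝ] U}
    (hS : DifferentiableAt ℝ S (ι u)) (hskew : IsSkew (S (ι u)))
    (hp : DifferentiableAt ℝ p u) (hpι : ∀ᶠ x in 𝓝 u, ∀ z, p x (ι z) = z)
    (hpS : ∀ k : V →L[ℝ] ℝ, (∀ z, k (ι z) = 0) → p u (S (ι u) k) = 0)
    {α' β' : U → U →L[ℝ] ℝ} (hα' : DifferentiableAt ℝ α' u) (hβ' : DifferentiableAt ℝ β' u)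
    {α β : V → V →L[ℝ] ℝ} (hα : DifferentiableAt ℝ α (ι u)) (hβ : DifferentiableAt ℝ β (ι u))
    (eα : ∀ᶠ x in 𝓝 u, α (ι x) = (α' x).comp (p x))
    (eβ : ∀ᶠ x in 𝓝 u, β (ι x) = (β' x).comp (p x)) (z : U) :
    lieForm S α β (ι u) (ι z) = lieForm (inducedContraction S ι p) α' β' u z := by
  have p0 := hpι.self_of_nhds
  have htan : ∀ η : U →L[ℝ] ℝ, S (ι u) (η.comp (p u)) = ι (inducedContraction S ι p u η) :=
    fun η => sharp_comp_proj hskew p0 hpS η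
  have hder : ∀ {γ : V → V →L[ℝ] ℝ} {γ' : U → U →L[ℝ] ℝ}, DifferentiableAt ℝ γ (ι u) →
      DifferentiableAt ℝ γ' u → (∀ᶠ x in 𝓝 u, γ (ι x) = (γ' x).comp (p x)) → ∀ w,
      fderiv ℝ γ (ι u) (ι w) (ι z) = fderiv ℝ γ' u w z := by
    intro γ γ' hγ hγ' eγ w
    have h1 := fderiv_clm_apply_apply hγ (differentiableAt_const (ι z)) (ι w)
    have h2 := fderiv_clm_apply_apply hγ' (differentiableAt_const z) w
    simp only [fderiv_fun_const, Pi.zero_apply, zero_apply, map_zero, add_zero] at h1 h2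
    rw [← h1, ← h2, fderiv_apply_inclusion (hγ.clm_apply (differentiableAt_const _))]
    have : (fun x => γ (ι x) (ι z)) =ᶠ[𝓝 u] fun x => γ' x z := by
      filter_upwards [eγ, hpι] with x hx hx'
      rw [hx, ContinuousLinearMap.comp_apply, hx']
    rw [this.fderiv_eq]
  have a0 := eα.self_of_nhds
  have b0 := eβ.self_of_nhds
  have hSι : DifferentiableAt ℝ (fun x => S (ι x)) u := hS.comp u ι.differentiableAt
  have hT : DifferentiableAt ℝ (inducedContraction S ι p) u :=
    hp.clm_comp (hSι.clm_comp
      ((ContinuousLinearMap.compL ℝ V U ℝ).flip.differentiableAt.comp u hp))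
  have key : (β' u) (fderiv ℝ (inducedContraction S ι p) u z (α' u)) =
      (β' u) (p u (fderiv ℝ S (ι u) (ι z) ((α' u).comp (p u)))) := by
    have hc : DifferentiableAt ℝ (fun x => (α' u).comp (p x)) u :=
      (differentiableAt_const _).clm_comp hp
    have h1 := fderiv_clm_apply_apply hT (differentiableAt_const (α' u)) z
    have h2 := fderiv_clm_apply_apply hp (hSι.clm_apply hc) z
    rw [fderiv_clm_apply_apply hSι hc] at h2
    simp only [fderiv_fun_const, Pi.zero_apply, zero_apply, map_zero, add_zero] at h1
    -- All the `p x` restrict to the identity on the subspace, so the derivative of `p` vanishes on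
    -- it. This kills the summand in which the outer `p` is differentiated, whose argument is
    -- tangent. It also makes the covector arising from the inner `p` conormal, hence killed by `p
    -- u` after `S`.
    have hpz : ∀ w, fderiv ℝ p u z (ι w) = 0 := by
      intro w
      have h3 := fderiv_clm_apply_apply hp (differentiableAt_const (ι w)) z
      simp only [fderiv_fun_const, Pi.zero_apply, zero_apply, map_zero, add_zero] at h3
      have : (fun x => p x (ι w)) =ᶠ[𝓝 u] fun _ => w := by
        filter_upwards [hpι] with x hx using hx w
      rw [← h3, this.fderiv_eq]
      simp
    have hcz : fderiv ℝ (fun x => (α' u).comp (p x)) u z = (α' u).comp (fderiv ℝ p u z) := by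
      rw [((hasFDerivAt_const (α' u) u).clm_comp hp.hasFDerivAt).fderiv]
      ext; simp
    rw [hcz, htan, hpz, map_add, hpS _ (fun w => by simp [hpz]), zero_add, add_zero,
      ← fderiv_apply_inclusion hS] at h2
    rw [← h1, ← h2]
    rfl
  rw [lieForm_apply, lieForm_apply, key, a0, b0, htan, htan, hder hα hα' eα, hder hβ hβ' eβ]
  rfl

lemma contDiffWithinAt_inverse_apply {X Y : Type*} [NormedAddCommGroup X] [NormedSpace ℝ X]
    [NormedAddCommGroup Y] [NormedSpace ℝ Y] [CompleteSpace X] {M : U → X →L[ℝ] Y} {W : Set U}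
    (hM : ContDiffWithinAt ℝ ∞ M W u) (he : ∃ e : X ≃L[ℝ] Y, (e : X →L[ℝ] Y) = M u) (y : Y) :
    ContDiffWithinAt ℝ ∞ (fun x => (M x).inverse y) W u := by
  obtain ⟨e, he⟩ := he
  have h1 : ContDiffAt ℝ ∞ (ContinuousLinearMap.inverse : (X →L[ℝ] Y) → Y →L[ℝ] X) (M u) :=
    he ▸ contDiffAt_map_inverse e
  have h : ContDiffWithinAt ℝ ∞ (fun x => (M x).inverse) W u := h1.comp_contDiffWithinAt u hM
  exact h.clm_apply contDiffWithinAt_const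

/-- The conormal covectors of a subspace. -/
def conormalSpace (ι : U →L[ℝ] V) : Submodule ℝ (V →L[ℝ] ℝ) :=
  (ContinuousLinearMap.precomp ℝ ι : (V →L[ℝ] ℝ) →L[ℝ] (U →L[ℝ] ℝ)).ker

instance instNormedAddCommGroupConormalSpace : NormedAddCommGroup (conormalSpace ι) :=
  Submodule.normedAddCommGroup _

instance instNormedSpaceConormalSpace : NormedSpace ℝ (conormalSpace ι) :=
  Submodule.normedSpace _

lemma mem_conormalSpace {k : V →L[ℝ] ℝ} : k ∈ conormalSpace ι ↔ ∀ z, k (ι z) = 0 := by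
  simp [conormalSpace, ContinuousLinearMap.ext_iff]

lemma finrank_clm_real (W : Type*) [NormedAddCommGroup W] [NormedSpace ℝ W]
    [FiniteDimensional ℝ W] : Module.finrank ℝ (W →L[ℝ] ℝ) = Module.finrank ℝ W := by
  rw [← (LinearMap.toContinuousLinearMap (𝕜 := ℝ) (E := W) (F' := ℝ)).finrank_eq]
  exact Subspace.dual_finrank_eq

lemma finrank_conormalSpace [FiniteDimensional ℝ V] [FiniteDimensional ℝ U]
    (hρ : ∀ z, ρ (ι z) = z) :
    Module.finrank ℝ U + Module.finrank ℝ (conormalSpace ι) = Module.finrank ℝ V := by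
  have h := LinearMap.finrank_range_add_finrank_ker
    (ContinuousLinearMap.precomp ℝ ι : (V →L[ℝ] ℝ) →L[ℝ] (U →L[ℝ] ℝ)).toLinearMap
  rw [LinearMap.range_eq_top.2, finrank_top, finrank_clm_real, finrank_clm_real] at h
  · exact h
  · intro η
    refine ⟨η.comp ρ, ?_⟩
    ext z
    simp [hρ]

/-- The projections along `S (conormal space)` onto a cosymplectic subspace depend smoothly on the
base point. -/
lemma contDiffOn_proj [FiniteDimensional ℝ V] [FiniteDimensional ℝ U] (hρ : ∀ z, ρ (ι z) = z)
    {W : Set U} (hS : ContDiffOn ℝ ∞ (fun x => S (ι x)) W) {p : U → V →L[ℝ] U}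
    (hpι : ∀ x ∈ W, ∀ z, p x (ι z) = z)
    (hpS : ∀ x ∈ W, ∀ k : V →L[ℝ] ℝ, (∀ z, k (ι z) = 0) → p x (S (ι x) k) = 0)
    (hcos : ∀ x ∈ W, ∀ v, ∃ z, ∃ k : V →L[ℝ] ℝ, (∀ z, k (ι z) = 0) ∧ v = ι z + S (ι x) k) :
    ContDiffOn ℝ ∞ p W := by
  -- In the decomposition of the ambient space into the subspace and the image of its conormal
  -- space, the projection is the first component of the inverse of `M x`. Smoothness of operator
  -- inversion then gives the claim.
  let M : U → (U × conormalSpace ι) →L[ℝ] V := fun x =>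
    ι.comp (ContinuousLinearMap.fst ℝ _ _) +
      ((S (ι x)).comp (conormalSpace ι).subtypeL).comp (ContinuousLinearMap.snd ℝ _ _)
  have hM : ContDiffOn ℝ ∞ M W :=
    contDiffOn_const.add ((hS.clm_comp contDiffOn_const).clm_comp contDiffOn_const)
  have hdim : Module.finrank ℝ (U × conormalSpace ι) = Module.finrank ℝ V := by
    rw [Module.finrank_prod, finrank_conormalSpace hρ]
  have hinv : ∀ x ∈ W, ∃ e : (U × conormalSpace ι) ≃L[ℝ] V,
      (e : (U × conormalSpace ι) →L[ℝ] V) = M x := by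
    intro x hx
    have hsurj : Function.Surjective (M x).toLinearMap := by
      intro v
      obtain ⟨z, k, hk, rfl⟩ := hcos x hx v
      exact ⟨(z, ⟨k, mem_conormalSpace.2 hk⟩), rfl⟩
    have hinj := (LinearMap.injective_iff_surjective_of_finrank_eq_finrank hdim).2 hsurj
    refine ⟨(LinearEquiv.ofBijective (M x).toLinearMap ⟨hinj, hsurj⟩).toContinuousLinearEquiv, ?_⟩
    ext <;> rfl
  have h2 : ∀ x ∈ W, p x = (ContinuousLinearMap.fst ℝ U (conormalSpace ι)).comp (M x).inverse := by
    intro x hx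
    obtain ⟨e, he⟩ := hinv x hx
    rw [← he, ContinuousLinearMap.inverse_equiv]
    ext v
    obtain ⟨⟨z, k⟩, rfl⟩ := e.surjective v
    have : e (z, k) = ι z + S (ι x) k := congrArg (fun T => T (z, k)) he
    simp only [ContinuousLinearMap.comp_apply, ContinuousLinearEquiv.coe_coe,
      ContinuousLinearEquiv.symm_apply_apply]
    rw [this, map_add, hpι x hx, hpS x hx k (mem_conormalSpace.1 k.2), add_zero]
    rfl
  have : CompleteSpace U := FiniteDimensional.complete ℝ U
  refine contDiffOn_clm_apply.2 fun v => ?_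
  refine ContDiffOn.congr (f := fun x => ((M x).inverse v).1) ?_ fun x hx => by rw [h2 x hx]; rfl
  exact fun x hx => (contDiffWithinAt_inverse_apply (hM x hx) (hinv x hx) v).fst

/-- The kernels of a smooth family of linear maps of constant rank have smooth local frames. -/
lemma exists_smooth_frame_ker {X Y : Type*} [NormedAddCommGroup X] [NormedSpace ℝ X]
    [FiniteDimensional ℝ X] [NormedAddCommGroup Y] [NormedSpace ℝ Y] [FiniteDimensional ℝ Y]
    {W : Set U} (hW : IsOpen W) {B : U → X →L[ℝ] Y} (hB : ContDiffOn ℝ ∞ B W) {k : ℕ}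
    (hk : ∀ x ∈ W, Module.finrank ℝ (B x).ker = k) (hu : u ∈ W) :
    ∃ W' ⊆ W, IsOpen W' ∧ u ∈ W' ∧ ∃ s : Fin k → U → X, (∀ i, ContDiffOn ℝ ∞ (s i) W') ∧
      ∀ x ∈ W', LinearIndependent ℝ (fun i => s i x) ∧
        Submodule.span ℝ (Set.range fun i => s i x) = (B x).ker := by
  obtain ⟨R, hR⟩ := (B u).range.exists_isCompl
  obtain ⟨K', hK'⟩ := (B u).ker.exists_isCompl
  let r : Y →L[ℝ] (B u).range :=
    LinearMap.toContinuousLinearMap ((B u).range.projectionOnto R hR)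
  let q : X →L[ℝ] (B u).ker := LinearMap.toContinuousLinearMap ((B u).ker.projectionOnto K' hK')
  -- Fixed projections `r` onto the range and `q` onto the kernel of `B u` complete `B x` to a map
  -- that is invertible at `u`, hence near `u`. The frame is the preimage under `M x` of a basis of
  -- the kernel at `u`.
  let M : U → X →L[ℝ] ((B u).range × (B u).ker) := fun x => (r.comp (B x)).prod q
  have hM : ContDiffOn ℝ ∞ M W := by
    have h1 : ContDiffOn ℝ ∞ (fun x => r.comp (B x)) W := contDiffOn_const.clm_comp hB
    refine contDiffOn_clm_apply.2 fun v => ?_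
    exact (h1.clm_apply contDiffOn_const).prodMk contDiffOn_const
  have hinj : Function.Injective (M u).toLinearMap := by
    rw [← LinearMap.ker_eq_bot, LinearMap.ker_eq_bot']
    intro v hv
    have hv1 : r (B u v) = 0 := congrArg Prod.fst hv
    have hv2 : q v = 0 := congrArg Prod.snd hv
    have h3 : r (B u v) = ⟨B u v, LinearMap.mem_range_self _ v⟩ :=
      Submodule.projectionOnto_apply_left hR ⟨B u v, LinearMap.mem_range_self _ v⟩
    rw [h3] at hv1
    have hvk : v ∈ (B u).ker := by simpa using congrArg Subtype.val hv1
    have h4 : q v = ⟨v, hvk⟩ := Submodule.projectionOnto_apply_left hK' ⟨v, hvk⟩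
    rw [h4] at hv2
    simpa using congrArg Subtype.val hv2
  have hdim : Module.finrank ℝ X = Module.finrank ℝ ((B u).range × (B u).ker) := by
    rw [Module.finrank_prod]
    exact (LinearMap.finrank_range_add_finrank_ker (B u).toLinearMap).symm
  have hsurj := (LinearMap.injective_iff_surjective_of_finrank_eq_finrank hdim).1 hinj
  let e₀ : X ≃L[ℝ] ((B u).range × (B u).ker) :=
    (LinearEquiv.ofBijective (M u).toLinearMap ⟨hinj, hsurj⟩).toContinuousLinearEquiv
  have he₀ : (e₀ : X →L[ℝ] ((B u).range × (B u).ker)) = M u := by ext <;> rfl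
  let O : Set (X →L[ℝ] ((B u).range × (B u).ker)) :=
    Set.range ((↑) : (X ≃L[ℝ] ((B u).range × (B u).ker)) → _)
  have hO : IsOpen O := ContinuousLinearEquiv.isOpen
  let b : Module.Basis (Fin k) ℝ (B u).ker := Module.finBasisOfFinrankEq ℝ _ (hk u hu)
  refine ⟨W ∩ M ⁻¹' O, Set.inter_subset_left, hM.continuousOn.isOpen_inter_preimage hW hO,
    ⟨hu, e₀, he₀⟩, fun i x => (M x).inverse (0, b i), fun i x hx => ?_, fun x hx => ?_⟩
  · obtain ⟨e, he⟩ := hx.2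
    exact contDiffWithinAt_inverse_apply ((hM x hx.1).mono Set.inter_subset_left) ⟨e, he⟩ _
  · obtain ⟨e, he⟩ := hx.2
    beta_reduce
    rw [← he, ContinuousLinearMap.inverse_equiv]
    have hli : LinearIndependent ℝ fun i => e.symm ((0, b i) : (B u).range × (B u).ker) := by
      have h1 := b.linearIndependent.map' (e.symm.toLinearEquiv.toLinearMap ∘ₗ LinearMap.inr ℝ _ _)
        (LinearMap.ker_eq_bot.2 (e.symm.injective.comp LinearMap.inr_injective))
      exact h1
    refine ⟨hli, ?_⟩
    -- The frame vectors are only known to satisfy r(B x v) = 0. The kernel of `B x` is contained in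
    -- their span, and equality follows because both have dimension `k`.
    symm
    refine Submodule.eq_of_le_of_finrank_eq ?_ ?_
    · intro v hv
      have h1 : e v = (0, q v) := by
        have : e v = M x v := congrArg (fun T => T v) he
        rw [this]
        refine Prod.ext ?_ rfl
        change r (B x v) = 0
        rw [show B x v = 0 from hv, map_zero]
      have h2 : v = ∑ i, b.repr (q v) i • e.symm ((0, b i) : (B u).range × (B u).ker) := by
        apply e.injective
        rw [h1, map_sum]
        simp only [map_smul, ContinuousLinearEquiv.apply_symm_apply, Prod.smul_mk, smul_zero]
        refine Prod.ext ?_ ?_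
        · simp [Prod.fst_sum]
        · simp [Prod.snd_sum, b.sum_repr]
      rw [h2]
      exact Submodule.sum_mem _ fun i _ =>
        Submodule.smul_mem _ _ (Submodule.subset_span ⟨i, rfl⟩)
    · rw [hk x hx.1]
      exact (finrank_span_eq_card hli).trans (Fintype.card_fin k) |>.symm

end AlongSubspace

/-! ### Smooth fields, forms and contraction maps in charts. -/

section Charts

variable {E : Type*} [NormedAddCommGroup E] [NormedSpace ℝ E]
  {P : Type*} [TopologicalSpace P] [ChartedSpace E P] [IsManifold 𝓘(ℝ, E) ∞ P]
  {F : Type*} [NormedAddCommGroup F] [NormedSpace ℝ F]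
  {C : Type*} [TopologicalSpace C] [ChartedSpace F C]

/-- A covector, as a covector of the model space. -/
def covModel {x : P} (ξ : Cot E x) : E →L[ℝ] ℝ := ξ

/-- A covector of the model space, as a covector at `x`. -/
def covOfModel (x : P) (a : E →L[ℝ] ℝ) : Cot E x := a

/-- A contraction map at a point, as a map of the model space. -/
def contractionModel {x : P} (T : Cot E x →L[ℝ] Tan E x) : (E →L[ℝ] ℝ) →L[ℝ] E := T

/-- The differential of a chart, as a map of the model space. -/
def chartD (e : OpenPartialHomeomorph P E) (x : P) : E →L[ℝ] E := mfderiv 𝓘(ℝ, E) 𝓘(ℝ, E) e x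

/-- The differential of the inverse of a chart, as a map of the model space. -/
def chartDsymm (e : OpenPartialHomeomorph P E) (y : E) : E →L[ℝ] E :=
  mfderiv 𝓘(ℝ, E) 𝓘(ℝ, E) e.symm y

variable {e : OpenPartialHomeomorph P E}

lemma mdifferentiable_of_mem_maximalAtlas (he : e ∈ IsManifold.maximalAtlas 𝓘(ℝ, E) ∞ P) :
    e.MDifferentiable 𝓘(ℝ, E) 𝓘(ℝ, E) :=
  ⟨(contMDiffOn_of_mem_maximalAtlas he).mdifferentiableOn (by simp),
    (contMDiffOn_symm_of_mem_maximalAtlas he).mdifferentiableOn (by simp)⟩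

lemma chartDsymm_chartD (he : e ∈ IsManifold.maximalAtlas 𝓘(ℝ, E) ∞ P) {x : P}
    (hx : x ∈ e.source) (v : E) : chartDsymm e (e x) (chartD e x v) = v :=
  congrArg (fun T : TangentSpace 𝓘(ℝ, E) x →L[ℝ] TangentSpace 𝓘(ℝ, E) x => T v)
    ((mdifferentiable_of_mem_maximalAtlas he).symm_comp_deriv hx)

lemma chartD_chartDsymm' (he : e ∈ IsManifold.maximalAtlas 𝓘(ℝ, E) ∞ P) {y : E}
    (hy : y ∈ e.target) (v : E) : chartD e (e.symm y) (chartDsymm e y v) = v :=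
  congrArg (fun T : TangentSpace 𝓘(ℝ, E) y →L[ℝ] TangentSpace 𝓘(ℝ, E) y => T v)
    ((mdifferentiable_of_mem_maximalAtlas he).comp_symm_deriv hy)

lemma chartD_chartDsymm (he : e ∈ IsManifold.maximalAtlas 𝓘(ℝ, E) ∞ P) {x : P}
    (hx : x ∈ e.source) (v : E) : chartD e x (chartDsymm e (e x) v) = v := by
  have h := chartD_chartDsymm' he (e.map_source hx) v
  rwa [e.left_inv hx] at h

/-- Smoothness on `U` of a vector field along `f`. -/
def SmoothFieldAlongOn (F : Type*) [NormedAddCommGroup F] [NormedSpace ℝ F] {C : Type*}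
    [TopologicalSpace C] [ChartedSpace F C] (f : C → P) (X : ∀ c, Tan E (f c)) (U : Set C) : Prop :=
  ContMDiffOn 𝓘(ℝ, F) (𝓘(ℝ, E).prod 𝓘(ℝ, E)) ∞
    (fun c => (⟨f c, X c⟩ : TangentBundle 𝓘(ℝ, E) P)) U

lemma SmoothFieldAlongOn.tangentMap {H : Type*} [NormedAddCommGroup H] [NormedSpace ℝ H]
    {Q : Type*} [TopologicalSpace Q] [ChartedSpace H Q] [IsManifold 𝓘(ℝ, H) ∞ Q]
    {f : C → P} {X : ∀ c, Tan E (f c)} {U : Set C} {r : P → Q} {O : Set P} (hO : IsOpen O)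
    (hr : ContMDiffOn 𝓘(ℝ, E) 𝓘(ℝ, H) ∞ r O) (hX : SmoothFieldAlongOn F f X U)
    (hfU : Set.MapsTo f U O) :
    SmoothFieldAlongOn F (fun c => r (f c)) (fun c => mfderiv 𝓘(ℝ, E) 𝓘(ℝ, H) r (f c) (X c)) U := by
  have h1 := hr.contMDiffOn_tangentMapWithin (m := ∞) le_rfl hO.uniqueMDiffOn
  have h2 := ContMDiffOn.comp h1 hX (fun c hc => hfU hc)
  refine h2.congr fun c hc => ?_
  simp only [Function.comp, tangentMapWithin]
  rw [mfderivWithin_of_isOpen hO (hfU hc)]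

lemma SmoothFieldAlongOn.contMDiffOn_base {f : C → P} {X : ∀ c, Tan E (f c)} {U : Set C}
    (hX : SmoothFieldAlongOn F f X U) : ContMDiffOn 𝓘(ℝ, F) 𝓘(ℝ, E) ∞ f U :=
  (Bundle.contMDiff_proj (IB := 𝓘(ℝ, E)) (F := E)
    (TangentSpace 𝓘(ℝ, E) : P → Type _)).comp_contMDiffOn hX

lemma smoothFieldAlongOn_vectorSpace {f : C → E} {X : C → E} {U : Set C} :
    SmoothFieldAlongOn (P := E) (E := E) F f X U ↔
      ContMDiffOn 𝓘(ℝ, F) 𝓘(ℝ, E) ∞ f U ∧ ContMDiffOn 𝓘(ℝ, F) 𝓘(ℝ, E) ∞ X U := by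
  constructor
  · intro h
    exact ⟨h.contMDiffOn_base,
      (contMDiff_snd_tangentBundle_modelSpace E 𝓘(ℝ, E)).comp_contMDiffOn h⟩
  · rintro ⟨h1, h2⟩
    intro c hc
    refine Bundle.contMDiffWithinAt_totalSpace.2 ⟨h1 c hc, ?_⟩
    convert! h2 c hc with y
    simp

lemma smoothFieldAlongOn_iff (he : e ∈ IsManifold.maximalAtlas 𝓘(ℝ, E) ∞ P)
    {f : C → P} {X : ∀ c, Tan E (f c)} {U : Set C} (hf : ContMDiffOn 𝓘(ℝ, F) 𝓘(ℝ, E) ∞ f U)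
    (hfU : Set.MapsTo f U e.source) :
    SmoothFieldAlongOn F f X U ↔
      ContMDiffOn 𝓘(ℝ, F) 𝓘(ℝ, E) ∞ (fun c => chartD e (f c) (X c)) U := by
  constructor
  · intro h
    exact (smoothFieldAlongOn_vectorSpace.1
      (h.tangentMap e.open_source (contMDiffOn_of_mem_maximalAtlas he) hfU)).2
  · intro h
    have h1 : SmoothFieldAlongOn (P := E) (E := E) F (fun c => e (f c))
        (fun c => chartD e (f c) (X c)) U :=
      smoothFieldAlongOn_vectorSpace.2 ⟨(contMDiffOn_of_mem_maximalAtlas he).comp hf hfU, h⟩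
    have h2 := h1.tangentMap e.open_target (contMDiffOn_symm_of_mem_maximalAtlas he)
      (fun c hc => e.map_source (hfU hc))
    refine ContMDiffOn.congr h2 fun c hc => ?_
    have h3 := chartDsymm_chartD he (hfU hc) (X c)
    have h4 := e.left_inv (hfU hc)
    rw [Bundle.TotalSpace.mk.injEq]
    refine ⟨h4.symm, heq_of_eq ?_⟩
    exact h3.symm

/-- In finite dimension an operator is determined linearly by its values on a basis, so pointwise
smoothness suffices. -/
lemma contMDiffOn_clm_of_apply {W : Type*} [NormedAddCommGroup W] [NormedSpace ℝ W]
    {H : Type*} [NormedAddCommGroup H] [NormedSpace ℝ H] [FiniteDimensional ℝ H]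
    {A : C → H →L[ℝ] W} {U : Set C}
    (h : ∀ v, ContMDiffOn 𝓘(ℝ, F) 𝓘(ℝ, W) ∞ (fun c => A c v) U) :
    ContMDiffOn 𝓘(ℝ, F) 𝓘(ℝ, H →L[ℝ] W) ∞ A U := by
  let d := Module.finrank ℝ H
  have hd : d = Module.finrank ℝ (Fin d → ℝ) := (Module.finrank_fin_fun ℝ).symm
  let e₁ := ContinuousLinearEquiv.ofFinrankEq hd
  let e₂ := (e₁.arrowCongr (1 : W ≃L[ℝ] W)).trans (ContinuousLinearEquiv.piRing (Fin d))
  have h1 : ContMDiffOn 𝓘(ℝ, F) 𝓘(ℝ, Fin d → W) ∞ (fun c => e₂ (A c)) U :=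
    contMDiffOn_pi_space.2 fun i => h _
  have h2 := e₂.symm.contDiff.contMDiff (n := ∞) |>.comp_contMDiffOn h1
  refine h2.congr fun c _ => ?_
  simp

lemma SmoothAlongOn.apply {f : C → P} {σ : ∀ c, Cot E (f c)} {X : ∀ c, Tan E (f c)} {U : Set C}
    (hσ : SmoothAlongOn F f σ U) (hX : SmoothFieldAlongOn F f X U) :
    ContMDiffOn 𝓘(ℝ, F) 𝓘(ℝ, ℝ) ∞ (fun c => σ c (X c)) U := by
  have h := ContMDiffOn.clm_bundle_apply (E₁ := fun x : P => TangentSpace 𝓘(ℝ, E) x)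
    (E₂ := Bundle.Trivial P ℝ) hσ hX
  intro c hc
  exact (Bundle.contMDiffWithinAt_totalSpace.1 (h c hc)).2

lemma SmoothAlongOn.contMDiffOn_base {f : C → P} {σ : ∀ c, Cot E (f c)} {U : Set C}
    (hσ : SmoothAlongOn F f σ U) : ContMDiffOn 𝓘(ℝ, F) 𝓘(ℝ, E) ∞ f U := fun c hc =>
  (Bundle.contMDiffWithinAt_totalSpace.1 (hσ c hc)).1

/-- Tested on the fields that are constant in a trivialization, the hypothesis says that the
coordinates of `σ` are smooth. Allowing fields on smaller sets `V` is what makes these local fields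
admissible. -/
lemma smoothAlongOn_of_apply [FiniteDimensional ℝ E] {f : C → P} {σ : ∀ c, Cot E (f c)} {U : Set C}
    (hf : ContMDiffOn 𝓘(ℝ, F) 𝓘(ℝ, E) ∞ f U)
    (h : ∀ V ⊆ U, ∀ X : ∀ c, Tan E (f c), SmoothFieldAlongOn F f X V →
      ContMDiffOn 𝓘(ℝ, F) 𝓘(ℝ, ℝ) ∞ (fun c => σ c (X c)) V) :
    SmoothAlongOn F f σ U := by
  intro c₀ hc₀
  rw [contMDiffWithinAt_hom_bundle]
  refine ⟨hf c₀ hc₀, ?_⟩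
  let t := trivializationAt E (TangentSpace 𝓘(ℝ, E) : P → Type _) (f c₀)
  have hc₀' : f c₀ ∈ t.baseSet := FiberBundle.mem_baseSet_trivializationAt' (f c₀)
  have ht : f ⁻¹' t.baseSet ∈ 𝓝[U] c₀ :=
    (hf c₀ hc₀).continuousWithinAt (t.open_baseSet.mem_nhds hc₀')
  have key : ContMDiffOn 𝓘(ℝ, F) 𝓘(ℝ, E →L[ℝ] ℝ) ∞
      (fun c => ContinuousLinearMap.inCoordinates E (TangentSpace 𝓘(ℝ, E) : P → Type _) ℝ
        (Bundle.Trivial P ℝ) (f c₀) (f c) (f c₀) (f c) (σ c)) (U ∩ f ⁻¹' t.baseSet) := by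
    refine contMDiffOn_clm_of_apply fun v => ?_
    have h1 : SmoothFieldAlongOn F f (fun c => t.symmL ℝ (f c) v) (U ∩ f ⁻¹' t.baseSet) := by
      have h2 : ContMDiffOn 𝓘(ℝ, E) (𝓘(ℝ, E).prod 𝓘(ℝ, E)) ∞
          (fun x => (⟨x, t.symmL ℝ x v⟩ : TangentBundle 𝓘(ℝ, E) P)) t.baseSet := by
        refine (t.contMDiffOn_iff fun x hx => t.mem_source.2 hx).2 ⟨contMDiffOn_id, ?_⟩
        refine contMDiffOn_const (c := v) |>.congr fun x hx => ?_
        have h3 := t.apply_mk_symm (show x ∈ t.baseSet from hx) v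
        rw [t.symmL_apply, h3]
        exact hx
      exact h2.comp (hf.mono Set.inter_subset_left) (fun c hc => hc.2)
    refine (h _ Set.inter_subset_left _ h1).congr fun c hc => ?_
    have h3 : (trivializationAt ℝ (Bundle.Trivial P ℝ) (f c₀)).continuousLinearMapAt ℝ (f c) =
        ContinuousLinearMap.id ℝ ℝ := Bundle.Trivial.continuousLinearMapAt_trivialization ℝ P ℝ (f c)
    exact congrArg (fun T : ℝ →L[ℝ] ℝ => T (σ c (t.symmL ℝ (f c) v))) h3
  have := key c₀ ⟨hc₀, hc₀'⟩
  exact this.mono_of_mem_nhdsWithin (Filter.inter_mem self_mem_nhdsWithin ht)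

lemma smoothAlongOn_iff [FiniteDimensional ℝ E] (he : e ∈ IsManifold.maximalAtlas 𝓘(ℝ, E) ∞ P)
    {f : C → P} {σ : ∀ c, Cot E (f c)} {U : Set C} (hf : ContMDiffOn 𝓘(ℝ, F) 𝓘(ℝ, E) ∞ f U)
    (hfU : Set.MapsTo f U e.source) :
    SmoothAlongOn F f σ U ↔ ContMDiffOn 𝓘(ℝ, F) 𝓘(ℝ, E →L[ℝ] ℝ) ∞
      (fun c => (covModel (σ c)).comp (chartDsymm e (e (f c)))) U := by
  constructor
  · intro h
    refine contMDiffOn_clm_of_apply fun v => ?_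
    refine h.apply ((smoothFieldAlongOn_iff he hf hfU).2 ?_)
    refine (contMDiffOn_const (c := v)).congr fun c hc => ?_
    exact chartD_chartDsymm he (hfU hc) v
  · intro h
    refine smoothAlongOn_of_apply hf fun V hV X hX => ?_
    have h1 := (smoothFieldAlongOn_iff he (hf.mono hV) (hfU.mono_left hV)).1 hX
    refine ((h.mono hV).clm_apply h1).congr fun c hc => ?_
    exact (congrArg (covModel (σ c)) (chartDsymm_chartD he (hfU (hV hc)) (X c))).symm

/-- The expression in a chart of a one-form. -/
def formHat (e : OpenPartialHomeomorph P E) (α : ∀ x : P, Cot E x) (y : E) : E →L[ℝ] ℝ :=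
  (covModel (α (e.symm y))).comp (chartDsymm e y)

/-- The expression in a chart of a vector field. -/
def fieldHat (e : OpenPartialHomeomorph P E) (Z : ∀ x : P, Tan E x) (y : E) : E :=
  chartD e (e.symm y) (Z (e.symm y))

/-- The expression in a chart of a contraction map. -/
def sharpHat (e : OpenPartialHomeomorph P E) (sharp : ∀ x : P, Cot E x →L[ℝ] Tan E x) (y : E) :
    (E →L[ℝ] ℝ) →L[ℝ] E :=
  (chartD e (e.symm y)).comp ((contractionModel (sharp (e.symm y))).comp
    (ContinuousLinearMap.precomp ℝ (chartD e (e.symm y))))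

/-- The transport of a covector to the base point of a chart. -/
def covHat (e : OpenPartialHomeomorph P E) {x : P} (ξ : Cot E x) : E →L[ℝ] ℝ :=
  (covModel ξ).comp (chartDsymm e (e x))

lemma covHat_chartD (he : e ∈ IsManifold.maximalAtlas 𝓘(ℝ, E) ∞ P) {x : P} (hx : x ∈ e.source)
    (ξ : Cot E x) (v : Tan E x) : covHat e ξ (chartD e x v) = ξ v :=
  congrArg (covModel ξ) (chartDsymm_chartD he hx v)

lemma formHat_apply_chart {x : P} (hx : x ∈ e.source) (α : ∀ x : P, Cot E x) :
    formHat e α (e x) = covHat e (α x) := by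
  unfold formHat covHat
  rw [e.left_inv hx]

lemma fieldHat_apply_chart {x : P} (hx : x ∈ e.source) (Z : ∀ x : P, Tan E x) :
    fieldHat e Z (e x) = chartD e x (Z x) := by
  unfold fieldHat
  rw [e.left_inv hx]

lemma sharpHat_apply_chart {x : P} (hx : x ∈ e.source) (sharp : ∀ x : P, Cot E x →L[ℝ] Tan E x)
    (a : E →L[ℝ] ℝ) : sharpHat e sharp (e x) a =
      chartD e x (sharp x (covOfModel x (a.comp (chartD e x)))) := by
  unfold sharpHat
  rw [e.left_inv hx]
  rfl

lemma sharpHat_covHat (he : e ∈ IsManifold.maximalAtlas 𝓘(ℝ, E) ∞ P) {x : P} (hx : x ∈ e.source)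
    (sharp : ∀ x : P, Cot E x →L[ℝ] Tan E x) (ξ : Cot E x) :
    sharpHat e sharp (e x) (covHat e ξ) = chartD e x (sharp x ξ) := by
  rw [sharpHat_apply_chart hx]
  congr 2
  ext v
  exact covHat_chartD he hx ξ v

lemma isSkew_sharpHat {sharp : ∀ x : P, Cot E x →L[ℝ] Tan E x}
    (hskew : ∀ (x : P) (α β : Cot E x), β (sharp x α) = -α (sharp x β)) (y : E) :
    IsSkew (sharpHat e sharp y) := fun a b =>
  hskew (e.symm y) (covOfModel _ (a.comp (chartD e (e.symm y))))
    (covOfModel _ (b.comp (chartD e (e.symm y))))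

lemma ContMDiffOn.contDiffOn_comp_symm {W : Type*} [NormedAddCommGroup W] [NormedSpace ℝ W]
    (he : e ∈ IsManifold.maximalAtlas 𝓘(ℝ, E) ∞ P) {A : P → W} {U : Set P}
    (hA : ContMDiffOn 𝓘(ℝ, E) 𝓘(ℝ, W) ∞ A U) :
    ContDiffOn ℝ ∞ (fun y => A (e.symm y)) (e.target ∩ e.symm ⁻¹' U) :=
  contMDiffOn_iff_contDiffOn.1 (hA.comp
    ((contMDiffOn_symm_of_mem_maximalAtlas he).mono Set.inter_subset_left) fun _ hy => hy.2)

lemma contDiffOn_fieldHat (he : e ∈ IsManifold.maximalAtlas 𝓘(ℝ, E) ∞ P)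
    {Z : ∀ x : P, Tan E x} {U : Set P} (hZ : SmoothFieldOn Z U) :
    ContDiffOn ℝ ∞ (fieldHat e Z) (e.target ∩ e.symm ⁻¹' U) := by
  have h : SmoothFieldAlongOn E (fun x => x) Z (e.source ∩ U) := hZ.mono Set.inter_subset_right
  have h1 := (smoothFieldAlongOn_iff he contMDiffOn_id fun x hx => hx.1).1 h
  exact (h1.contDiffOn_comp_symm he).mono fun y hy => ⟨hy.1, e.map_target hy.1, hy.2⟩

lemma contDiffOn_formHat [FiniteDimensional ℝ E] (he : e ∈ IsManifold.maximalAtlas 𝓘(ℝ, E) ∞ P)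
    {α : ∀ x : P, Cot E x} {U : Set P} (hα : SmoothFormOn α U) :
    ContDiffOn ℝ ∞ (formHat e α) (e.target ∩ e.symm ⁻¹' U) := by
  have h : SmoothAlongOn E (fun x => x) α (e.source ∩ U) := hα.mono Set.inter_subset_right
  have h1 := (smoothAlongOn_iff he contMDiffOn_id fun x hx => hx.1).1 h
  refine ((h1.contDiffOn_comp_symm he).mono
    fun y hy => ⟨hy.1, e.map_target hy.1, hy.2⟩).congr fun y hy => ?_
  rw [← e.right_inv hy.1, formHat_apply_chart (e.map_target hy.1), e.right_inv hy.1]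
  rfl

lemma smoothFormOn_of_hat [FiniteDimensional ℝ E] (he : e ∈ IsManifold.maximalAtlas 𝓘(ℝ, E) ∞ P)
    {A : E → E →L[ℝ] ℝ} {W : Set E} (hA : ContDiffOn ℝ ∞ A W) :
    SmoothFormOn (fun x : P => covOfModel x ((A (e x)).comp (chartD e x)))
      (e.source ∩ e ⁻¹' W) := by
  refine (smoothAlongOn_iff (f := fun x => x) he contMDiffOn_id fun x hx => hx.1).2 ?_
  refine (hA.contMDiffOn.comp
    ((contMDiffOn_of_mem_maximalAtlas he).mono Set.inter_subset_left) fun x hx => hx.2).congr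
    fun x hx => ?_
  ext v
  exact congrArg (A (e x)) (chartD_chartDsymm he hx.1 v)

lemma smoothFieldOn_of_hat (he : e ∈ IsManifold.maximalAtlas 𝓘(ℝ, E) ∞ P) (v : E) :
    SmoothFieldOn (fun x : P => (chartDsymm e (e x) v : E)) e.source := by
  refine (smoothFieldAlongOn_iff (f := fun x => x) he contMDiffOn_id fun x hx => hx).2 ?_
  exact (contMDiffOn_const (c := v)).congr fun x hx => chartD_chartDsymm he hx v

lemma SmoothAlongOn.sharp {sharp : ∀ x : P, Cot E x →L[ℝ] Tan E x}
    (hs : ContMDiff 𝓘(ℝ, E) (𝓘(ℝ, E).prod 𝓘(ℝ, (E →L[ℝ] ℝ) →L[ℝ] E)) ∞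
      (fun x => Bundle.TotalSpace.mk' ((E →L[ℝ] ℝ) →L[ℝ] E)
        (E := fun x : P => Cot E x →L[ℝ] Tan E x) x (sharp x)))
    {f : C → P} {σ : ∀ c, Cot E (f c)} {U : Set C} (hσ : SmoothAlongOn F f σ U) :
    SmoothFieldAlongOn F f (fun c => sharp (f c) (σ c)) U := by
  have h1 := hs.comp_contMDiffOn hσ.contMDiffOn_base
  exact ContMDiffOn.clm_bundle_apply (E₁ := fun x : P => Cot E x)
    (E₂ := fun x : P => TangentSpace 𝓘(ℝ, E) x) h1 hσ

lemma contDiffOn_sharpHat [FiniteDimensional ℝ E] (he : e ∈ IsManifold.maximalAtlas 𝓘(ℝ, E) ∞ P)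
    {sharp : ∀ x : P, Cot E x →L[ℝ] Tan E x}
    (hs : ContMDiff 𝓘(ℝ, E) (𝓘(ℝ, E).prod 𝓘(ℝ, (E →L[ℝ] ℝ) →L[ℝ] E)) ∞
      (fun x => Bundle.TotalSpace.mk' ((E →L[ℝ] ℝ) →L[ℝ] E)
        (E := fun x : P => Cot E x →L[ℝ] Tan E x) x (sharp x))) :
    ContDiffOn ℝ ∞ (sharpHat e sharp) e.target := by
  refine contDiffOn_clm_apply.2 fun a => ?_
  have h1 : SmoothAlongOn E (fun x => x)
      (fun x : P => covOfModel x (a.comp (chartD e x))) e.source :=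
    (smoothFormOn_of_hat (W := Set.univ) he (contDiffOn_const (c := a))).mono
      fun x hx => ⟨hx, Set.mem_univ _⟩
  have h2 : SmoothFieldOn _ e.source := h1.sharp hs
  refine (contDiffOn_fieldHat he h2).mono fun y hy => ⟨hy, e.map_target hy⟩

end Charts

/-! ### The cotangent bracket and the Jacobi identity in a chart. -/

section KoszulChart

variable {E : Type*} [NormedAddCommGroup E] [NormedSpace ℝ E] [FiniteDimensional ℝ E]
  {P : Type*} [TopologicalSpace P] [ChartedSpace E P] [IsManifold 𝓘(ℝ, E) ∞ P]
  {e : OpenPartialHomeomorph P E} {x : P}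

lemma dfun_eq_fderiv (he : e ∈ IsManifold.maximalAtlas 𝓘(ℝ, E) ∞ P) (hx : x ∈ e.source)
    {h : P → ℝ} (hh : MDifferentiableAt 𝓘(ℝ, E) 𝓘(ℝ, ℝ) h x) (v : Tan E x) :
    dfun (E := E) h x v = fderiv ℝ (fun y => h (e.symm y)) (e x) (chartD e x v) := by
  have h1 : MDifferentiableAt 𝓘(ℝ, E) 𝓘(ℝ, E) e.symm (e x) :=
    (mdifferentiable_of_mem_maximalAtlas he).mdifferentiableAt_symm (e.map_source hx)
  have hx' : e.symm (e x) = x := e.left_inv hx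
  have h2 := mfderiv_comp_of_eq (I'' := 𝓘(ℝ, ℝ)) hh h1 hx'
  rw [mfderiv_eq_fderiv] at h2
  have h3 := congrArg (fun T : E →L[ℝ] ℝ => T (chartD e x v)) h2
  -- The base point is generalised so that the equality `e.symm (e x) = x` can be substituted in the
  -- tangent spaces that depend on it.
  have h4 : ∀ x' : P, x' = x → (mfderiv 𝓘(ℝ, E) 𝓘(ℝ, ℝ) h x' : E → ℝ)
      (chartDsymm e (e x) (chartD e x v)) = covModel (dfun (E := E) h x) v := by
    rintro _ rfl
    exact congrArg (covModel (dfun (E := E) h _)) (chartDsymm_chartD he hx v)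
  exact ((h4 _ hx').symm.trans h3.symm)

lemma mpullback_symm_eq_fieldHat (he : e ∈ IsManifold.maximalAtlas 𝓘(ℝ, E) ∞ P)
    (X : ∀ x : P, Tan E x) {y : E} (hy : y ∈ e.target) :
    VectorField.mpullback 𝓘(ℝ, E) 𝓘(ℝ, E) e.symm X y = fieldHat e X y := by
  have h : (mfderiv 𝓘(ℝ, E) 𝓘(ℝ, E) e.symm y).inverse = mfderiv 𝓘(ℝ, E) 𝓘(ℝ, E) e (e.symm y) := by
    refine ContinuousLinearMap.inverse_eq ?_ ?_
    · have := (mdifferentiable_of_mem_maximalAtlas he).symm_comp_deriv (e.map_target hy)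
      rwa [e.right_inv hy] at this
    · exact (mdifferentiable_of_mem_maximalAtlas he).comp_symm_deriv hy
  rw [VectorField.mpullback_apply, h]
  rfl

/-- Lie brackets commute with pullback by the local diffeomorphism `e.symm`, and pullback by it is
exactly `fieldHat` on the target of the chart. -/
lemma chartD_mlieBracket (he : e ∈ IsManifold.maximalAtlas 𝓘(ℝ, E) ∞ P) (hx : x ∈ e.source)
    {X Z : ∀ x : P, Tan E x} {U : Set P} (hU : IsOpen U) (hxU : x ∈ U)
    (hX : SmoothFieldOn X U) (hZ : SmoothFieldOn Z U) :
    chartD e x (VectorField.mlieBracket 𝓘(ℝ, E) X Z x) =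
      VectorField.lieBracket ℝ (fieldHat e X) (fieldHat e Z) (e x) := by
  have : CompleteSpace E := FiniteDimensional.complete ℝ E
  have hx' : e.symm (e x) = x := e.left_inv hx
  have hd : ∀ {Y : ∀ x : P, Tan E x}, SmoothFieldOn Y U →
      MDifferentiableAt 𝓘(ℝ, E) (𝓘(ℝ, E).prod 𝓘(ℝ, E))
        (fun x => (⟨x, Y x⟩ : TangentBundle 𝓘(ℝ, E) P)) (e.symm (e x)) := by
    intro Y hY
    rw [hx']
    exact (hY.contMDiffAt (hU.mem_nhds hxU)).mdifferentiableAt (by simp)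
  have : IsManifold 𝓘(ℝ, E) (minSmoothness ℝ 3) P := by
    have : (minSmoothness ℝ 3 : WithTop ℕ∞) ≤ ∞ := by simp; exact WithTop.coe_le_coe.2 le_top
    exact IsManifold.of_le this
  have h1 := VectorField.mpullback_mlieBracket (n := ∞) (hd hX) (hd hZ)
    (contMDiffAt_symm_of_mem_maximalAtlas he (e.map_source hx))
    (by simp; exact WithTop.coe_le_coe.2 le_top)
  rw [mpullback_symm_eq_fieldHat he _ (e.map_source hx)] at h1
  have h2 : ∀ Y : ∀ x : P, Tan E x,
      VectorField.mpullback 𝓘(ℝ, E) 𝓘(ℝ, E) e.symm Y =ᶠ[𝓝 (e x)] fieldHat e Y := fun Y => by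
    filter_upwards [e.open_target.mem_nhds (e.map_source hx)] with y hy
      using mpullback_symm_eq_fieldHat he Y hy
  rw [(h2 X).mlieBracket_vectorField_eq (h2 Z)] at h1
  refine (fieldHat_apply_chart hx _).symm.trans (h1.trans ?_)
  exact mlieBracket_vectorSpace _ _ _

lemma lieDerivForm_eq_hat (he : e ∈ IsManifold.maximalAtlas 𝓘(ℝ, E) ∞ P) (hx : x ∈ e.source)
    {X Z : ∀ x : P, Tan E x} {β : ∀ x : P, Cot E x} {U : Set P} (hU : IsOpen U) (hxU : x ∈ U)
    (hX : SmoothFieldOn X U) (hβ : SmoothFormOn β U) (hZ : SmoothFieldOn Z U) :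
    lieDerivForm X β Z x = lieDerivForm (E := E) (M := E) (fieldHat e X) (formHat e β)
      (fieldHat e Z) (e x) := by
  have hs : ContMDiffOn 𝓘(ℝ, E) 𝓘(ℝ, ℝ) ∞ (fun y => β y (Z y)) U :=
    SmoothAlongOn.apply (f := fun x => x) hβ hZ
  have hs' : MDifferentiableAt 𝓘(ℝ, E) 𝓘(ℝ, ℝ) (fun y => β y (Z y)) x :=
    (hs.contMDiffAt (hU.mem_nhds hxU)).mdifferentiableAt (by simp)
  have e1 : (fun y => β (e.symm y) (Z (e.symm y))) =ᶠ[𝓝 (e x)]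
      fun y => formHat e β y (fieldHat e Z y) := by
    filter_upwards [e.open_target.mem_nhds (e.map_source hx)] with y hy
    have h1 := covHat_chartD he (e.map_target hy) (β (e.symm y)) (Z (e.symm y))
    rw [← h1, ← formHat_apply_chart (e.map_target hy), e.right_inv hy]
    rfl
  have e2 := covHat_chartD he hx (β x) (VectorField.mlieBracket 𝓘(ℝ, E) X Z x)
  rw [chartD_mlieBracket he hx hU hxU hX hZ, ← formHat_apply_chart hx] at e2
  rw [lieDerivForm_vectorSpace, e2, ← e1.fderiv_eq, fieldHat_apply_chart hx,
    ← dfun_eq_fderiv he hx hs']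
  rfl

/-- The bracket of the cotangent Lie algebroid, in a chart. -/
lemma koszul_eq_hat (he : e ∈ IsManifold.maximalAtlas 𝓘(ℝ, E) ∞ P) (hx : x ∈ e.source)
    {sharp : ∀ x : P, Cot E x →L[ℝ] Tan E x}
    (hskew : ∀ (x : P) (α β : Cot E x), β (sharp x α) = -α (sharp x β))
    {α β : ∀ x : P, Cot E x} {Z : ∀ x : P, Tan E x} {U : Set P} (hU : IsOpen U) (hxU : x ∈ U)
    (hS : DifferentiableAt ℝ (sharpHat e sharp) (e x))
    (hα : SmoothFormOn α U) (hβ : SmoothFormOn β U) (hZ : SmoothFieldOn Z U)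
    (hsα : SmoothFieldOn (fun y => sharp y (α y)) U)
    (hsβ : SmoothFieldOn (fun y => sharp y (β y)) U) :
    koszul sharp α β Z x =
      lieForm (sharpHat e sharp) (formHat e α) (formHat e β) (e x) (chartD e x (Z x)) := by
  have hmem : e.target ∩ e.symm ⁻¹' U ∈ 𝓝 (e x) :=
    (e.isOpen_inter_preimage_symm hU).mem_nhds ⟨e.map_source hx, by simpa [e.left_inv hx] using hxU⟩
  have hfield : ∀ γ : ∀ x : P, Cot E x, ∀ y ∈ e.target,
      fieldHat e (fun y => sharp y (γ y)) y = sharpHat e sharp y (formHat e γ y) := by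
    intro γ y hy
    rw [← e.right_inv hy, fieldHat_apply_chart (e.map_target hy),
      formHat_apply_chart (e.map_target hy), sharpHat_covHat he (e.map_target hy)]
  have hfield' : ∀ γ : ∀ x : P, Cot E x,
      fieldHat e (fun y => sharp y (γ y)) =ᶠ[𝓝 (e x)]
        fun y => sharpHat e sharp y (formHat e γ y) := fun γ => by
    filter_upwards [e.open_target.mem_nhds (e.map_source hx)] with y hy using hfield γ y hy
  rw [← fieldHat_apply_chart hx, ← koszul_eq_lieForm hS
    (Filter.Eventually.of_forall fun y => isSkew_sharpHat hskew y)
    (((contDiffOn_formHat he hα).contDiffAt hmem).differentiableAt (by simp))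
    (((contDiffOn_formHat he hβ).contDiffAt hmem).differentiableAt (by simp))
    (((contDiffOn_fieldHat he hZ).contDiffAt hmem).differentiableAt (by simp))]
  have e0 : koszul (E := E) (M := E) (sharpHat e sharp) (formHat e α) (formHat e β)
        (fieldHat e Z) (e x) =
      lieDerivForm (E := E) (M := E) (fun y => sharpHat e sharp y (formHat e α y)) (formHat e β)
        (fieldHat e Z) (e x)
      - lieDerivForm (E := E) (M := E) (fun y => sharpHat e sharp y (formHat e β y)) (formHat e α)
        (fieldHat e Z) (e x)
      - fderiv ℝ (fun y => formHat e β y (sharpHat e sharp y (formHat e α y))) (e x)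
        (fieldHat e Z (e x)) := by
    rw [← mfderiv_eq_fderiv]
    rfl
  have hs : ContMDiffOn 𝓘(ℝ, E) 𝓘(ℝ, ℝ) ∞ (fun y => β y (sharp y (α y))) U :=
    SmoothAlongOn.apply (f := fun x => x) hβ hsα
  have hs' : MDifferentiableAt 𝓘(ℝ, E) 𝓘(ℝ, ℝ) (fun y => β y (sharp y (α y))) x :=
    (hs.contMDiffAt (hU.mem_nhds hxU)).mdifferentiableAt (by simp)
  have e3 : (fun y => β (e.symm y) (sharp (e.symm y) (α (e.symm y)))) =ᶠ[𝓝 (e x)]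
      fun y => formHat e β y (sharpHat e sharp y (formHat e α y)) := by
    filter_upwards [e.open_target.mem_nhds (e.map_source hx)] with y hy
    have h1 := covHat_chartD he (e.map_target hy) (β (e.symm y)) (sharp (e.symm y) (α (e.symm y)))
    rw [← h1, ← formHat_apply_chart (e.map_target hy), e.right_inv hy, ← hfield α y hy]
    rfl
  have e4 : koszul sharp α β Z x = lieDerivForm (fun y => sharp y (α y)) β Z x
      - lieDerivForm (fun y => sharp y (β y)) α Z x
      - dfun (E := E) (fun y => β y (sharp y (α y))) x (Z x) := rfl
  rw [e0, e4, dfun_eq_fderiv he hx hs', e3.fderiv_eq, lieDerivForm_eq_hat he hx hU hxU hsα hβ hZ,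
    lieDerivForm_eq_hat he hx hU hxU hsβ hα hZ, fieldHat_apply_chart hx]
  simp only [lieDerivForm_vectorSpace, (hfield' _).lieBracket_vectorField_eq Filter.EventuallyEq.rfl,
    (hfield' _).self_of_nhds]

/-- The Jacobi identity for functions is applied to linear coordinate functions, `a` composed with
the chart. Their differentials are constant in the chart, so a double bracket reduces to a single
derivative of the contraction map. -/
lemma IsPoisson.jacobiAt_sharpHat (he : e ∈ IsManifold.maximalAtlas 𝓘(ℝ, E) ∞ P)
    {sharp : ∀ x : P, Cot E x →L[ℝ] Tan E x} (hP : IsPoisson sharp) {y : E} (hy : y ∈ e.target) :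
    JacobiAt (sharpHat e sharp) y := by
  have hS := contDiffOn_sharpHat he hP.smooth
  have hlin : ∀ a : E →L[ℝ] ℝ, ContMDiffOn 𝓘(ℝ, E) 𝓘(ℝ, ℝ) ∞ (fun x => a (e x)) e.source :=
    fun a => a.contMDiff.comp_contMDiffOn (contMDiffOn_of_mem_maximalAtlas he)
  have hd : ∀ a : E →L[ℝ] ℝ, ∀ x ∈ e.source,
      dfun (E := E) (fun x => a (e x)) x = covOfModel x (a.comp (chartD e x)) := by
    intro a x hx
    ext v
    have h1 := dfun_eq_fderiv he hx
      (((hlin a).contMDiffAt (e.open_source.mem_nhds hx)).mdifferentiableAt (by simp)) v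
    have h2 : (fun y => a (e (e.symm y))) =ᶠ[𝓝 (e x)] a := by
      filter_upwards [e.open_target.mem_nhds (e.map_source hx)] with y hy
      rw [e.right_inv hy]
    rw [h1, h2.fderiv_eq, a.fderiv]
    rfl
  have hbr : ∀ a b : E →L[ℝ] ℝ, ∀ x ∈ e.source,
      poissonBracket sharp (fun x => a (e x)) (fun x => b (e x)) x =
        b (sharpHat e sharp (e x) a) := by
    intro a b x hx
    rw [poissonBracket, hd a x hx, hd b x hx, sharpHat_apply_chart hx]
    rfl
  have hx := e.map_target hy
  have hdS : DifferentiableAt ℝ (sharpHat e sharp) y :=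
    (hS.contDiffAt (e.open_target.mem_nhds hy)).differentiableAt (by simp)
  have hbr2 : ∀ a b c : E →L[ℝ] ℝ,
      poissonBracket sharp (fun x => a (e x))
        (poissonBracket sharp (fun x => b (e x)) (fun x => c (e x))) (e.symm y) =
      c (fderiv ℝ (sharpHat e sharp) y (sharpHat e sharp y a) b) := by
    intro a b c
    have h1 : (poissonBracket sharp (fun x => b (e x)) (fun x => c (e x))) =ᶠ[𝓝 (e.symm y)]
        fun x => c (sharpHat e sharp (e x) b) := by
      filter_upwards [e.open_source.mem_nhds hx] with x hx using hbr b c x hx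
    have h2 : ContMDiffOn 𝓘(ℝ, E) 𝓘(ℝ, ℝ) ∞ (fun x => c (sharpHat e sharp (e x) b)) e.source := by
      have : ContDiffOn ℝ ∞ (fun y => c (sharpHat e sharp y b)) e.target :=
        contDiffOn_const.clm_apply (hS.clm_apply contDiffOn_const)
      exact this.contMDiffOn.comp (contMDiffOn_of_mem_maximalAtlas he) fun x hx => e.map_source hx
    have h3 : (fun y => c (sharpHat e sharp (e (e.symm y)) b)) =ᶠ[𝓝 y]
        fun y => c (sharpHat e sharp y b) := by
      filter_upwards [e.open_target.mem_nhds hy] with z hz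
      rw [e.right_inv hz]
    have h4 : dfun (E := E) (poissonBracket sharp (fun x => b (e x)) (fun x => c (e x)))
        (e.symm y) = dfun (E := E) (fun x => c (sharpHat e sharp (e x) b)) (e.symm y) :=
      h1.mfderiv_eq
    have h5 := sharpHat_apply_chart (sharp := sharp) hx a
    rw [poissonBracket, h4, hd a _ hx, dfun_eq_fderiv he hx
      ((h2.contMDiffAt (e.open_source.mem_nhds hx)).mdifferentiableAt (by simp)), ← h5,
      e.right_inv hy, h3.fderiv_eq, fderiv_clm_apply_apply (differentiableAt_const c)
        (hdS.clm_apply (differentiableAt_const b)),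
      fderiv_clm_apply_apply hdS (differentiableAt_const b)]
    simp
  intro a b c
  have h := hP.jacobi e.source _ _ _ e.open_source (hlin a) (hlin b) (hlin c) _ hx
  rwa [hbr2, hbr2, hbr2] at h

end KoszulChart

/-! ### Charts in which an immersion is a linear inclusion. -/

section AdaptedCharts

variable {E : Type*} [NormedAddCommGroup E] [NormedSpace ℝ E]
  {P : Type*} [TopologicalSpace P] [ChartedSpace E P] [IsManifold 𝓘(ℝ, E) ∞ P]
  {F : Type*} [NormedAddCommGroup F] [NormedSpace ℝ F]
  {C : Type*} [TopologicalSpace C] [ChartedSpace F C] [IsManifold 𝓘(ℝ, F) ∞ C]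

lemma formHat_of_hat {e : OpenPartialHomeomorph P E} (he : e ∈ IsManifold.maximalAtlas 𝓘(ℝ, E) ∞ P)
    (A : E → E →L[ℝ] ℝ) {y : E} (hy : y ∈ e.target) :
    formHat e (fun x : P => covOfModel x ((A (e x)).comp (chartD e x))) y = A y := by
  ext v
  have h := congrArg (A (e (e.symm y))) (chartD_chartDsymm' he hy v)
  refine Eq.trans h ?_
  rw [e.right_inv hy]

lemma eq_of_covHat_eq {e : OpenPartialHomeomorph P E} (he : e ∈ IsManifold.maximalAtlas 𝓘(ℝ, E) ∞ P)
    {x : P} (hx : x ∈ e.source) {ξ η : Cot E x} (h : covHat e ξ = covHat e η) : ξ = η := by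
  ext v
  rw [← covHat_chartD he hx, h, covHat_chartD he hx]

/-- A pair of charts in which `f : C → P` is a linear inclusion. -/
structure AdaptedChart (f : C → P) where
  e : OpenPartialHomeomorph P E
  d : OpenPartialHomeomorph C F
  ι : F →L[ℝ] E
  ρ : E →L[ℝ] F
  e_mem : e ∈ IsManifold.maximalAtlas 𝓘(ℝ, E) ∞ P
  d_mem : d ∈ IsManifold.maximalAtlas 𝓘(ℝ, F) ∞ C
  ρ_ι : ∀ z, ρ (ι z) = z
  mapsTo : ∀ c ∈ d.source, f c ∈ e.source
  apply_eq : ∀ c ∈ d.source, e (f c) = ι (d c)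

/-- This is the local normal form of an immersion, u ↦ (u, 0); the retraction `ρ` is the first
projection. -/
lemma exists_adaptedChart {f : C → P} (hf : IsImmersion 𝓘(ℝ, F) 𝓘(ℝ, E) ∞ f) (c : C) :
    ∃ A : AdaptedChart (E := E) (F := F) f, c ∈ A.d.source := by
  have h := hf.isImmersionAt c
  refine ⟨⟨h.codChart, h.domChart,
    (h.equiv : (F × h.complement) →L[ℝ] E).comp (ContinuousLinearMap.inl ℝ F h.complement),
    (ContinuousLinearMap.fst ℝ F h.complement).comp (h.equiv.symm : E →L[ℝ] (F × h.complement)),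
    h.codChart_mem_maximalAtlas, h.domChart_mem_maximalAtlas, fun z => by simp,
    fun c hc => h.source_subset_preimage_source hc, fun c hc => ?_⟩, h.mem_domChart_source⟩
  have h1 := h.writtenInCharts (show h.domChart c ∈ _ by simpa using h.domChart.map_source hc)
  simpa [h.domChart.left_inv hc] using h1

namespace AdaptedChart

variable {f : C → P} (A : AdaptedChart (E := E) (F := F) f)

lemma ι_mem_target {u : F} (hu : u ∈ A.d.target) : A.ι u ∈ A.e.target := by
  have h := A.apply_eq _ (A.d.map_target hu)
  rw [A.d.right_inv hu] at h
  exact h ▸ A.e.map_source (A.mapsTo _ (A.d.map_target hu))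

lemma symm_ι {u : F} (hu : u ∈ A.d.target) : A.e.symm (A.ι u) = f (A.d.symm u) := by
  have h := A.apply_eq _ (A.d.map_target hu)
  rw [A.d.right_inv hu] at h
  rw [← h, A.e.left_inv (A.mapsTo _ (A.d.map_target hu))]

lemma symm_ι_apply {c : C} (hc : c ∈ A.d.source) : A.e.symm (A.ι (A.d c)) = f c := by
  rw [A.symm_ι (A.d.map_source hc), A.d.left_inv hc]

lemma contMDiffOn : ContMDiffOn 𝓘(ℝ, F) 𝓘(ℝ, E) ∞ f A.d.source := by
  have h1 : ContMDiffOn 𝓘(ℝ, F) 𝓘(ℝ, E) ∞ (fun c => A.ι (A.d c)) A.d.source :=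
    A.ι.contMDiff.comp_contMDiffOn (contMDiffOn_of_mem_maximalAtlas A.d_mem)
  refine ((contMDiffOn_symm_of_mem_maximalAtlas A.e_mem).comp h1
    fun c hc => A.ι_mem_target (A.d.map_source hc)).congr fun c hc => ?_
  exact (A.symm_ι_apply hc).symm

lemma chartD_mfderiv {c : C} (hc : c ∈ A.d.source) (w : Tan F c) :
    chartD A.e (f c) (mfderiv 𝓘(ℝ, F) 𝓘(ℝ, E) f c w) = A.ι (chartD A.d c w) := by
  have hn : A.d.source ∈ 𝓝 c := A.d.open_source.mem_nhds hc
  have h1 : MDifferentiableAt 𝓘(ℝ, F) 𝓘(ℝ, E) f c :=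
    (A.contMDiffOn.contMDiffAt hn).mdifferentiableAt (by simp)
  have h2 := mfderiv_comp c
    ((mdifferentiable_of_mem_maximalAtlas A.e_mem).mdifferentiableAt (A.mapsTo c hc)) h1
  have h3 := mfderiv_comp c (I' := 𝓘(ℝ, F)) (I'' := 𝓘(ℝ, E)) (g := A.ι)
    (A.ι.contMDiff.mdifferentiableAt (n := 1) one_ne_zero)
    ((mdifferentiable_of_mem_maximalAtlas A.d_mem).mdifferentiableAt hc)
  have h4 : (A.e ∘ f) =ᶠ[𝓝 c] (A.ι ∘ A.d) := by
    filter_upwards [hn] with c' hc' using A.apply_eq c' hc'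
  have h5 := h4.mfderiv_eq (I := 𝓘(ℝ, F)) (I' := 𝓘(ℝ, E))
  have h6 : (mfderiv 𝓘(ℝ, F) 𝓘(ℝ, E) A.ι (A.d c) : F →L[ℝ] E) = A.ι := by
    rw [mfderiv_eq_fderiv]
    exact A.ι.fderiv
  have e1 := congrArg (fun T : F →L[ℝ] E => T w) h2
  have e2 := congrArg (fun T : F →L[ℝ] E => T w) h3
  have e3 := congrArg (fun T : F →L[ℝ] E => T w) h5
  have e4 := congrArg (fun T : F →L[ℝ] E => T (chartD A.d c w)) h6
  exact (e1.symm.trans e3).trans (e2.trans e4)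

lemma mfderiv_eq {c : C} (hc : c ∈ A.d.source) (w : Tan F c) :
    mfderiv 𝓘(ℝ, F) 𝓘(ℝ, E) f c w = chartDsymm A.e (A.e (f c)) (A.ι (chartD A.d c w)) := by
  rw [← A.chartD_mfderiv hc]
  exact (chartDsymm_chartD A.e_mem (A.mapsTo c hc) _).symm

lemma mfderiv_injective {c : C} (hc : c ∈ A.d.source) :
    Function.Injective (mfderiv 𝓘(ℝ, F) 𝓘(ℝ, E) f c) := by
  intro w w' h
  have h1 := congrArg (fun v : E => A.ρ (chartD A.e (f c) v)) h
  have e1 : ∀ w : Tan F c, A.ρ (chartD A.e (f c) (mfderiv 𝓘(ℝ, F) 𝓘(ℝ, E) f c w)) =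
      chartD A.d c w := fun w => by rw [A.chartD_mfderiv hc, A.ρ_ι]
  have h2 : chartD A.d c w = chartD A.d c w' := (e1 w).symm.trans (h1.trans (e1 w'))
  have h3 := congrArg (chartDsymm A.d (A.d c)) h2
  exact (chartDsymm_chartD A.d_mem hc w).symm.trans (h3.trans (chartDsymm_chartD A.d_mem hc w'))

lemma mem_tangentAlong_iff {c : C} (hc : c ∈ A.d.source) (v : Tan E (f c)) :
    v ∈ tangentAlong F f c ↔ chartD A.e (f c) v = A.ι (A.ρ (chartD A.e (f c) v)) := by
  constructor
  · rintro ⟨w, rfl⟩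
    have h := A.chartD_mfderiv hc w
    have h2 := congrArg (fun v => A.ι (A.ρ v)) h
    rw [A.ρ_ι] at h2
    exact h.trans h2.symm
  · intro h
    refine ⟨chartDsymm A.d (A.d c) (A.ρ (chartD A.e (f c) v)), ?_⟩
    have h1 := A.mfderiv_eq hc (chartDsymm A.d (A.d c) (A.ρ (chartD A.e (f c) v)))
    rw [chartD_chartDsymm A.d_mem hc, ← h] at h1
    exact h1.trans (chartDsymm_chartD A.e_mem (A.mapsTo c hc) v)

lemma mem_conormal_iff {c : C} (hc : c ∈ A.d.source) (ξ : Cot E (f c)) :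
    ξ ∈ conormal F f c ↔ ∀ z, covHat A.e ξ (A.ι z) = 0 := by
  constructor
  · intro h z
    have h1 := h _ ⟨chartDsymm A.d (A.d c) z, rfl⟩
    have h2 := A.mfderiv_eq hc (chartDsymm A.d (A.d c) z)
    rw [chartD_chartDsymm A.d_mem hc] at h2
    exact (congrArg (covModel ξ) h2).symm.trans h1
  · rintro h _ ⟨w, rfl⟩
    exact (congrArg (covModel ξ) (A.mfderiv_eq hc w)).trans (h _)

lemma mem_charConormal_iff (sharp : ∀ x : P, Cot E x →L[ℝ] Tan E x) {c : C} (hc : c ∈ A.d.source)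
    (ξ : Cot E (f c)) : ξ ∈ charConormal F sharp f c ↔
      IsCharCovector (sharpHat A.e sharp) A.ι A.ρ (A.d c) (covHat A.e ξ) := by
  have h : sharpHat A.e sharp (A.ι (A.d c)) (covHat A.e ξ) = chartD A.e (f c) (sharp (f c) ξ) := by
    rw [← A.apply_eq c hc, sharpHat_covHat A.e_mem (A.mapsTo c hc)]
  unfold IsCharCovector
  rw [h]
  exact and_congr (A.mem_conormal_iff hc ξ) (A.mem_tangentAlong_iff hc _)

/-- The expression in an adapted chart of a section of `T*P|_C`. -/
def secHat (σ : ∀ c, Cot E (f c)) (u : F) : E →L[ℝ] ℝ := covHat A.e (σ (A.d.symm u))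

lemma secHat_apply_chart (σ : ∀ c, Cot E (f c)) {c : C} (hc : c ∈ A.d.source) :
    A.secHat σ (A.d c) = covHat A.e (σ c) := by
  unfold secHat
  rw [A.d.left_inv hc]

/-- The section of `T*P|_C` with given expression in an adapted chart. -/
def secOfHat (s : F → E →L[ℝ] ℝ) (c : C) : Cot E (f c) :=
  covOfModel (f c) ((s (A.d c)).comp (chartD A.e (f c)))

lemma covHat_secOfHat (s : F → E →L[ℝ] ℝ) {c : C} (hc : c ∈ A.d.source) :
    covHat A.e (A.secOfHat s c) = s (A.d c) := by
  ext v
  exact congrArg (s (A.d c)) (chartD_chartDsymm A.e_mem (A.mapsTo c hc) v)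

/-- The extension to `P` of a section of `T*P|_C`, constant in the normal directions of an adapted
chart. -/
def extend (s : F → E →L[ℝ] ℝ) (x : P) : Cot E x :=
  covOfModel x ((s (A.ρ (A.e x))).comp (chartD A.e x))

lemma extend_apply (s : F → E →L[ℝ] ℝ) {c : C} (hc : c ∈ A.d.source) :
    A.extend s (f c) = A.secOfHat s c := by
  unfold extend secOfHat
  rw [A.apply_eq c hc, A.ρ_ι]

variable [FiniteDimensional ℝ E]

lemma contDiffOn_secHat {σ : ∀ c, Cot E (f c)} {U : Set C} (hσ : SmoothAlongOn F f σ U) :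
    ContDiffOn ℝ ∞ (A.secHat σ) (A.d.target ∩ A.d.symm ⁻¹' U) := by
  have h1 := (smoothAlongOn_iff A.e_mem (A.contMDiffOn.mono (Set.inter_subset_left (t := U)))
    fun c hc => A.mapsTo c hc.1).1 (hσ.mono Set.inter_subset_right)
  exact (h1.contDiffOn_comp_symm A.d_mem).mono fun u hu => ⟨hu.1, A.d.map_target hu.1, hu.2⟩

lemma smoothAlongOn_secOfHat {s : F → E →L[ℝ] ℝ} {W : Set F} (hs : ContDiffOn ℝ ∞ s W) :
    SmoothAlongOn F f (A.secOfHat s) (A.d.source ∩ A.d ⁻¹' W) := by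
  refine (smoothAlongOn_iff A.e_mem (A.contMDiffOn.mono Set.inter_subset_left)
    fun c hc => A.mapsTo c hc.1).2 ?_
  refine (hs.contMDiffOn.comp
    ((contMDiffOn_of_mem_maximalAtlas A.d_mem).mono Set.inter_subset_left)
    fun c hc => hc.2).congr fun c hc => A.covHat_secOfHat s hc.1

lemma smoothFormOn_extend {s : F → E →L[ℝ] ℝ} {W : Set F} (hs : ContDiffOn ℝ ∞ s W) :
    SmoothFormOn (A.extend s) (A.e.source ∩ A.e ⁻¹' (A.ρ ⁻¹' W)) :=
  smoothFormOn_of_hat (A := fun y => s (A.ρ y)) A.e_mem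
    (hs.comp A.ρ.contDiff.contDiffOn fun _ h => h)

lemma smoothFieldOn_of_comp {X : ∀ c, Tan F c} {U : Set C} (hU : U ⊆ A.d.source)
    (hX : SmoothFieldAlongOn F f (fun c => mfderiv 𝓘(ℝ, F) 𝓘(ℝ, E) f c (X c)) U) :
    SmoothFieldOn X U := by
  refine (smoothFieldAlongOn_iff (f := fun c => c) A.d_mem contMDiffOn_id fun c hc => hU hc).2 ?_
  have h1 := (smoothFieldAlongOn_iff A.e_mem (A.contMDiffOn.mono hU)
    fun c hc => A.mapsTo c (hU hc)).1 hX
  refine (A.ρ.contMDiff.comp_contMDiffOn h1).congr fun c hc => ?_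
  have h2 := congrArg A.ρ (A.chartD_mfderiv (hU hc) (X c))
  rw [A.ρ_ι] at h2
  exact h2.symm

end AdaptedChart

end AdaptedCharts

/-! ### The bracket of sections of N*C ∩ ♯⁻¹TC. -/

section CharAlgebroid

variable {E : Type*} [NormedAddCommGroup E] [NormedSpace ℝ E] [FiniteDimensional ℝ E]
  {P : Type*} [TopologicalSpace P] [ChartedSpace E P] [IsManifold 𝓘(ℝ, E) ∞ P]
  {F : Type*} [NormedAddCommGroup F] [NormedSpace ℝ F]
  {C : Type*} [TopologicalSpace C] [ChartedSpace F C] [IsManifold 𝓘(ℝ, F) ∞ C]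
  {sharp : ∀ x : P, Cot E x →L[ℝ] Tan E x} {f : C → P}

/-- The one-form `α` is smooth around `f c` and extends `σ` around `c`. -/
def IsLocalExtension (f : C → P) (σ : ∀ c, Cot E (f c)) (c : C) (α : ∀ x : P, Cot E x) : Prop :=
  (∃ U : Set P, IsOpen U ∧ f c ∈ U ∧ SmoothFormOn α U) ∧ ∀ᶠ c' in 𝓝 c, α (f c') = σ c'

lemma SmoothAlongOn.smul_fun {σ : ∀ c, Cot E (f c)} {h : C → ℝ}
    {U : Set C} (hσ : SmoothAlongOn F f σ U) (hh : SmoothFunOn F h U) :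
    SmoothAlongOn F f (fun c => h c • σ c) U :=
  smoothAlongOn_of_apply hσ.contMDiffOn_base fun _ hV _ hX =>
    (ContMDiffOn.mul (hh.mono hV) (SmoothAlongOn.apply (ContMDiffOn.mono hσ hV) hX) :)

lemma SmoothAlongOn.add {σ τ : ∀ c, Cot E (f c)} {U : Set C} (hσ : SmoothAlongOn F f σ U)
    (hτ : SmoothAlongOn F f τ U) : SmoothAlongOn F f (σ + τ) U :=
  smoothAlongOn_of_apply hσ.contMDiffOn_base fun _ hV _ hX =>
    (ContMDiffOn.add (SmoothAlongOn.apply (ContMDiffOn.mono hσ hV) hX)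
      (SmoothAlongOn.apply (ContMDiffOn.mono hτ hV) hX) :)

lemma IsSection.add {B : ∀ c, Submodule ℝ (Cot E (f c))} {σ τ : ∀ c, Cot E (f c)}
    (hσ : IsSection F f B σ) (hτ : IsSection F f B τ) : IsSection F f B (σ + τ) :=
  ⟨fun c => (B c).add_mem (hσ.mem c) (hτ.mem c), hσ.smooth.add hτ.smooth⟩

lemma IsSection.smul_fun {B : ∀ c, Submodule ℝ (Cot E (f c))} {σ : ∀ c, Cot E (f c)} {h : C → ℝ}
    (hσ : IsSection F f B σ) (hh : SmoothFunOn F h Set.univ) :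
    IsSection F f B (fun c => h c • σ c) :=
  ⟨fun c => (B c).smul_mem _ (hσ.mem c), hσ.smooth.smul_fun hh⟩

namespace AdaptedChart

variable (A : AdaptedChart (E := E) (F := F) f)

/-- The expression in an adapted chart of a section, extended to the ambient model space. -/
def liftHat (σ : ∀ c, Cot E (f c)) (y : E) : E →L[ℝ] ℝ := A.secHat σ (A.ρ y)

lemma liftHat_ι (σ : ∀ c, Cot E (f c)) (u : F) : A.liftHat σ (A.ι u) = A.secHat σ u := by
  unfold liftHat
  rw [A.ρ_ι]

lemma contDiffAt_liftHat {σ : ∀ c, Cot E (f c)} (hσ : SmoothAlongOn F f σ Set.univ) {u : F}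
    (hu : u ∈ A.d.target) : ContDiffAt ℝ ∞ (A.liftHat σ) (A.ι u) := by
  have h1 : ContDiffAt ℝ ∞ (A.secHat σ) (A.ρ (A.ι u)) := by
    rw [A.ρ_ι]
    exact (A.contDiffOn_secHat hσ).contDiffAt
      ((A.d.open_target.inter (by simp)).mem_nhds ⟨hu, by simp⟩)
  exact h1.comp (A.ι u) A.ρ.contDiff.contDiffAt

lemma contDiffOn_liftHat {σ : ∀ c, Cot E (f c)} (hσ : SmoothAlongOn F f σ Set.univ) :
    ContDiffOn ℝ ∞ (A.liftHat σ) (A.e.target ∩ A.ρ ⁻¹' A.d.target) :=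
  (A.contDiffOn_secHat hσ).comp A.ρ.contDiff.contDiffOn fun _ hy => ⟨hy.2, Set.mem_univ _⟩

lemma contDiffAt_sharpHat (hP : IsPoisson sharp) {u : F} (hu : u ∈ A.d.target) :
    ContDiffAt ℝ ∞ (sharpHat A.e sharp) (A.ι u) :=
  (contDiffOn_sharpHat A.e_mem hP.smooth).contDiffAt
    (A.e.open_target.mem_nhds (A.ι_mem_target hu))

lemma isSkew_eventually (hP : IsPoisson sharp) (y : E) :
    ∀ᶠ x in 𝓝 y, IsSkew (sharpHat A.e sharp x) :=
  Filter.Eventually.of_forall (isSkew_sharpHat hP.skew)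

lemma isLocalExtension_extend {σ : ∀ c, Cot E (f c)} (hσ : SmoothAlongOn F f σ Set.univ) {c : C}
    (hc : c ∈ A.d.source) : IsLocalExtension f σ c (A.extend (A.secHat σ)) := by
  have hW : IsOpen (A.d.target ∩ A.d.symm ⁻¹' Set.univ) := A.d.open_target.inter (by simp)
  refine ⟨⟨_, A.e.isOpen_inter_preimage (hW.preimage A.ρ.continuous), ⟨A.mapsTo c hc, ?_⟩,
    A.smoothFormOn_extend (A.contDiffOn_secHat hσ)⟩, ?_⟩
  · change A.ρ (A.e (f c)) ∈ A.d.target ∩ A.d.symm ⁻¹' Set.univ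
    rw [A.apply_eq c hc, A.ρ_ι]
    exact ⟨A.d.map_source hc, Set.mem_univ _⟩
  · filter_upwards [A.d.open_source.mem_nhds hc] with c' hc'
    refine eq_of_covHat_eq A.e_mem (A.mapsTo c' hc') ?_
    rw [A.extend_apply _ hc', A.covHat_secOfHat _ hc', A.secHat_apply_chart _ hc']

lemma formHat_ι_eventually {σ : ∀ c, Cot E (f c)} {c : C} (hc : c ∈ A.d.source)
    {α : ∀ x : P, Cot E x} (hα : ∀ᶠ c' in 𝓝 c, α (f c') = σ c') :
    ∀ᶠ u in 𝓝 (A.d c), formHat A.e α (A.ι u) = A.secHat σ u := by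
  have h1 : Filter.Tendsto A.d.symm (𝓝 (A.d c)) (𝓝 c) := A.d.tendsto_symm hc
  filter_upwards [h1.eventually hα, A.d.open_target.mem_nhds (A.d.map_source hc)] with u hu hu'
  have h2 := A.apply_eq _ (A.d.map_target hu')
  rw [A.d.right_inv hu'] at h2
  rw [← h2, formHat_apply_chart (A.mapsTo _ (A.d.map_target hu')), hu]
  rfl

variable (sharp) in
/-- The bracket of two sections, in an adapted chart. -/
def bracketHat (σ τ : ∀ c, Cot E (f c)) (u : F) : E →L[ℝ] ℝ :=
  lieForm (sharpHat A.e sharp) (A.liftHat σ) (A.liftHat τ) (A.ι u)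

lemma isCharCovector_secHat {σ : ∀ c, Cot E (f c)} (hσ : ∀ c, σ c ∈ charConormal F sharp f c)
    {u : F} (hu : u ∈ A.d.target) :
    IsCharCovector (sharpHat A.e sharp) A.ι A.ρ u (A.liftHat σ (A.ι u)) := by
  have h := (A.mem_charConormal_iff sharp (A.d.map_target hu) _).1 (hσ (A.d.symm u))
  rw [A.d.right_inv hu] at h
  rw [A.liftHat_ι]
  exact h

lemma sharp_mem_range {σ : ∀ c, Cot E (f c)} (hσ : ∀ c, σ c ∈ charConormal F sharp f c)
    {u : F} (hu : u ∈ A.d.target) :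
    sharpHat A.e sharp (A.ι u) (A.liftHat σ (A.ι u)) ∈ Set.range A.ι :=
  ⟨_, (A.isCharCovector_secHat hσ hu).2.symm⟩

/-- The images of the sections under ♯ are tangent, so the extension constant along the fibres of
`ρ` may be replaced by any other. This freedom is used both for arbitrary one-forms on `P` and for
nested brackets. -/
lemma bracketHat_eq_lieForm {σ τ : ∀ c, Cot E (f c)}
    (hσ : IsSection F f (charConormal F sharp f) σ)
    (hτ : IsSection F f (charConormal F sharp f) τ) {u : F} (hu : u ∈ A.d.target)
    {a b : E → E →L[ℝ] ℝ} (ha : DifferentiableAt ℝ a (A.ι u)) (hb : DifferentiableAt ℝ b (A.ι u))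
    (ea : ∀ᶠ x in 𝓝 u, a (A.ι x) = A.secHat σ x) (eb : ∀ᶠ x in 𝓝 u, b (A.ι x) = A.secHat τ x) :
    A.bracketHat sharp σ τ u = lieForm (sharpHat A.e sharp) a b (A.ι u) := by
  refine lieForm_congr_of_tangent ((A.contDiffAt_liftHat hσ.smooth hu).differentiableAt (by simp))
    ((A.contDiffAt_liftHat hτ.smooth hu).differentiableAt (by simp)) ha hb ?_ ?_
    (A.sharp_mem_range hσ.mem hu) (A.sharp_mem_range hτ.mem hu)
  · filter_upwards [ea] with x hx
    rw [hx, A.liftHat_ι]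
  · filter_upwards [eb] with x hx
    rw [hx, A.liftHat_ι]

/-- The right side involves no chart and the left side no extension: each side thus shows that the
other is well defined. -/
lemma bracketHat_apply_eq_koszul (hP : IsPoisson sharp) {σ τ : ∀ c, Cot E (f c)}
    (hσ : IsSection F f (charConormal F sharp f) σ)
    (hτ : IsSection F f (charConormal F sharp f) τ) {c : C} (hc : c ∈ A.d.source)
    {α β : ∀ x : P, Cot E x} (hα : IsLocalExtension f σ c α) (hβ : IsLocalExtension f τ c β)
    {Z : ∀ x : P, Tan E x} {O : Set P} (hO : IsOpen O) (hcO : f c ∈ O) (hZ : SmoothFieldOn Z O) :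
    A.bracketHat sharp σ τ (A.d c) (chartD A.e (f c) (Z (f c))) = koszul sharp α β Z (f c) := by
  obtain ⟨⟨U, hU, hcU, hαU⟩, eα⟩ := hα
  obtain ⟨⟨V, hV, hcV, hβV⟩, eβ⟩ := hβ
  have hu := A.d.map_source hc
  have ho : IsOpen (O ∩ (U ∩ V)) := hO.inter (hU.inter hV)
  have hα' : SmoothFormOn α (O ∩ (U ∩ V)) := ContMDiffOn.mono hαU fun x hx => hx.2.1
  have hβ' : SmoothFormOn β (O ∩ (U ∩ V)) := ContMDiffOn.mono hβV fun x hx => hx.2.2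
  have hd : ∀ {γ : ∀ x : P, Cot E x}, SmoothFormOn γ (O ∩ (U ∩ V)) →
      DifferentiableAt ℝ (formHat A.e γ) (A.ι (A.d c)) := fun hγ =>
    ((contDiffOn_formHat A.e_mem hγ).contDiffAt ((A.e.isOpen_inter_preimage_symm ho).mem_nhds
      ⟨A.ι_mem_target hu, by
        rw [Set.mem_preimage, A.symm_ι_apply hc]; exact ⟨hcO, hcU, hcV⟩⟩)).differentiableAt (by simp)
  have hS := (A.contDiffAt_sharpHat hP hu).differentiableAt (by simp)
  rw [koszul_eq_hat A.e_mem (A.mapsTo c hc) hP.skew ho ⟨hcO, hcU, hcV⟩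
    (by rw [A.apply_eq c hc]; exact hS) hα' hβ' (ContMDiffOn.mono hZ Set.inter_subset_left)
    (SmoothAlongOn.sharp (f := fun x => x) hP.smooth hα')
    (SmoothAlongOn.sharp (f := fun x => x) hP.smooth hβ'), A.apply_eq c hc,
    A.bracketHat_eq_lieForm hσ hτ hu (hd hα') (hd hβ') (A.formHat_ι_eventually hc eα)
      (A.formHat_ι_eventually hc eβ)]

lemma contDiffOn_bracketHat (hP : IsPoisson sharp) {σ τ : ∀ c, Cot E (f c)}
    (hσ : SmoothAlongOn F f σ Set.univ) (hτ : SmoothAlongOn F f τ Set.univ) :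
    ContDiffOn ℝ ∞ (A.bracketHat sharp σ τ) A.d.target := by
  have hW : IsOpen (A.e.target ∩ A.ρ ⁻¹' A.d.target) :=
    A.e.open_target.inter (A.d.open_target.preimage A.ρ.continuous)
  refine (ContDiffOn.lieForm hW ((contDiffOn_sharpHat A.e_mem hP.smooth).mono
    Set.inter_subset_left) (A.contDiffOn_liftHat hσ) (A.contDiffOn_liftHat hτ)).comp A.ι.contDiff.contDiffOn fun u hu => ?_
  exact ⟨A.ι_mem_target hu, by rw [Set.mem_preimage, A.ρ_ι]; exact hu⟩

lemma isCharCovector_bracketHat (hP : IsPoisson sharp) {σ τ : ∀ c, Cot E (f c)}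
    (hσ : IsSection F f (charConormal F sharp f) σ)
    (hτ : IsSection F f (charConormal F sharp f) τ) {u : F} (hu : u ∈ A.d.target) :
    IsCharCovector (sharpHat A.e sharp) A.ι A.ρ u (A.bracketHat sharp σ τ u) := by
  refine IsCharCovector.lieForm ((A.contDiffAt_sharpHat hP hu).differentiableAt (by simp))
    (A.isSkew_eventually hP _) (hP.jacobiAt_sharpHat A.e_mem (A.ι_mem_target hu))
    ((A.contDiffAt_liftHat hσ.smooth hu).differentiableAt (by simp))
    ((A.contDiffAt_liftHat hτ.smooth hu).differentiableAt (by simp)) ?_ ?_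
  · filter_upwards [A.d.open_target.mem_nhds hu] with x hx using A.isCharCovector_secHat hσ.mem hx
  · filter_upwards [A.d.open_target.mem_nhds hu] with x hx using A.isCharCovector_secHat hτ.mem hx

end AdaptedChart

variable (sharp) in
/-- The bracket of two sections of `N*C ∩ ♯⁻¹TC`. -/
def charBracket (hf : IsImmersion 𝓘(ℝ, F) 𝓘(ℝ, E) ∞ f) (σ τ : ∀ c, Cot E (f c)) (c : C) :
    Cot E (f c) :=
  -- A chart is chosen separately for each point. By `covHat_charBracket` the value is the same in
  -- every adapted chart around the point, which is why the result is smooth.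
  (exists_adaptedChart hf c).choose.secOfHat
    ((exists_adaptedChart hf c).choose.bracketHat sharp σ τ) c

variable (hf : IsImmersion 𝓘(ℝ, F) 𝓘(ℝ, E) ∞ f)

lemma charBracket_apply_eq_koszul (hP : IsPoisson sharp) {σ τ : ∀ c, Cot E (f c)}
    (hσ : IsSection F f (charConormal F sharp f) σ)
    (hτ : IsSection F f (charConormal F sharp f) τ) {c : C}
    {α β : ∀ x : P, Cot E x} (hα : IsLocalExtension f σ c α) (hβ : IsLocalExtension f τ c β)
    {Z : ∀ x : P, Tan E x} {O : Set P} (hO : IsOpen O) (hcO : f c ∈ O) (hZ : SmoothFieldOn Z O) :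
    charBracket sharp hf σ τ c (Z (f c)) = koszul sharp α β Z (f c) :=
  (exists_adaptedChart hf c).choose.bracketHat_apply_eq_koszul hP hσ hτ
    (exists_adaptedChart hf c).choose_spec hα hβ hO hcO hZ

/-- Both sides compute `koszul` of one and the same pair of local extensions, tested on fields that
are constant in the chart. -/
lemma covHat_charBracket (hP : IsPoisson sharp) {σ τ : ∀ c, Cot E (f c)}
    (hσ : IsSection F f (charConormal F sharp f) σ)
    (hτ : IsSection F f (charConormal F sharp f) τ) (A : AdaptedChart (E := E) (F := F) f) {c : C}
    (hc : c ∈ A.d.source) :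
    covHat A.e (charBracket sharp hf σ τ c) = A.bracketHat sharp σ τ (A.d c) := by
  ext v
  have hZ := smoothFieldOn_of_hat A.e_mem v
  have hα := A.isLocalExtension_extend hσ.smooth hc
  have hβ := A.isLocalExtension_extend hτ.smooth hc
  have h1 := charBracket_apply_eq_koszul hf hP hσ hτ hα hβ A.e.open_source (A.mapsTo c hc) hZ
  have h2 := A.bracketHat_apply_eq_koszul hP hσ hτ hc hα hβ A.e.open_source (A.mapsTo c hc) hZ
  rw [chartD_chartDsymm A.e_mem (A.mapsTo c hc)] at h2
  exact h1.trans h2.symm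

lemma secHat_charBracket (hP : IsPoisson sharp) {σ τ : ∀ c, Cot E (f c)}
    (hσ : IsSection F f (charConormal F sharp f) σ)
    (hτ : IsSection F f (charConormal F sharp f) τ) (A : AdaptedChart (E := E) (F := F) f) {u : F}
    (hu : u ∈ A.d.target) :
    A.secHat (charBracket sharp hf σ τ) u = A.bracketHat sharp σ τ u := by
  refine (covHat_charBracket hf hP hσ hτ A (A.d.map_target hu)).trans ?_
  rw [A.d.right_inv hu]

lemma isSection_charBracket (hP : IsPoisson sharp) {σ τ : ∀ c, Cot E (f c)}
    (hσ : IsSection F f (charConormal F sharp f) σ)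
    (hτ : IsSection F f (charConormal F sharp f) τ) :
    IsSection F f (charConormal F sharp f) (charBracket sharp hf σ τ) := by
  refine ⟨fun c => ?_, fun c _ => ?_⟩
  · obtain ⟨A, hc⟩ := exists_adaptedChart hf c
    rw [A.mem_charConormal_iff sharp hc, covHat_charBracket hf hP hσ hτ A hc]
    exact A.isCharCovector_bracketHat hP hσ hτ (A.d.map_source hc)
  · obtain ⟨A, hc⟩ := exists_adaptedChart hf c
    have h1 := A.smoothAlongOn_secOfHat (A.contDiffOn_bracketHat hP hσ.smooth hτ.smooth)
    have h2 : SmoothAlongOn F f (charBracket sharp hf σ τ) (A.d.source ∩ A.d ⁻¹' A.d.target) := by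
      refine ContMDiffOn.congr h1 fun c' hc' => ?_
      congr 1
      refine eq_of_covHat_eq A.e_mem (A.mapsTo c' hc'.1) ?_
      rw [covHat_charBracket hf hP hσ hτ A hc'.1, A.covHat_secOfHat _ hc'.1]
    exact (h2.contMDiffAt ((A.d.isOpen_inter_preimage A.d.open_target).mem_nhds
      ⟨hc, A.d.map_source hc⟩)).contMDiffWithinAt

end CharAlgebroid

/-! ### The Lie algebroid axioms for N*C ∩ ♯⁻¹TC. -/

section CharAlgebroid

variable {E : Type*} [NormedAddCommGroup E] [NormedSpace ℝ E] [FiniteDimensional ℝ E]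
  {P : Type*} [TopologicalSpace P] [ChartedSpace E P] [IsManifold 𝓘(ℝ, E) ∞ P]
  {F : Type*} [NormedAddCommGroup F] [NormedSpace ℝ F] [FiniteDimensional ℝ F]
  {C : Type*} [TopologicalSpace C] [ChartedSpace F C] [IsManifold 𝓘(ℝ, F) ∞ C]
  {sharp : ∀ x : P, Cot E x →L[ℝ] Tan E x} {f : C → P}

namespace AdaptedChart

variable (A : AdaptedChart (E := E) (F := F) f)

lemma bracketHat_jacobi (hf : IsImmersion 𝓘(ℝ, F) 𝓘(ℝ, E) ∞ f) (hP : IsPoisson sharp)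
    {σ τ υ : ∀ c, Cot E (f c)}
    (hσ : IsSection F f (charConormal F sharp f) σ)
    (hτ : IsSection F f (charConormal F sharp f) τ)
    (hυ : IsSection F f (charConormal F sharp f) υ) {u : F} (hu : u ∈ A.d.target) :
    A.bracketHat sharp σ (charBracket sharp hf τ υ) u
      + A.bracketHat sharp τ (charBracket sharp hf υ σ) u
      + A.bracketHat sharp υ (charBracket sharp hf σ τ) u = 0 := by
  have hW : IsOpen (A.e.target ∩ A.ρ ⁻¹' A.d.target) :=
    A.e.open_target.inter (A.d.open_target.preimage A.ρ.continuous)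
  have huW : A.ι u ∈ A.e.target ∩ A.ρ ⁻¹' A.d.target :=
    ⟨A.ι_mem_target hu, by rw [Set.mem_preimage, A.ρ_ι]; exact hu⟩
  have hS := A.contDiffAt_sharpHat hP hu
  have hd : ∀ {σ τ : ∀ c, Cot E (f c)}, SmoothAlongOn F f σ Set.univ →
      SmoothAlongOn F f τ Set.univ → DifferentiableAt ℝ
        (lieForm (sharpHat A.e sharp) (A.liftHat σ) (A.liftHat τ)) (A.ι u) := fun h h' =>
    ((ContDiffOn.lieForm hW ((contDiffOn_sharpHat A.e_mem hP.smooth).mono Set.inter_subset_left)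
      (A.contDiffOn_liftHat h) (A.contDiffOn_liftHat h')).contDiffAt
        (hW.mem_nhds huW)).differentiableAt (by simp)
  -- The ambient form `lieForm` of the two lifts extends the inner bracket. It need not be the lift
  -- of that bracket, but `bracketHat_eq_lieForm` allows any extension.
  have key : ∀ {σ τ υ : ∀ c, Cot E (f c)}, IsSection F f (charConormal F sharp f) σ →
      IsSection F f (charConormal F sharp f) τ → IsSection F f (charConormal F sharp f) υ →
      A.bracketHat sharp σ (charBracket sharp hf τ υ) u =
        lieForm (sharpHat A.e sharp) (A.liftHat σ)
          (lieForm (sharpHat A.e sharp) (A.liftHat τ) (A.liftHat υ)) (A.ι u) := by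
    intro σ τ υ hσ hτ hυ
    refine A.bracketHat_eq_lieForm hσ (isSection_charBracket hf hP hτ hυ) hu
      ((A.contDiffAt_liftHat hσ.smooth hu).differentiableAt (by simp)) (hd hτ.smooth hυ.smooth)
      (Filter.Eventually.of_forall fun x => A.liftHat_ι σ x) ?_
    filter_upwards [A.d.open_target.mem_nhds hu] with x hx
    exact (secHat_charBracket hf hP hτ hυ A hx).symm
  have h2 : (2 : WithTop ℕ∞) ≤ ∞ := WithTop.coe_le_coe.2 le_top
  rw [key hσ hτ hυ, key hτ hυ hσ, key hυ hσ hτ]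
  refine lieForm_jacobi (hS.of_le h2) (A.isSkew_eventually hP _) ?_
    ((A.contDiffAt_liftHat hσ.smooth hu).of_le h2) ((A.contDiffAt_liftHat hτ.smooth hu).of_le h2)
    ((A.contDiffAt_liftHat hυ.smooth hu).of_le h2)
  filter_upwards [A.e.open_target.mem_nhds (A.ι_mem_target hu)] with y hy
    using hP.jacobiAt_sharpHat A.e_mem hy

end AdaptedChart

lemma mfderiv_injective_of_isImmersion (hf : IsImmersion 𝓘(ℝ, F) 𝓘(ℝ, E) ∞ f) (c : C) :
    Function.Injective (mfderiv 𝓘(ℝ, F) 𝓘(ℝ, E) f c).toLinearMap := by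
  obtain ⟨A, hc⟩ := exists_adaptedChart hf c
  exact A.mfderiv_injective hc

variable (sharp) in
/-- The restriction of `♯` to `N*C ∩ ♯⁻¹TC`, with values in `TC`. -/
def charAnchor (hf : IsImmersion 𝓘(ℝ, F) 𝓘(ℝ, E) ∞ f) (c : C) :
    charConormal F sharp f c →ₗ[ℝ] Tan F c :=
  (LinearEquiv.ofInjective _ (mfderiv_injective_of_isImmersion hf c)).symm.toLinearMap ∘ₗ
    ((sharp (f c)).toLinearMap ∘ₗ (charConormal F sharp f c).subtype).codRestrict
      (tangentAlong F f c) fun ξ => ξ.2.2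

lemma mfderiv_charAnchor (hf : IsImmersion 𝓘(ℝ, F) 𝓘(ℝ, E) ∞ f) (c : C)
    (ξ : charConormal F sharp f c) :
    mfderiv 𝓘(ℝ, F) 𝓘(ℝ, E) f c (charAnchor sharp hf c ξ) = sharp (f c) (ξ : Cot E (f c)) := by
  have h := (LinearEquiv.ofInjective _ (mfderiv_injective_of_isImmersion hf c)).apply_symm_apply
    (((sharp (f c)).toLinearMap ∘ₗ (charConormal F sharp f c).subtype).codRestrict
      (tangentAlong F f c) (fun ξ => ξ.2.2) ξ)
  exact congrArg Subtype.val h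

lemma smoothFieldOn_charAnchor (hf : IsImmersion 𝓘(ℝ, F) 𝓘(ℝ, E) ∞ f) (hP : IsPoisson sharp)
    {σ : ∀ c, Cot E (f c)} (hσ : IsSection F f (charConormal F sharp f) σ) :
    SmoothFieldOn (fun c => charAnchor sharp hf c ⟨σ c, hσ.mem c⟩) Set.univ := by
  intro c _
  obtain ⟨A, hc⟩ := exists_adaptedChart hf c
  have h1 : SmoothFieldAlongOn F f (fun c => mfderiv 𝓘(ℝ, F) 𝓘(ℝ, E) f c
      (charAnchor sharp hf c ⟨σ c, hσ.mem c⟩)) A.d.source := by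
    refine ContMDiffOn.congr ((hσ.smooth.sharp hP.smooth).mono (Set.subset_univ A.d.source))
      fun c hc => ?_
    congr 1
    exact mfderiv_charAnchor hf c _
  exact ((A.smoothFieldOn_of_comp subset_rfl h1).contMDiffAt
    (A.d.open_source.mem_nhds hc)).contMDiffWithinAt

lemma charBracket_leibniz (hf : IsImmersion 𝓘(ℝ, F) 𝓘(ℝ, E) ∞ f) (hP : IsPoisson sharp)
    {σ τ : ∀ c, Cot E (f c)} (hσ : IsSection F f (charConormal F sharp f) σ)
    (hτ : IsSection F f (charConormal F sharp f) τ) {h : C → ℝ} (hh : SmoothFunOn F h Set.univ)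
    (c : C) : charBracket sharp hf σ (fun c => h c • τ c) c = h c • charBracket sharp hf σ τ c +
      (dfun (E := F) h c (charAnchor sharp hf c ⟨σ c, hσ.mem c⟩) : ℝ) • τ c := by
  obtain ⟨A, hc⟩ := exists_adaptedChart hf c
  have hu := A.d.map_source hc
  have hW : IsOpen (A.d.target ∩ A.d.symm ⁻¹' Set.univ) := A.d.open_target.inter (by simp)
  have hh1 : ContDiffAt ℝ ∞ (fun u => h (A.d.symm u)) (A.ρ (A.ι (A.d c))) := by
    rw [A.ρ_ι]
    exact (ContMDiffOn.contDiffOn_comp_symm A.d_mem hh).contDiffAt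
      (hW.mem_nhds ⟨hu, Set.mem_univ _⟩)
  have hh2 : ContDiffAt ℝ ∞ (fun y => h (A.d.symm (A.ρ y))) (A.ι (A.d c)) :=
    hh1.comp (A.ι (A.d c)) A.ρ.contDiff.contDiffAt
  have hh3 := hh2.differentiableAt (by simp)
  have hS : sharpHat A.e sharp (A.ι (A.d c)) (A.liftHat σ (A.ι (A.d c))) =
      A.ι (chartD A.d c (charAnchor sharp hf c ⟨σ c, hσ.mem c⟩)) := by
    rw [A.liftHat_ι, A.secHat_apply_chart _ hc, ← A.apply_eq c hc,
      sharpHat_covHat A.e_mem (A.mapsTo c hc), ← A.chartD_mfderiv hc]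
    exact congrArg (chartD A.e (f c)) (mfderiv_charAnchor hf c ⟨σ c, hσ.mem c⟩).symm
  have hfd : fderiv ℝ (fun y => h (A.d.symm (A.ρ y))) (A.ι (A.d c))
      (A.ι (chartD A.d c (charAnchor sharp hf c ⟨σ c, hσ.mem c⟩))) =
      dfun (E := F) h c (charAnchor sharp hf c ⟨σ c, hσ.mem c⟩) := by
    rw [fderiv_apply_inclusion hh3, dfun_eq_fderiv A.d_mem hc
      ((hh.contMDiffAt Filter.univ_mem).mdifferentiableAt (by simp))]
    simp only [A.ρ_ι]
  have h1 := lieForm_smul (S := sharpHat A.e sharp) (α := A.liftHat σ) hh3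
    ((A.contDiffAt_liftHat hτ.smooth hu).differentiableAt (by simp))
  refine eq_of_covHat_eq A.e_mem (A.mapsTo c hc) ?_
  rw [covHat_charBracket hf hP hσ (hτ.smul_fun hh) A hc]
  -- The lift of the product section is by definition the product of the lifts, so the Leibniz rule
  -- of `lieForm` applies; `hS` and `hfd` identify its derivative term with the anchor acting on
  -- `h`.
  refine (h1.trans ?_)
  rw [hS, hfd, A.liftHat_ι, A.secHat_apply_chart _ hc, A.ρ_ι, A.d.left_inv hc]
  have h2 := covHat_charBracket hf hP hσ hτ A hc
  unfold AdaptedChart.bracketHat at h2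
  rw [← h2]
  rfl

/-- The Lie algebroid structure of `N*C ∩ ♯⁻¹TC`. -/
def charAlgebroid (hf : IsImmersion 𝓘(ℝ, F) 𝓘(ℝ, E) ∞ f) (hP : IsPoisson sharp) :
    LieAlgebroid F f (charConormal F sharp f) where
  anchor := charAnchor sharp hf
  bracket := charBracket sharp hf
  anchor_smooth _ hσ := smoothFieldOn_charAnchor hf hP hσ
  bracket_isSection _ _ hσ hτ := isSection_charBracket hf hP hσ hτ
  add σ τ₁ τ₂ hσ hτ₁ hτ₂ := by
    funext c
    obtain ⟨A, hc⟩ := exists_adaptedChart hf c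
    have hu := A.d.map_source hc
    refine eq_of_covHat_eq A.e_mem (A.mapsTo c hc) ?_
    rw [covHat_charBracket hf hP hσ (hτ₁.add hτ₂) A hc]
    refine (lieForm_add ((A.contDiffAt_liftHat hτ₁.smooth hu).differentiableAt (by simp))
      ((A.contDiffAt_liftHat hτ₂.smooth hu).differentiableAt (by simp))).trans ?_
    exact congrArg₂ (· + ·) (covHat_charBracket hf hP hσ hτ₁ A hc).symm
      (covHat_charBracket hf hP hσ hτ₂ A hc).symm
  skew σ τ hσ hτ := by
    funext c
    obtain ⟨A, hc⟩ := exists_adaptedChart hf c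
    have hu := A.d.map_source hc
    refine eq_of_covHat_eq A.e_mem (A.mapsTo c hc) ?_
    rw [covHat_charBracket hf hP hσ hτ A hc]
    refine (lieForm_swap ((A.contDiffAt_sharpHat hP hu).differentiableAt (by simp))
      (A.isSkew_eventually hP _)).trans ?_
    exact congrArg (- ·) (covHat_charBracket hf hP hτ hσ A hc).symm
  jacobi σ τ υ hσ hτ hυ := by
    funext c
    obtain ⟨A, hc⟩ := exists_adaptedChart hf c
    refine eq_of_covHat_eq A.e_mem (A.mapsTo c hc) ?_
    have h1 := covHat_charBracket hf hP hσ (isSection_charBracket hf hP hτ hυ) A hc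
    have h2 := covHat_charBracket hf hP hτ (isSection_charBracket hf hP hυ hσ) A hc
    have h3 := covHat_charBracket hf hP hυ (isSection_charBracket hf hP hσ hτ) A hc
    refine Eq.trans (congrArg₂ (· + ·) (congrArg₂ (· + ·) h1 h2) h3) ?_
    exact A.bracketHat_jacobi hf hP hσ hτ hυ (A.d.map_source hc)
  leibniz _ _ hσ hτ _ hh c := charBracket_leibniz hf hP hσ hτ hh c

lemma isInduced_charAlgebroid (hf : IsImmersion 𝓘(ℝ, F) 𝓘(ℝ, E) ∞ f) (hP : IsPoisson sharp) :
    (charAlgebroid hf hP).IsInduced sharp where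
  anchor c ξ := mfderiv_charAnchor hf c ξ
  bracket σ τ hσ hτ U α β Z hU hα hβ hZ eα eβ c hc := by
    have hfU : f ⁻¹' U ∈ 𝓝 c := hf.contMDiff.continuous.continuousAt (hU.mem_nhds hc)
    refine charBracket_apply_eq_koszul hf hP hσ hτ ⟨⟨U, hU, hc, hα⟩, ?_⟩ ⟨⟨U, hU, hc, hβ⟩, ?_⟩
      hU hc hZ
    · filter_upwards [hfU] with c' hc' using eα c' hc'
    · filter_upwards [hfU] with c' hc' using eβ c' hc'

end CharAlgebroid

/-! ### N*C ∩ ♯⁻¹TC as an annihilator, and its rank. -/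

section Annihilator

variable {E : Type*} [NormedAddCommGroup E] [NormedSpace ℝ E] [FiniteDimensional ℝ E]
  {P : Type*} [TopologicalSpace P] [ChartedSpace E P]

instance instFiniteDimensionalTan (x : P) : FiniteDimensional ℝ (Tan E x) :=
  inferInstanceAs (FiniteDimensional ℝ E)

instance instT2SpaceTan (x : P) : T2Space (Tan E x) := inferInstanceAs (T2Space E)

lemma mem_of_forall_ann {x : P} {W : Submodule ℝ (Tan E x)} {v : Tan E x}
    (h : ∀ ξ ∈ ann W, ξ v = 0) : v ∈ W := by
  rw [← Subspace.forall_mem_dualAnnihilator_apply_eq_zero_iff W v]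
  intro φ hφ
  have h1 := h (LinearMap.toContinuousLinearMap φ : Tan E x →L[ℝ] ℝ)
    fun w hw => (Submodule.mem_dualAnnihilator φ).1 hφ w hw
  exact h1

lemma finrank_ann {x : P} (W : Submodule ℝ (Tan E x)) :
    Module.finrank ℝ W + Module.finrank ℝ (ann W) = Module.finrank ℝ E := by
  have h1 := Subspace.finrank_add_finrank_dualAnnihilator_eq W
  let φ : Module.Dual ℝ (Tan E x) ≃ₗ[ℝ] Cot E x := LinearMap.toContinuousLinearMap
  have h2 : W.dualAnnihilator.map φ.toLinearMap = ann W := by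
    ext ξ
    constructor
    · rintro ⟨ψ, hψ, rfl⟩
      exact fun w hw => (Submodule.mem_dualAnnihilator ψ).1 hψ w hw
    · intro hξ
      exact ⟨φ.symm ξ, (Submodule.mem_dualAnnihilator _).2 fun w hw => hξ w hw,
        φ.apply_symm_apply ξ⟩
  rw [← h2, LinearEquiv.finrank_map_eq]
  exact h1

variable {F : Type*} [NormedAddCommGroup F] [NormedSpace ℝ F]
  {C : Type*} [TopologicalSpace C] [ChartedSpace F C]

/-- By double annihilation ♯ξ is tangent to C exactly when η(♯ξ) = 0 for all conormal η, and
skewness turns this into the vanishing of ξ on ♯N*C. -/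
lemma charConormal_eq_ann {sharp : ∀ x : P, Cot E x →L[ℝ] Tan E x}
    (hskew : ∀ (x : P) (α β : Cot E x), β (sharp x α) = -α (sharp x β)) (f : C → P) (c : C) :
    charConormal F sharp f c = ann (tangentAlong F f c ⊔ sharpConormal F sharp f c) := by
  ext ξ
  constructor
  · rintro ⟨h1, h2⟩ v hv
    obtain ⟨w, hw, _, ⟨η, hη, rfl⟩, rfl⟩ := Submodule.mem_sup.1 hv
    have h3 : ξ (sharp (f c) η) = 0 := by
      have h4 : η (sharp (f c) ξ) = 0 := hη _ h2
      rw [hskew, h4, neg_zero]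
    exact (map_add ξ _ _).trans (by rw [h1 w hw]; exact (zero_add _).trans h3)
  · intro h
    refine ⟨fun v hv => h v (Submodule.mem_sup_left hv), ?_⟩
    change sharp (f c) ξ ∈ tangentAlong F f c
    refine mem_of_forall_ann fun η hη => ?_
    have h3 : ξ (sharp (f c) η) = 0 := h _ (Submodule.mem_sup_right ⟨η, hη, rfl⟩)
    exact (hskew (f c) ξ η).trans (by rw [h3, neg_zero])

lemma finrank_charConormal {sharp : ∀ x : P, Cot E x →L[ℝ] Tan E x}
    (hskew : ∀ (x : P) (α β : Cot E x), β (sharp x α) = -α (sharp x β)) (f : C → P) (c : C) :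
    Module.finrank ℝ ↥(tangentAlong F f c ⊔ sharpConormal F sharp f c)
      + Module.finrank ℝ (charConormal F sharp f c) = Module.finrank ℝ E := by
  rw [charConormal_eq_ann hskew, finrank_ann]

end Annihilator

/-! ### Smooth frames, and the equivalence with the pre-Poisson condition. -/

section Frame

variable {E : Type*} [NormedAddCommGroup E] [NormedSpace ℝ E] [FiniteDimensional ℝ E]
  {P : Type*} [TopologicalSpace P] [ChartedSpace E P] [IsManifold 𝓘(ℝ, E) ∞ P]
  {F : Type*} [NormedAddCommGroup F] [NormedSpace ℝ F] [FiniteDimensional ℝ F]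
  {C : Type*} [TopologicalSpace C] [ChartedSpace F C] [IsManifold 𝓘(ℝ, F) ∞ C]
  {sharp : ∀ x : P, Cot E x →L[ℝ] Tan E x} {f : C → P}

/-- The linear equivalence of the cotangent space with the dual of the model space, in a chart. -/
def covHatEquiv {e : OpenPartialHomeomorph P E} (he : e ∈ IsManifold.maximalAtlas 𝓘(ℝ, E) ∞ P)
    {x : P} (hx : x ∈ e.source) : Cot E x ≃ₗ[ℝ] (E →L[ℝ] ℝ) where
  toFun ξ := covHat e ξ
  map_add' _ _ := rfl
  map_smul' _ _ := rfl
  invFun a := covOfModel x (a.comp (chartD e x))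
  left_inv ξ := by
    ext v
    exact covHat_chartD he hx ξ v
  right_inv a := by
    ext v
    exact congrArg a (chartD_chartDsymm he hx v)

lemma finrank_charConormal_of_isSmoothSubbundle
    (h : IsSmoothSubbundle F f (charConormal F sharp f)) :
    ∃ k, ∀ c, Module.finrank ℝ (charConormal F sharp f c) = k := by
  obtain ⟨k, hk⟩ := h
  refine ⟨k, fun c => ?_⟩
  obtain ⟨U, -, hcU, s, -, hs⟩ := hk c
  rw [← (hs c hcU).2, finrank_span_eq_card (hs c hcU).1, Fintype.card_fin]

/-- A linear map whose kernel consists of the characteristic conormal covectors. -/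
def charMap (S : E → (E →L[ℝ] ℝ) →L[ℝ] E) (ι : F →L[ℝ] E) (ρ : E →L[ℝ] F) (u : F) :
    (E →L[ℝ] ℝ) →L[ℝ] (F →L[ℝ] ℝ) × E :=
  (ContinuousLinearMap.precomp ℝ ι).prod
    ((ContinuousLinearMap.id ℝ E - ι.comp ρ).comp (S (ι u)))

lemma mem_ker_charMap {S : E → (E →L[ℝ] ℝ) →L[ℝ] E} {ι : F →L[ℝ] E} {ρ : E →L[ℝ] F} {u : F}
    {a : E →L[ℝ] ℝ} : a ∈ (charMap S ι ρ u).ker ↔ IsCharCovector S ι ρ u a := by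
  have h : charMap S ι ρ u a = (a.comp ι, S (ι u) a - ι (ρ (S (ι u) a))) := rfl
  rw [LinearMap.mem_ker, ContinuousLinearMap.coe_coe, h, Prod.mk_eq_zero, sub_eq_zero, ContinuousLinearMap.ext_iff]
  rfl

/-- In an adapted chart the fibres are the kernels of the smooth family `charMap`, so constant rank
yields a smooth local frame, which is carried back by the chart. -/
lemma isSmoothSubbundle_charConormal (hf : IsImmersion 𝓘(ℝ, F) 𝓘(ℝ, E) ∞ f)
    (hP : IsPoisson sharp) {k : ℕ} (hk : ∀ c, Module.finrank ℝ (charConormal F sharp f c) = k) :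
    IsSmoothSubbundle F f (charConormal F sharp f) := by
  refine ⟨k, fun c₀ => ?_⟩
  obtain ⟨A, hc₀⟩ := exists_adaptedChart hf c₀
  have hmap : ∀ c (hc : c ∈ A.d.source),
      (charMap (sharpHat A.e sharp) A.ι A.ρ (A.d c)).ker.map
        (covHatEquiv A.e_mem (A.mapsTo c hc)).symm.toLinearMap = charConormal F sharp f c := by
    intro c hc
    ext ξ
    rw [A.mem_charConormal_iff sharp hc, ← mem_ker_charMap]
    exact Submodule.mem_map_equiv (e := (covHatEquiv A.e_mem (A.mapsTo c hc)).symm)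
      (p := (charMap (sharpHat A.e sharp) A.ι A.ρ (A.d c)).ker) (x := ξ)
  have hB : ContDiffOn ℝ ∞ (charMap (sharpHat A.e sharp) A.ι A.ρ) A.d.target := by
    have h1 : ContDiffOn ℝ ∞ (fun u => sharpHat A.e sharp (A.ι u)) A.d.target :=
      (contDiffOn_sharpHat A.e_mem hP.smooth).comp A.ι.contDiff.contDiffOn
        fun u hu => A.ι_mem_target hu
    refine contDiffOn_clm_apply.2 fun a => ?_
    exact contDiffOn_const.prodMk ((ContinuousLinearMap.id ℝ E - A.ι.comp A.ρ).contDiff.comp_contDiffOn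
      (h1.clm_apply contDiffOn_const))
  have hker : ∀ u ∈ A.d.target,
      Module.finrank ℝ (charMap (sharpHat A.e sharp) A.ι A.ρ u).ker = k := by
    intro u hu
    have h1 := hmap _ (A.d.map_target hu)
    rw [A.d.right_inv hu] at h1
    rw [← hk (A.d.symm u), ← h1, LinearEquiv.finrank_map_eq]
  obtain ⟨W, hWt, hW, hcW, s, hs, hs'⟩ :=
    exists_smooth_frame_ker A.d.open_target hB hker (A.d.map_source hc₀)
  refine ⟨A.d.source ∩ A.d ⁻¹' W, A.d.isOpen_inter_preimage hW, ⟨hc₀, hcW⟩,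
    fun i => A.secOfHat (s i), fun i => A.smoothAlongOn_secOfHat (hs i), fun c hc => ?_⟩
  obtain ⟨h1, h2⟩ := hs' (A.d c) hc.2
  refine ⟨h1.map' (covHatEquiv A.e_mem (A.mapsTo c hc.1)).symm.toLinearMap
    (LinearEquiv.ker _), ?_⟩
  rw [← hmap c hc.1, ← h2, Submodule.map_span, ← Set.range_comp]
  rfl

lemma isLieSubalgebroid_charConormal_iff (hf : IsImmersion 𝓘(ℝ, F) 𝓘(ℝ, E) ∞ f)
    (hP : IsPoisson sharp) :
    IsLieSubalgebroid F sharp f (charConormal F sharp f) ↔ IsPrePoisson F sharp f := by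
  have hn := finrank_charConormal (F := F) hP.skew f
  constructor
  · rintro ⟨h, -⟩
    obtain ⟨k, hk⟩ := finrank_charConormal_of_isSmoothSubbundle h
    -- The two ranks add up to the dimension of `E` by `hn`, so the truncated subtraction is exact
    -- at every point.
    exact ⟨Module.finrank ℝ E - k, fun c => by have := hn c; have := hk c; omega⟩
  · rintro ⟨k, hk⟩
    exact ⟨isSmoothSubbundle_charConormal hf hP (k := Module.finrank ℝ E - k)
      fun c => by have := hn c; have := hk c; omega, _, isInduced_charAlgebroid hf hP⟩

end Frame

/-! ### Projection and induced contraction map of a cosymplectic submanifold. -/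

section Cosymplectic

variable {E : Type*} [NormedAddCommGroup E] [NormedSpace ℝ E] [FiniteDimensional ℝ E]
  {P : Type*} [TopologicalSpace P] [ChartedSpace E P] [IsManifold 𝓘(ℝ, E) ∞ P]
  {G : Type*} [NormedAddCommGroup G] [NormedSpace ℝ G] [FiniteDimensional ℝ G]
  {Q : Type*} [TopologicalSpace Q] [ChartedSpace G Q] [IsManifold 𝓘(ℝ, G) ∞ Q]
  {sharp : ∀ x : P, Cot E x →L[ℝ] Tan E x} {j : Q → P}

section Pointwise

variable (hj : IsImmersion 𝓘(ℝ, G) 𝓘(ℝ, E) ∞ j) (hcos : IsCosymplectic G sharp j)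
include hj hcos

lemma cosymplecticProj_mfderiv (q : Q) (w : Tan G q) :
    cosymplecticProj (F := G) sharp j q (mfderiv 𝓘(ℝ, G) 𝓘(ℝ, E) j q w) = w := by
  have h := And.intro (mfderiv_injective_of_isImmersion hj q) (hcos q)
  unfold cosymplecticProj
  rw [dif_pos h]
  have h1 : (tangentAlong G j q).projectionOnto (sharpConormal G sharp j q) h.2
      (mfderiv 𝓘(ℝ, G) 𝓘(ℝ, E) j q w) = LinearEquiv.ofInjective _ h.1 w :=
    Submodule.projectionOnto_apply_left h.2 (LinearEquiv.ofInjective _ h.1 w)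
  exact (congrArg (LinearEquiv.ofInjective _ h.1).symm h1).trans
    (LinearEquiv.symm_apply_apply _ w)

lemma cosymplecticProj_sharp (q : Q) {ξ : Cot E (j q)} (hξ : ξ ∈ conormal G j q) :
    cosymplecticProj (F := G) sharp j q (sharp (j q) ξ) = 0 := by
  have h := And.intro (mfderiv_injective_of_isImmersion hj q) (hcos q)
  unfold cosymplecticProj
  rw [dif_pos h]
  have h1 : (tangentAlong G j q).projectionOnto (sharpConormal G sharp j q) h.2
      (sharp (j q) ξ) = 0 :=
    (Submodule.projectionOnto_apply_eq_zero_iff h.2).2 ⟨ξ, hξ, rfl⟩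
  exact (congrArg (LinearEquiv.ofInjective _ h.1).symm h1).trans (map_zero _)

lemma exists_eq_mfderiv_add_sharp (q : Q) (v : Tan E (j q)) :
    ∃ ξ ∈ conormal G j q,
      v = mfderiv 𝓘(ℝ, G) 𝓘(ℝ, E) j q (cosymplecticProj (F := G) sharp j q v) + sharp (j q) ξ := by
  have hv : v ∈ tangentAlong G j q ⊔ sharpConormal G sharp j q := by
    rw [(hcos q).sup_eq_top]
    exact Submodule.mem_top
  obtain ⟨_, ⟨w, rfl⟩, _, ⟨ξ, hξ, rfl⟩, rfl⟩ := Submodule.mem_sup.1 hv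
  refine ⟨ξ, hξ, ?_⟩
  have h1 : cosymplecticProj (F := G) sharp j q (mfderiv 𝓘(ℝ, G) 𝓘(ℝ, E) j q w + sharp (j q) ξ) = w := by
    rw [map_add, cosymplecticProj_mfderiv hj hcos, cosymplecticProj_sharp hj hcos q hξ, add_zero]
  exact congrArg (fun w => mfderiv 𝓘(ℝ, G) 𝓘(ℝ, E) j q w + sharp (j q) ξ) h1.symm

/-- The extension of η annihilates ♯N*Q, so by skewness its image under ♯ is annihilated by N*Q and
hence tangent to Q. The outer projection in `inducedSharp` therefore changes nothing. -/
lemma mfderiv_inducedSharp (hskew : ∀ (x : P) (α β : Cot E x), β (sharp x α) = -α (sharp x β))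
    (q : Q) (η : Cot G q) :
    mfderiv 𝓘(ℝ, G) 𝓘(ℝ, E) j q (inducedSharp (F := G) sharp j q η) =
      sharp (j q) (η.comp (cosymplecticProj (F := G) sharp j q)) := by
  have h1 : sharp (j q) (η.comp (cosymplecticProj (F := G) sharp j q)) ∈ tangentAlong G j q := by
    refine mem_of_forall_ann fun ξ hξ => ?_
    have h2 := congrArg η (cosymplecticProj_sharp hj hcos q hξ)
    rw [map_zero] at h2
    rw [hskew]
    exact neg_eq_zero.2 h2
  obtain ⟨w, hw⟩ := h1
  have h3 : inducedSharp (F := G) sharp j q η = w := by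
    refine Eq.trans ?_ (cosymplecticProj_mfderiv hj hcos q w)
    exact congrArg (cosymplecticProj (F := G) sharp j q) hw.symm
  rw [h3]
  exact hw

end Pointwise

lemma inducedSharp_skew (hskew : ∀ (x : P) (α β : Cot E x), β (sharp x α) = -α (sharp x β))
    (q : Q) (α β : Cot G q) : β (inducedSharp (F := G) sharp j q α) =
      -α (inducedSharp (F := G) sharp j q β) :=
  hskew (j q) (α.comp (cosymplecticProj (F := G) sharp j q)) (β.comp (cosymplecticProj (F := G) sharp j q))

namespace AdaptedChart

variable (A : AdaptedChart (E := E) (F := G) j)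

variable (sharp) in
/-- The expression in an adapted chart of the projection onto a cosymplectic submanifold. -/
def projHat (u : G) : E →L[ℝ] G :=
  (chartD A.d (A.d.symm u)).comp
    ((show E →L[ℝ] G from cosymplecticProj (F := G) sharp j (A.d.symm u)).comp (chartDsymm A.e (A.ι u)))

lemma projHat_apply {q : Q} (hq : q ∈ A.d.source) (v : E) : A.projHat sharp (A.d q) v =
    chartD A.d q (cosymplecticProj (F := G) sharp j q (chartDsymm A.e (A.e (j q)) v)) := by
  unfold projHat
  rw [A.d.left_inv hq, ← A.apply_eq q hq]
  rfl

lemma projHat_chartD {q : Q} (hq : q ∈ A.d.source) (v : Tan E (j q)) :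
    A.projHat sharp (A.d q) (chartD A.e (j q) v) =
      chartD A.d q (cosymplecticProj (F := G) sharp j q v) := by
  rw [A.projHat_apply hq]
  exact congrArg (fun v : Tan E (j q) => chartD A.d q (cosymplecticProj (F := G) sharp j q v))
    (chartDsymm_chartD A.e_mem (A.mapsTo q hq) v)

lemma mem_conormal_covOfModel {q : Q} (hq : q ∈ A.d.source) {k : E →L[ℝ] ℝ}
    (hk : ∀ z, k (A.ι z) = 0) :
    covOfModel (j q) (k.comp (chartD A.e (j q))) ∈ conormal G j q := by
  rw [A.mem_conormal_iff hq]
  intro z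
  refine Eq.trans ?_ (hk z)
  exact congrArg k (chartD_chartDsymm A.e_mem (A.mapsTo q hq) _)

variable (hj : IsImmersion 𝓘(ℝ, G) 𝓘(ℝ, E) ∞ j) (hcos : IsCosymplectic G sharp j)
include hj hcos

lemma projHat_ι {u : G} (hu : u ∈ A.d.target) (z : G) : A.projHat sharp u (A.ι z) = z := by
  have hq := A.d.map_target hu
  have h1 := A.chartD_mfderiv hq (chartDsymm A.d (A.d (A.d.symm u)) z)
  rw [chartD_chartDsymm A.d_mem hq] at h1
  have h2 := A.projHat_chartD (sharp := sharp) hq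
    (mfderiv 𝓘(ℝ, G) 𝓘(ℝ, E) j (A.d.symm u) (chartDsymm A.d (A.d (A.d.symm u)) z))
  have h3 := congrArg (chartD A.d (A.d.symm u)) (cosymplecticProj_mfderiv hj hcos (A.d.symm u)
    (chartDsymm A.d (A.d (A.d.symm u)) z))
  have h4 := h2.trans (h3.trans (chartD_chartDsymm A.d_mem hq z))
  rw [h1, A.d.right_inv hu] at h4
  exact h4

lemma projHat_sharpHat {u : G} (hu : u ∈ A.d.target) {k : E →L[ℝ] ℝ} (hk : ∀ z, k (A.ι z) = 0) :
    A.projHat sharp u (sharpHat A.e sharp (A.ι u) k) = 0 := by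
  have hq := A.d.map_target hu
  have h1 := A.projHat_chartD (sharp := sharp) hq
    (sharp _ (covOfModel _ (k.comp (chartD A.e (j (A.d.symm u))))))
  have h2 := congrArg (chartD A.d (A.d.symm u))
    (cosymplecticProj_sharp hj hcos _ (A.mem_conormal_covOfModel hq hk))
  rw [← sharpHat_apply_chart (A.mapsTo _ hq), A.apply_eq _ hq, A.d.right_inv hu] at h1
  exact h1.trans (h2.trans (map_zero _))

/-- In an adapted chart the projections satisfy the hypotheses of `contDiffOn_proj`, the last of
which is the cosymplectic decomposition of a tangent vector. -/
lemma contDiffOn_projHat (hP : IsPoisson sharp) :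
    ContDiffOn ℝ ∞ (A.projHat sharp) A.d.target := by
  refine contDiffOn_proj (S := sharpHat A.e sharp) A.ρ_ι
    ((contDiffOn_sharpHat A.e_mem hP.smooth).comp A.ι.contDiff.contDiffOn
      fun u hu => A.ι_mem_target hu) (fun u hu => A.projHat_ι hj hcos hu)
    (fun u hu k hk => A.projHat_sharpHat hj hcos hu hk) fun u hu v => ?_
  have hq := A.d.map_target hu
  obtain ⟨ξ, hξ, h⟩ := exists_eq_mfderiv_add_sharp hj hcos (A.d.symm u)
    (chartDsymm A.e (A.e (j (A.d.symm u))) v)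
  refine ⟨chartD A.d (A.d.symm u) (cosymplecticProj (F := G) sharp j (A.d.symm u)
    (chartDsymm A.e (A.e (j (A.d.symm u))) v)), covHat A.e ξ, (A.mem_conormal_iff hq ξ).1 hξ, ?_⟩
  have h1 := congrArg (chartD A.e (j (A.d.symm u))) h
  have h2 := (chartD_chartDsymm A.e_mem (A.mapsTo _ hq) v).symm.trans
    (h1.trans (map_add (chartD A.e (j (A.d.symm u))) _ _))
  have h3 := sharpHat_covHat A.e_mem (A.mapsTo _ hq) sharp ξ
  rw [A.apply_eq _ hq, A.d.right_inv hu] at h3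
  refine h2.trans (congrArg₂ (· + ·) (A.chartD_mfderiv hq _) h3.symm)

end AdaptedChart

variable {F : Type*} [NormedAddCommGroup F] [NormedSpace ℝ F] [FiniteDimensional ℝ F]
  {C : Type*} [TopologicalSpace C] [ChartedSpace F C] [IsManifold 𝓘(ℝ, F) ∞ C] {g : C → Q}

lemma SmoothAlongOn.mono {f : C → P} {σ : ∀ c, Cot E (f c)} {U V : Set C}
    (hσ : SmoothAlongOn F f σ U) (hV : V ⊆ U) : SmoothAlongOn F f σ V :=
  ContMDiffOn.mono hσ hV

section Smooth

variable (hj : IsImmersion 𝓘(ℝ, G) 𝓘(ℝ, E) ∞ j) (hcos : IsCosymplectic G sharp j)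
include hj hcos

lemma SmoothFieldAlongOn.cosymplecticProj (hP : IsPoisson sharp) {V : Set C}
    (hg : ContMDiffOn 𝓘(ℝ, F) 𝓘(ℝ, G) ∞ g V) {X : ∀ c, Tan E (j (g c))}
    (hX : SmoothFieldAlongOn F (fun c => j (g c)) X V) :
    SmoothFieldAlongOn F g (fun c => cosymplecticProj (F := G) sharp j (g c) (X c)) V := by
  intro c hc
  obtain ⟨A, hgc⟩ := exists_adaptedChart hj (g c)
  have hV : V ∩ g ⁻¹' A.d.source ∈ 𝓝[V] c := Filter.inter_mem self_mem_nhdsWithin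
    ((hg c hc).continuousWithinAt (A.d.open_source.mem_nhds hgc))
  have hg' := hg.mono (Set.inter_subset_left (t := g ⁻¹' A.d.source))
  have h1 := (smoothFieldAlongOn_iff A.e_mem (hX.contMDiffOn_base.mono Set.inter_subset_left)
    fun c hc => A.mapsTo _ hc.2).1 (hX.mono (Set.inter_subset_left (t := g ⁻¹' A.d.source)))
  have h2 : ContMDiffOn 𝓘(ℝ, F) 𝓘(ℝ, E →L[ℝ] G) ∞ (fun c => A.projHat sharp (A.d (g c)))
      (V ∩ g ⁻¹' A.d.source) :=
    (A.contDiffOn_projHat hj hcos hP).contMDiffOn.comp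
      ((contMDiffOn_of_mem_maximalAtlas A.d_mem).comp hg' fun c hc => hc.2)
      fun c hc => A.d.map_source hc.2
  have h3 : SmoothFieldAlongOn F g (fun c => _root_.cosymplecticProj (F := G) sharp j (g c) (X c))
      (V ∩ g ⁻¹' A.d.source) := by
    refine (smoothFieldAlongOn_iff A.d_mem hg' fun c hc => hc.2).2
      ((h2.clm_apply h1).congr fun c hc => ?_)
    exact (A.projHat_chartD hc.2 (X c)).symm
  exact (h3 c ⟨hc, hgc⟩).mono_of_mem_nhdsWithin hV

lemma SmoothAlongOn.comp_cosymplecticProj (hP : IsPoisson sharp) {V : Set C}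
    {τ : ∀ c, Cot G (g c)} (hτ : SmoothAlongOn F g τ V) :
    SmoothAlongOn F (fun c => j (g c))
      (fun c => (τ c).comp (cosymplecticProj (F := G) sharp j (g c))) V := by
  refine smoothAlongOn_of_apply (hj.contMDiff.comp_contMDiffOn hτ.contMDiffOn_base)
    fun V' hV' X hX => ?_
  have h := SmoothFieldAlongOn.cosymplecticProj hj hcos hP (hτ.contMDiffOn_base.mono hV') hX
  exact (hτ.mono hV').apply h

end Smooth

lemma SmoothAlongOn.comp_mfderiv (hj : ContMDiff 𝓘(ℝ, G) 𝓘(ℝ, E) ∞ j) {V : Set C}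
    (hg : ContMDiffOn 𝓘(ℝ, F) 𝓘(ℝ, G) ∞ g V) {σ : ∀ c, Cot E (j (g c))}
    (hσ : SmoothAlongOn F (fun c => j (g c)) σ V) :
    SmoothAlongOn F g (fun c => (σ c).comp (mfderiv 𝓘(ℝ, G) 𝓘(ℝ, E) j (g c))) V :=
  smoothAlongOn_of_apply hg fun _ hV' _ hX => (hσ.mono hV').apply
    (hX.tangentMap isOpen_univ hj.contMDiffOn (Set.mapsTo_univ _ _))

end Cosymplectic

/-! ### Transport of Lie algebroid structures along bundle isomorphisms. -/

section Transport

variable {E : Type*} [NormedAddCommGroup E] [NormedSpace ℝ E] [FiniteDimensional ℝ E]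
  {P : Type*} [TopologicalSpace P] [ChartedSpace E P] [IsManifold 𝓘(ℝ, E) ∞ P]
  {G : Type*} [NormedAddCommGroup G] [NormedSpace ℝ G] [FiniteDimensional ℝ G]
  {Q : Type*} [TopologicalSpace Q] [ChartedSpace G Q] [IsManifold 𝓘(ℝ, G) ∞ Q]
  {F : Type*} [NormedAddCommGroup F] [NormedSpace ℝ F]
  {C : Type*} [TopologicalSpace C] [ChartedSpace F C] [IsManifold 𝓘(ℝ, F) ∞ C]

variable (F) in
/-- Fibrewise linear maps of `T*P|_C` and `T*Q|_C` that restrict to mutually inverse isomorphisms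
of the subbundles `B` and `B'` and preserve smoothness of sections. -/
structure SubbundleEquiv (f : C → P) (B : ∀ c, Submodule ℝ (Cot E (f c)))
    (g : C → Q) (B' : ∀ c, Submodule ℝ (Cot G (g c))) where
  res : ∀ c, Cot E (f c) →ₗ[ℝ] Cot G (g c)
  ext : ∀ c, Cot G (g c) →ₗ[ℝ] Cot E (f c)
  ext_res : ∀ c, ∀ ξ ∈ B c, ext c (res c ξ) = ξ
  res_ext : ∀ c, ∀ η ∈ B' c, res c (ext c η) = η
  res_mem : ∀ c, ∀ ξ ∈ B c, res c ξ ∈ B' c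
  ext_mem : ∀ c, ∀ η ∈ B' c, ext c η ∈ B c
  smooth_res : ∀ σ, IsSection F f B σ → SmoothAlongOn F g (fun c => res c (σ c)) Set.univ
  smooth_ext : ∀ τ, IsSection F g B' τ → SmoothAlongOn F f (fun c => ext c (τ c)) Set.univ

namespace SubbundleEquiv

variable {f : C → P} {B : ∀ c, Submodule ℝ (Cot E (f c))}
  {g : C → Q} {B' : ∀ c, Submodule ℝ (Cot G (g c))} (Φ : SubbundleEquiv F f B g B')

lemma isSection_res {σ : ∀ c, Cot E (f c)} (hσ : IsSection F f B σ) :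
    IsSection F g B' (fun c => Φ.res c (σ c)) :=
  ⟨fun c => Φ.res_mem c _ (hσ.mem c), Φ.smooth_res σ hσ⟩

lemma isSection_ext {τ : ∀ c, Cot G (g c)} (hτ : IsSection F g B' τ) :
    IsSection F f B (fun c => Φ.ext c (τ c)) :=
  ⟨fun c => Φ.ext_mem c _ (hτ.mem c), Φ.smooth_ext τ hτ⟩

/-- The fibrewise isomorphism of the subbundles. -/
def fibreEquiv (c : C) : B c ≃ₗ[ℝ] B' c where
  toFun ξ := ⟨Φ.res c ξ, Φ.res_mem c ξ ξ.2⟩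
  map_add' _ _ := Subtype.ext (map_add (Φ.res c) _ _)
  map_smul' r _ := Subtype.ext (map_smul (Φ.res c) r _)
  invFun η := ⟨Φ.ext c η, Φ.ext_mem c η η.2⟩
  left_inv ξ := Subtype.ext (Φ.ext_res c ξ ξ.2)
  right_inv η := Subtype.ext (Φ.res_ext c η η.2)

variable (L : LieAlgebroid F f B)

lemma ext_res_section {σ : ∀ c, Cot E (f c)} (hσ : IsSection F f B σ) :
    (fun c => Φ.ext c (Φ.res c (σ c))) = σ := funext fun c => Φ.ext_res c _ (hσ.mem c)

/-- The Lie algebroid structure transported along an isomorphism of subbundles. -/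
def transport : LieAlgebroid F g B' where
  anchor c := L.anchor c ∘ₗ (Φ.fibreEquiv c).symm.toLinearMap
  bracket σ τ c := Φ.res c (L.bracket (fun c => Φ.ext c (σ c)) (fun c => Φ.ext c (τ c)) c)
  anchor_smooth σ hσ := L.anchor_smooth _ (Φ.isSection_ext hσ)
  bracket_isSection σ τ hσ hτ :=
    Φ.isSection_res (L.bracket_isSection _ _ (Φ.isSection_ext hσ) (Φ.isSection_ext hτ))
  add σ τ₁ τ₂ hσ hτ₁ hτ₂ := by
    have h : (fun c => Φ.ext c ((τ₁ + τ₂) c)) =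
        (fun c => Φ.ext c (τ₁ c)) + fun c => Φ.ext c (τ₂ c) :=
      funext fun c => map_add (Φ.ext c) _ _
    funext c
    rw [h, L.add _ _ _ (Φ.isSection_ext hσ) (Φ.isSection_ext hτ₁) (Φ.isSection_ext hτ₂)]
    exact map_add (Φ.res c) _ _
  skew σ τ hσ hτ := by
    funext c
    rw [L.skew _ _ (Φ.isSection_ext hσ) (Φ.isSection_ext hτ)]
    exact map_neg (Φ.res c) _
  jacobi σ τ υ hσ hτ hυ := by
    have h1 := Φ.isSection_ext hσ
    have h2 := Φ.isSection_ext hτ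
    have h3 := Φ.isSection_ext hυ
    funext c
    -- In a nested bracket the inner one is restricted and then extended again. This is the identity
    -- on sections of `B`, so the Jacobi identity of `L` applies directly.
    rw [Φ.ext_res_section (L.bracket_isSection _ _ h2 h3),
      Φ.ext_res_section (L.bracket_isSection _ _ h3 h1),
      Φ.ext_res_section (L.bracket_isSection _ _ h1 h2)]
    have h := congrArg (Φ.res c) (congrFun (L.jacobi _ _ _ h1 h2 h3) c)
    rw [Pi.zero_apply, map_zero, Pi.add_apply, Pi.add_apply, map_add, map_add] at h
    exact h
  leibniz σ τ hσ hτ h hh c := by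
    have e : (fun c => Φ.ext c (h c • τ c)) = fun c => h c • Φ.ext c (τ c) :=
      funext fun c => map_smul (Φ.ext c) _ _
    rw [e, L.leibniz _ _ (Φ.isSection_ext hσ) (Φ.isSection_ext hτ) h hh c, map_add, map_smul,
      map_smul, Φ.res_ext c _ (hτ.mem c)]
    rfl

/-- The isomorphism of a Lie algebroid with the transported one. -/
def transportIso : LieAlgebroid.Iso L (Φ.transport L) where
  toFun := Φ.fibreEquiv
  smooth _ hσ := Φ.isSection_res hσ
  symm_smooth _ hτ := Φ.isSection_ext hτ
  anchor c ξ := congrArg (L.anchor c) ((Φ.fibreEquiv c).symm_apply_apply ξ)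
  bracket σ τ hσ hτ c := by
    have h1 := Φ.ext_res_section hσ
    have h2 := Φ.ext_res_section hτ
    change Φ.res c (L.bracket σ τ c) = Φ.res c (L.bracket (fun c => Φ.ext c (Φ.res c (σ c)))
      (fun c => Φ.ext c (Φ.res c (τ c))) c)
    rw [h1, h2]

end SubbundleEquiv

end Transport

/-! ### Coisotropic submanifolds of a cosymplectic submanifold. -/

section Cosymplectic

variable {E : Type*} [NormedAddCommGroup E] [NormedSpace ℝ E] [FiniteDimensional ℝ E]
  {P : Type*} [TopologicalSpace P] [ChartedSpace E P] [IsManifold 𝓘(ℝ, E) ∞ P]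
  {G : Type*} [NormedAddCommGroup G] [NormedSpace ℝ G] [FiniteDimensional ℝ G]
  {Q : Type*} [TopologicalSpace Q] [ChartedSpace G Q] [IsManifold 𝓘(ℝ, G) ∞ Q]
  {F : Type*} [NormedAddCommGroup F] [NormedSpace ℝ F] [FiniteDimensional ℝ F]
  {C : Type*} [TopologicalSpace C] [ChartedSpace F C] [IsManifold 𝓘(ℝ, F) ∞ C]
  {sharp : ∀ x : P, Cot E x →L[ℝ] Tan E x} {j : Q → P} {g : C → Q}

lemma mfderiv_comp_immersion_apply (hj : IsImmersion 𝓘(ℝ, G) 𝓘(ℝ, E) ∞ j)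
    (hg : ContMDiff 𝓘(ℝ, F) 𝓘(ℝ, G) ∞ g) (c : C) (w : Tan F c) :
    mfderiv 𝓘(ℝ, F) 𝓘(ℝ, E) (fun c => j (g c)) c w =
      mfderiv 𝓘(ℝ, G) 𝓘(ℝ, E) j (g c) (mfderiv 𝓘(ℝ, F) 𝓘(ℝ, G) g c w) :=
  congrArg (fun T : F →L[ℝ] E => T w) (mfderiv_comp c
    ((hj.contMDiff (g c)).mdifferentiableAt (by simp)) ((hg c).mdifferentiableAt (by simp)))

/-- For `C` coisotropic in a cosymplectic submanifold `Q` of `P`, restriction of covectors to `TQ`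
maps `N*C ∩ ♯⁻¹TC` isomorphically onto the conormal bundle of `C` in `Q`. -/
def restrictConormal (hP : IsPoisson sharp) (hj : IsImmersion 𝓘(ℝ, G) 𝓘(ℝ, E) ∞ j)
    (hcos : IsCosymplectic G sharp j) (hg : ContMDiff 𝓘(ℝ, F) 𝓘(ℝ, G) ∞ g)
    (hcoi : IsCoisotropic F (inducedSharp (F := G) sharp j) g) :
    SubbundleEquiv F (fun c => j (g c)) (charConormal F sharp fun c => j (g c))
      g (conormal (E := G) F g) where
  res c := (ContinuousLinearMap.precomp ℝ (mfderiv 𝓘(ℝ, G) 𝓘(ℝ, E) j (g c))).toLinearMap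
  ext c := (ContinuousLinearMap.precomp ℝ (cosymplecticProj (F := G) sharp j (g c))).toLinearMap
  -- A vector splits into a part tangent to Q, where the two covectors agree, and a part ♯η with η
  -- in N*Q. On the latter ξ vanishes because ♯ξ is tangent to C, hence to Q.
  ext_res c ξ hξ := by
    ext v
    obtain ⟨η, hη, hv⟩ := exists_eq_mfderiv_add_sharp hj hcos (g c) v
    have h1 : ξ (sharp _ η) = 0 := by
      obtain ⟨w, hw⟩ := hξ.2
      have h2 : η (sharp _ ξ) = 0 := by
        refine Eq.trans (congrArg η hw).symm ?_
        refine Eq.trans (congrArg η (mfderiv_comp_immersion_apply hj hg c w)) ?_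
        exact hη _ ⟨_, rfl⟩
      rw [hP.skew, h2, neg_zero]
    refine Eq.trans ?_ (congrArg ξ hv).symm
    rw [map_add, h1]
    exact (add_zero _).symm
  res_ext c η _ := by
    ext w
    exact congrArg η (cosymplecticProj_mfderiv hj hcos (g c) w)
  res_mem c ξ hξ := by
    rintro _ ⟨w, rfl⟩
    refine Eq.trans (congrArg ξ (mfderiv_comp_immersion_apply hj hg c w)).symm ?_
    exact hξ.1 _ ⟨w, rfl⟩
  ext_mem c η hη := by
    refine ⟨?_, ?_⟩
    · rintro _ ⟨w, rfl⟩
      refine Eq.trans (congrArg (fun v => η (cosymplecticProj (F := G) sharp j (g c) v))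
        (mfderiv_comp_immersion_apply hj hg c w)) ?_
      refine Eq.trans (congrArg η (cosymplecticProj_mfderiv hj hcos (g c) _)) ?_
      exact hη _ ⟨w, rfl⟩
    -- Coisotropy supplies the tangent vector of C that is the induced ♯ of η, and
    -- `mfderiv_inducedSharp` identifies it in P with ♯ of the extension of η.
    · obtain ⟨w, hw⟩ := hcoi c ⟨η, hη, rfl⟩
      refine ⟨w, ?_⟩
      refine (mfderiv_comp_immersion_apply hj hg c w).trans ?_
      refine (congrArg (mfderiv 𝓘(ℝ, G) 𝓘(ℝ, E) j (g c)) hw).trans ?_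
      exact mfderiv_inducedSharp hj hcos hP.skew (g c) η
  smooth_res _ hσ := SmoothAlongOn.comp_mfderiv hj.contMDiff hg.contMDiffOn hσ.smooth
  smooth_ext _ hτ := SmoothAlongOn.comp_cosymplecticProj hj hcos hP hτ.smooth

namespace AdaptedChart

variable (A : AdaptedChart (E := E) (F := G) j)

lemma sharpHat_inducedSharp {u : G} (hu : u ∈ A.d.target) :
    sharpHat A.d (inducedSharp (F := G) sharp j) u =
      inducedContraction (sharpHat A.e sharp) A.ι (A.projHat sharp) u := by
  have hq := A.d.map_target hu
  ext a
  have h1 := sharpHat_apply_chart hq (inducedSharp (F := G) sharp j) a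
  rw [A.d.right_inv hu] at h1
  refine h1.trans ?_
  have h2 := A.projHat_chartD (sharp := sharp) hq (sharp _ ((covOfModel (A.d.symm u)
    (a.comp (chartD A.d (A.d.symm u)))).comp (cosymplecticProj (F := G) sharp j (A.d.symm u))))
  refine h2.symm.trans ?_
  have h3 := sharpHat_apply_chart (A.mapsTo _ hq) sharp (a.comp (A.projHat sharp u))
  have h4 : covOfModel (j (A.d.symm u)) ((a.comp (A.projHat sharp u)).comp
      (chartD A.e (j (A.d.symm u)))) = (covOfModel (A.d.symm u)
    (a.comp (chartD A.d (A.d.symm u)))).comp (cosymplecticProj (F := G) sharp j (A.d.symm u)) := by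
    ext v
    have h5 := congrArg a (A.projHat_chartD (sharp := sharp) hq v)
    rw [A.d.right_inv hu] at h5
    exact h5
  rw [h4, A.apply_eq _ hq, A.d.right_inv hu] at h3
  rw [A.d.right_inv hu, ← h3]
  rfl

end AdaptedChart

lemma smoothFieldOn_inducedSharp (hP : IsPoisson sharp) (hj : IsImmersion 𝓘(ℝ, G) 𝓘(ℝ, E) ∞ j)
    (hcos : IsCosymplectic G sharp j) {α : ∀ q : Q, Cot G q} {U : Set Q} (hα : SmoothFormOn α U) :
    SmoothFieldOn (fun q => inducedSharp (F := G) sharp j q (α q)) U := by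
  have h1 : SmoothAlongOn G (fun q => q) α U := hα
  have h2 := (SmoothAlongOn.comp_cosymplecticProj hj hcos hP h1).sharp hP.smooth
  exact SmoothFieldAlongOn.cosymplecticProj hj hcos hP contMDiffOn_id h2

/-- The induced bracket on a cosymplectic submanifold: the bracket of the extensions of one-forms
that annihilate `♯N*Q` restricts to the bracket of the one-forms. -/
lemma koszul_inducedSharp (hP : IsPoisson sharp) (hj : IsImmersion 𝓘(ℝ, G) 𝓘(ℝ, E) ∞ j)
    (hcos : IsCosymplectic G sharp j) {U : Set Q} (hU : IsOpen U) {α β : ∀ q : Q, Cot G q}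
    {Z : ∀ q : Q, Tan G q} (hα : SmoothFormOn α U) (hβ : SmoothFormOn β U)
    (hZ : SmoothFieldOn Z U) {q : Q} (hq : q ∈ U) :
    ∃ α' β' : ∀ x : P, Cot E x, ∃ Z' : ∀ x : P, Tan E x, ∃ O : Set P, IsOpen O ∧ j q ∈ O ∧
      SmoothFormOn α' O ∧ SmoothFormOn β' O ∧ SmoothFieldOn Z' O ∧
      (∀ᶠ q' in 𝓝 q, α' (j q') = (α q').comp (cosymplecticProj (F := G) sharp j q')) ∧
      (∀ᶠ q' in 𝓝 q, β' (j q') = (β q').comp (cosymplecticProj (F := G) sharp j q')) ∧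
      Z' (j q) = mfderiv 𝓘(ℝ, G) 𝓘(ℝ, E) j q (Z q) ∧
      koszul sharp α' β' Z' (j q) = koszul (inducedSharp (F := G) sharp j) α β Z q := by
  obtain ⟨A, hA⟩ := exists_adaptedChart hj q
  have hu := A.d.map_source hA
  have hW : IsOpen (A.d.target ∩ A.d.symm ⁻¹' U) := A.d.isOpen_inter_preimage_symm hU
  have huW : A.d q ∈ A.d.target ∩ A.d.symm ⁻¹' U :=
    ⟨hu, by rw [Set.mem_preimage, A.d.left_inv hA]; exact hq⟩
  have hS := (A.contDiffAt_sharpHat hP hu).differentiableAt (by simp)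
  have hp := A.contDiffOn_projHat hj hcos hP
  -- The chart expression of γ composed with the projection onto TQ is the extension annihilating
  -- ♯N*Q. Off Q it is continued as a constant in the normal directions of the adapted chart, and
  -- the field `Z` is replaced by the chart-constant field with the same value at `q`.
  let ext : (∀ q : Q, Cot G q) → G → E →L[ℝ] ℝ := fun γ u =>
    (formHat A.d γ u).comp (A.projHat sharp u)
  have hext : ∀ {γ : ∀ q : Q, Cot G q}, SmoothFormOn γ U →
      ContDiffOn ℝ ∞ (ext γ) (A.d.target ∩ A.d.symm ⁻¹' U) := fun hγ =>
    (contDiffOn_formHat A.d_mem hγ).clm_comp (hp.mono Set.inter_subset_left)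
  let O := A.e.source ∩ A.e ⁻¹' (A.ρ ⁻¹' (A.d.target ∩ A.d.symm ⁻¹' U))
  have hO : IsOpen O := A.e.isOpen_inter_preimage (hW.preimage A.ρ.continuous)
  have hqO : j q ∈ O := by
    refine ⟨A.mapsTo q hA, ?_⟩
    rw [Set.mem_preimage, Set.mem_preimage, A.apply_eq q hA, A.ρ_ι]
    exact huW
  have hZ' : SmoothFieldOn _ O :=
    ContMDiffOn.mono (smoothFieldOn_of_hat A.e_mem (A.ι (chartD A.d q (Z q))))
      Set.inter_subset_left
  have hres : ∀ γ : ∀ q : Q, Cot G q, ∀ᶠ q' in 𝓝 q,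
      A.extend (ext γ) (j q') = (γ q').comp (cosymplecticProj (F := G) sharp j q') := by
    intro γ
    filter_upwards [A.d.open_source.mem_nhds hA] with q' hq'
    rw [A.extend_apply _ hq']
    ext v
    have h1 := congrArg (formHat A.d γ (A.d q')) (A.projHat_chartD (sharp := sharp) hq' v)
    rw [formHat_apply_chart hq'] at h1
    refine Eq.trans ?_ (h1.trans (covHat_chartD A.d_mem hq' (γ q') _))
    rw [← formHat_apply_chart hq']
    rfl
  have hhat : ∀ {γ : ∀ q : Q, Cot G q}, ∀ y ∈ A.e.target,
      formHat A.e (A.extend (ext γ)) y = ext γ (A.ρ y) := fun {γ} y hy =>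
    formHat_of_hat A.e_mem (fun y => ext γ (A.ρ y)) hy
  have hhatι : ∀ γ : ∀ q : Q, Cot G q, ∀ᶠ u in 𝓝 (A.d q),
      formHat A.e (A.extend (ext γ)) (A.ι u) = (formHat A.d γ u).comp (A.projHat sharp u) := by
    intro γ
    filter_upwards [A.d.open_target.mem_nhds hu] with u hu
    rw [hhat _ (A.ι_mem_target hu), A.ρ_ι]
  have hd : ∀ {γ : ∀ x : P, Cot E x}, SmoothFormOn γ O →
      DifferentiableAt ℝ (formHat A.e γ) (A.ι (A.d q)) := fun hγ =>
    ((contDiffOn_formHat A.e_mem hγ).contDiffAt ((A.e.isOpen_inter_preimage_symm hO).mem_nhds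
      ⟨A.ι_mem_target hu, by
        rw [Set.mem_preimage, A.symm_ι_apply hA]; exact hqO⟩)).differentiableAt (by simp)
  have hd' : ∀ {γ : ∀ q : Q, Cot G q}, SmoothFormOn γ U →
      DifferentiableAt ℝ (formHat A.d γ) (A.d q) := fun hγ =>
    ((contDiffOn_formHat A.d_mem hγ).contDiffAt (hW.mem_nhds huW)).differentiableAt (by simp)
  have hα' := A.smoothFormOn_extend (hext hα)
  have hβ' := A.smoothFormOn_extend (hext hβ)
  have hZq : (chartDsymm A.e (A.e (j q)) (A.ι (chartD A.d q (Z q))) : E) =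
      mfderiv 𝓘(ℝ, G) 𝓘(ℝ, E) j q (Z q) := (A.mfderiv_eq hA (Z q)).symm
  have hSi : sharpHat A.d (inducedSharp (F := G) sharp j) =ᶠ[𝓝 (A.d q)]
      inducedContraction (sharpHat A.e sharp) A.ι (A.projHat sharp) := by
    filter_upwards [A.d.open_target.mem_nhds hu] with u hu
      using A.sharpHat_inducedSharp hu
  have hpd : DifferentiableAt ℝ (A.projHat sharp) (A.d q) :=
    (hp.contDiffAt (A.d.open_target.mem_nhds hu)).differentiableAt (by simp)
  have hSd : DifferentiableAt ℝ (inducedContraction (sharpHat A.e sharp) A.ι (A.projHat sharp))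
      (A.d q) := by
    have h1 : DifferentiableAt ℝ (fun u => sharpHat A.e sharp (A.ι u)) (A.d q) :=
      hS.comp (A.d q) A.ι.differentiableAt
    have h2 : DifferentiableAt ℝ (fun u => (ContinuousLinearMap.precomp ℝ (A.projHat sharp u) :
        (G →L[ℝ] ℝ) →L[ℝ] E →L[ℝ] ℝ)) (A.d q) :=
      ((ContinuousLinearMap.compL ℝ E G ℝ).flip.differentiableAt).comp (A.d q) hpd
    exact hpd.clm_comp (h1.clm_comp h2)
  refine ⟨A.extend (ext α), A.extend (ext β), _, O, hO, hqO, hα', hβ', hZ', hres α, hres β, hZq, ?_⟩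
  rw [koszul_eq_hat A.e_mem (A.mapsTo q hA) hP.skew hO hqO (by rw [A.apply_eq q hA]; exact hS)
      hα' hβ' hZ' (SmoothAlongOn.sharp (f := fun x => x) hP.smooth hα')
      (SmoothAlongOn.sharp (f := fun x => x) hP.smooth hβ'),
    koszul_eq_hat A.d_mem hA (inducedSharp_skew hP.skew) hU hq
      (hSi.differentiableAt_iff.2 hSd) hα hβ hZ
      (smoothFieldOn_inducedSharp hP hj hcos hα) (smoothFieldOn_inducedSharp hP hj hcos hβ),
    chartD_chartDsymm A.e_mem (A.mapsTo q hA), A.apply_eq q hA,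
    lieForm_congr hSi Filter.EventuallyEq.rfl Filter.EventuallyEq.rfl]
  refine lieForm_inducedContraction hS (isSkew_sharpHat hP.skew _) hpd ?_
    (fun k hk => A.projHat_sharpHat hj hcos hu hk) (hd' hα) (hd' hβ) (hd hα') (hd hβ')
    (hhatι α) (hhatι β) _
  filter_upwards [A.d.open_target.mem_nhds hu] with u hu using A.projHat_ι hj hcos hu

/-- Given forms on Q extending the two sections, `koszul_inducedSharp` provides forms on P that
extend the corresponding sections of N*C ∩ ♯⁻¹TC and have the same bracket on vectors tangent to Q.
The bracket of `charAlgebroid` is computed from these. -/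
lemma isInduced_transport (hP : IsPoisson sharp) (hj : IsImmersion 𝓘(ℝ, G) 𝓘(ℝ, E) ∞ j)
    (hcos : IsCosymplectic G sharp j) (hg : ContMDiff 𝓘(ℝ, F) 𝓘(ℝ, G) ∞ g)
    (hcoi : IsCoisotropic F (inducedSharp (F := G) sharp j) g)
    (hf : IsImmersion 𝓘(ℝ, F) 𝓘(ℝ, E) ∞ fun c => j (g c)) :
    ((restrictConormal hP hj hcos hg hcoi).transport (charAlgebroid hf hP)).IsInduced
      (inducedSharp (F := G) sharp j) where
  anchor c η := by
    refine mfderiv_injective_of_isImmersion hj (g c) ?_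
    refine (mfderiv_comp_immersion_apply hj hg c _).symm.trans ?_
    refine (mfderiv_charAnchor hf c _).trans ?_
    exact (mfderiv_inducedSharp hj hcos hP.skew (g c) (η : Cot G (g c))).symm
  bracket σ τ hσ hτ U α β Z hU hα hβ hZ eα eβ c hc := by
    obtain ⟨α', β', Z', O, hO, hcO, hα', hβ', hZ', eα', eβ', eZ, hk⟩ :=
      koszul_inducedSharp hP hj hcos hU hα hβ hZ hc
    have hgU : g ⁻¹' U ∈ 𝓝 c := hg.continuous.continuousAt (hU.mem_nhds hc)
    have hα₁ : IsLocalExtension (fun c => j (g c))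
        (fun c => (restrictConormal hP hj hcos hg hcoi).ext c (σ c)) c α' := by
      refine ⟨⟨O, hO, hcO, hα'⟩, ?_⟩
      filter_upwards [hgU, hg.continuous.continuousAt.eventually eα'] with c' h1 h2
      rw [h2, eα c' h1]
      rfl
    have hβ₁ : IsLocalExtension (fun c => j (g c))
        (fun c => (restrictConormal hP hj hcos hg hcoi).ext c (τ c)) c β' := by
      refine ⟨⟨O, hO, hcO, hβ'⟩, ?_⟩
      filter_upwards [hgU, hg.continuous.continuousAt.eventually eβ'] with c' h1 h2
      rw [h2, eβ c' h1]
      rfl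
    have h1 := charBracket_apply_eq_koszul hf hP
      ((restrictConormal hP hj hcos hg hcoi).isSection_ext hσ)
      ((restrictConormal hP hj hcos hg hcoi).isSection_ext hτ) hα₁ hβ₁ hO hcO hZ'
    rw [eZ] at h1
    exact h1.trans hk

end Cosymplectic

end

theorem mainTheorem6
    {E : Type*} [NormedAddCommGroup E] [NormedSpace ℝ E] [FiniteDimensional ℝ E]
    {P : Type*} [TopologicalSpace P] [T2Space P] [SecondCountableTopology P]
    [ChartedSpace E P] [IsManifold 𝓘(ℝ, E) ∞ P]
    (sharp : ∀ x : P, Cot E x →L[ℝ] Tan E x) (hP : IsPoisson sharp)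
    {F : Type*} [NormedAddCommGroup F] [NormedSpace ℝ F] [FiniteDimensional ℝ F]
    {C : Type*} [TopologicalSpace C] [ChartedSpace F C] [IsManifold 𝓘(ℝ, F) ∞ C]
    (f : C → P) (hf : IsSmoothEmbedding 𝓘(ℝ, F) 𝓘(ℝ, E) ∞ f) :
    (IsLieSubalgebroid F sharp f (charConormal F sharp f) ↔ IsPrePoisson F sharp f) ∧
    (IsPrePoisson F sharp f →
      ∀ {G : Type*} [NormedAddCommGroup G] [NormedSpace ℝ G] [FiniteDimensional ℝ G]
        {Q : Type*} [TopologicalSpace Q] [ChartedSpace G Q] [IsManifold 𝓘(ℝ, G) ∞ Q]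
        (j : Q → P) (_ : IsSmoothEmbedding 𝓘(ℝ, G) 𝓘(ℝ, E) ∞ j)
        (g : C → Q) (_ : ∀ c, j (g c) = f c),
        IsCosymplectic G sharp j → IsCoisotropic F (inducedSharp (F := G) sharp j) g →
        ∃ (L : LieAlgebroid F f (charConormal F sharp f)) (L' : LieAlgebroid F g (conormal F g)),
          L.IsInduced sharp ∧ L'.IsInduced (inducedSharp (F := G) sharp j) ∧
          Nonempty (LieAlgebroid.Iso L L')) := by
  refine ⟨isLieSubalgebroid_charConormal_iff hf.isImmersion hP, ?_⟩
  intro _ G _ _ _ Q _ _ _ j hj g hg hcos hcoi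
  obtain rfl : (fun c => j (g c)) = f := funext hg
  -- A smooth map into P with values in the embedded submanifold Q is smooth into Q: continuity
  -- comes from the embedding and smoothness from the immersion.
  have hg' : ContMDiff 𝓘(ℝ, F) 𝓘(ℝ, G) ∞ g := (ContMDiff.iff_comp_isImmersion hj.isImmersion).2
    ⟨hj.isEmbedding.continuous_iff.2 hf.contMDiff.continuous, hf.contMDiff⟩
  exact ⟨_, _, isInduced_charAlgebroid hf.isImmersion hP,
    isInduced_transport hP hj.isImmersion hcos hg' hcoi hf.isImmersion,
    ⟨SubbundleEquiv.transportIso _ _⟩⟩
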